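/- Let $d\ge 1$ and write $|x|_1=\sum_i|x_i|$, $|x|_\infty=\max_i|x_i|$ for $x\in\mathbb Z^d$. Let $\mu$ be a probability measure on $\mathbb R$ with a bounded, compactly supported density $\rho\in L^\infty(\mathbb R)$, and let $\omega=(\omega_k)_{k\in\mathbb Z^d}$ be independent random variables with distribution $\mu$; $\mathbb E$ denotes the expectation with respect to the product measure. Let $u:\mathbb Z^d\to\mathbb R$ have finite support $\Theta=\operatorname{supp}u$ with $0\in\Theta$, and assume that $u(k)>0$ for all $k\in\partial^{\rm i}\Theta=\{k\in\Theta : \#\{j\in\Theta:|k-j|_1=1\}<2d\}$. For $\lambda>0$ consider on $\ell^2(\mathbb Z^d)$ the operator $$H_\omega=-\Delta+\lambda V_\omega,\qquad (\Delta\psi)(x)=\sum_{|e|_1=1}\psi(x+e),\qquad (V_\omega\psi)(x)=\Big(\sum_{k\in\mathbb Z^d}\omega_k\,u(x-k)\Big)\psi(x),$$ which is almost surely bounded and self-adjoint. For $\Gamma\subset\mathbb Z^d$ let $P_\Gamma:\ell^2(\mathbb Z^d)\to\ell^2(\Gamma)$ be the restriction map, $H_{\omega,\Gamma}=P_\Gamma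 H_\omega P_\Gamma^*$, and $G_{\omega,\Gamma}(z;x,y)=\langle\delta_x,(H_{\omega,\Gamma}-z)^{-1}\delta_y\rangle$ for $x,y\in\Gamma$, $z\in\mathbb C\setminus\mathbb R$. Let $s\in(0,1/3)$. Then there is $\lambda_0>0$, depending only on $d,\rho,u,s$, such that for every $\lambda\ge\lambda_0$ there are constants $A,\gamma>0$, depending only on $d,\rho,u,s,\lambda$, such that for all $\Gamma\subset\mathbb Z^d$, all $z\in\mathbb C\setminus\mathbb R$ and all $x,y\in\Gamma$ the random variable $|G_{\omega,\Gamma}(z;x,y)|^{s/(2|\Theta|)}$ is integrable and $$\mathbb E\big\{|G_{\omega,\Gamma}(z;x,y)|^{s/(2|\Theta|)}\big\}\le A\,e^{-\gamma|x-y|_\infty}.$$ -/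

import Mathlib

open MeasureTheory
open scoped ENNReal lp

noncomputable section

namespace AlloyModel

/-- The lattice `ℤ^d`. Its norm `‖x‖` is the sup-norm `max |x i|`. -/
abbrev Lattice (d : ℕ) : Type := Fin d → ℤ

/-- The `ℓ¹`-norm on the lattice. -/
def l1Norm {d : ℕ} (x : Lattice d) : ℤ := ∑ i, |x i|

/-- The interior boundary of a set `S`: the points of `S` that have
fewer than `2 d` nearest neighbours in `S`. -/
def interiorBoundary {d : ℕ} (S : Set (Lattice d)) : Set (Lattice d) :=
  {k | k ∈ S ∧ {j | j ∈ S ∧ l1Norm (k - j) = 1}.ncard < 2 * d}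

/-- The finite set of all lattice vectors of `ℓ¹`-norm one. -/
def unitVectors (d : ℕ) : Finset (Lattice d) :=
  (Finset.Icc (-1) 1).filter (fun e => l1Norm e = 1)

theorem mem_unitVectors {d : ℕ} (e : Lattice d) : e ∈ unitVectors d ↔ l1Norm e = 1 := by
  simp only [unitVectors, Finset.mem_filter, Finset.mem_Icc, and_iff_right_iff_imp]
  intro h
  have key : ∀ i, |e i| ≤ 1 := fun i => by
    rw [← h]
    exact Finset.single_le_sum (f := fun j => |e j|) (fun j _ => abs_nonneg _) (Finset.mem_univ i)
  exact ⟨fun i => (abs_le.1 (key i)).1, fun i => (abs_le.1 (key i)).2⟩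

theorem memℓp_comp {α β : Type} {f : α → β} (hf : Function.Injective f) (ψ : ℓ²(β, ℂ)) :
    Memℓp (fun a => ψ (f a)) 2 :=
  memℓp_gen (((lp.memℓp ψ).summable (by norm_num)).comp_injective hf)

/-- The bounded operator `ψ ↦ ψ ∘ f` from `ℓ²(β)` to `ℓ²(α)`, for an injective map `f : α → β`. -/
def compOp {α β : Type} (f : α → β) (hf : Function.Injective f) : ℓ²(β, ℂ) →L[ℂ] ℓ²(α, ℂ) :=
  LinearMap.mkContinuous
    { toFun := fun ψ => ⟨fun a => ψ (f a), memℓp_comp hf ψ⟩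
      map_add' := fun _ _ => rfl
      map_smul' := fun _ _ => rfl } 1 (fun ψ => by
        rw [one_mul]
        refine lp.norm_le_of_tsum_le (by norm_num) (norm_nonneg _) ?_
        rw [lp.norm_rpow_eq_tsum (by norm_num)]
        have hs : Summable fun b => ‖ψ b‖ ^ (2 : ℝ≥0∞).toReal :=
          (lp.memℓp ψ).summable (by norm_num)
        exact (hs.comp_injective hf).tsum_le_tsum_of_inj f hf
          (fun _ _ => by positivity) (fun _ => le_rfl) hs)

theorem compOp_apply {α β : Type} (f : α → β) (hf : Function.Injective f) (ψ : ℓ²(β, ℂ)) (a : α) :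
    compOp f hf ψ a = ψ (f a) := rfl

/-- The discrete Laplace operator on `ℓ²(ℤ^d)`, without diagonal term:
`(Δ ψ)(x)` is the sum of `ψ (x + e)` over all `e` of `ℓ¹`-norm one. -/
def laplacian (d : ℕ) : ℓ²(Lattice d, ℂ) →L[ℂ] ℓ²(Lattice d, ℂ) :=
  ∑ e ∈ unitVectors d, compOp (fun x => x + e) (add_left_injective e)

open scoped Classical in
/-- The multiplication operator by a bounded real function `v` on `ℓ²(α)`.
For an unbounded `v`, where there is no bounded multiplication operator, the value is `0`;
the random potential below is almost surely bounded. -/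
def mulOp {α : Type} (v : α → ℝ) : ℓ²(α, ℂ) →L[ℂ] ℓ²(α, ℂ) :=
  if h : ∃ K : ℝ, 0 ≤ K ∧ ∀ a, |v a| ≤ K then
    lp.mapCLM 2 (fun a => (v a : ℂ) • ContinuousLinearMap.id ℂ ℂ) h.choose_spec.1
      (fun a => by simpa [norm_smul] using h.choose_spec.2 a)
  else 0

theorem mulOp_apply {α : Type} {v : α → ℝ} {K : ℝ} (hK : ∀ a, |v a| ≤ K)
    (ψ : ℓ²(α, ℂ)) (a : α) : mulOp v ψ a = (v a : ℂ) * ψ a := by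
  have h : ∃ K : ℝ, 0 ≤ K ∧ ∀ a, |v a| ≤ K := ⟨K, (abs_nonneg _).trans (hK a), hK⟩
  rw [mulOp, dif_pos h]
  simp

/-- The alloy-type potential with single-site potential `u`:
`V_ω(x) = ∑ k, ω k * u (x - k)`. -/
def potential {d : ℕ} (u : Lattice d → ℝ) (ω : Lattice d → ℝ) (x : Lattice d) : ℝ :=
  ∑' k, ω k * u (x - k)

/-- The discrete alloy-type Hamiltonian `H_ω = -Δ + lam V_ω` on `ℓ²(ℤ^d)`. -/
def hamiltonian {d : ℕ} (u : Lattice d → ℝ) (lam : ℝ) (ω : Lattice d → ℝ) :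
    ℓ²(Lattice d, ℂ) →L[ℂ] ℓ²(Lattice d, ℂ) :=
  -laplacian d + (lam : ℂ) • mulOp (potential u ω)

/-- The restriction `P_Γ : ℓ²(ℤ^d) → ℓ²(Γ)`. -/
def proj {d : ℕ} (Γ : Set (Lattice d)) : ℓ²(Lattice d, ℂ) →L[ℂ] ℓ²(Γ, ℂ) :=
  compOp (fun x : Γ => (x : Lattice d)) Subtype.val_injective

/-- The restricted Hamiltonian `H_{ω,Γ} = P_Γ H_ω P_Γ^*` on `ℓ²(Γ)`. -/
def hamiltonianOn {d : ℕ} (u : Lattice d → ℝ) (lam : ℝ) (ω : Lattice d → ℝ)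
    (Γ : Set (Lattice d)) : ℓ²(Γ, ℂ) →L[ℂ] ℓ²(Γ, ℂ) :=
  (proj Γ).comp ((hamiltonian u lam ω).comp (ContinuousLinearMap.adjoint (proj Γ)))

open scoped Classical in
/-- The Green function `G_{ω,Γ}(z; x, y) = ⟨δ_x, (H_{ω,Γ} - z)⁻¹ δ_y⟩`. -/
def green {d : ℕ} (u : Lattice d → ℝ) (lam : ℝ) (ω : Lattice d → ℝ) (Γ : Set (Lattice d))
    (z : ℂ) (x y : Γ) : ℂ :=
  inner ℂ (lp.single 2 x (1 : ℂ) : ℓ²(Γ, ℂ))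
    (Ring.inverse (hamiltonianOn u lam ω Γ - z • ContinuousLinearMap.id ℂ ℓ²(Γ, ℂ))
      (lp.single 2 y (1 : ℂ)))

/-- The law of the i.i.d. family `ω = (ω_k)`, each `ω_k` with distribution `μ`. -/
def law (d : ℕ) (μ : Measure ℝ) : Measure (Lattice d → ℝ) :=
  Measure.infinitePi (fun _ : Lattice d => μ)

end AlloyModel

end

/-!
The argument is a fractional moment (Aizenman–Molchanov) iteration over the cells `b + supp u`.
Two independent averages enter.

* Varying the coupling constant `ω b` by `r` adds `lam * r * u (· - b)` to the potential, which
  vanishes nowhere on the cell of `b`. By the Schur complement formula the Green function on the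
  cell is an entry of `lam⁻¹ (A + r D)⁻¹` with an invertible diagonal matrix `D`, and Cramer's rule
  bounds it by the reciprocal of a polynomial in `r` of degree at most `|supp u|`, of which small
  powers are integrable. The matrix `A` contains the Green function `G'` outside the cell.
* Since `u` may change sign, `G'` cannot be averaged over a single coupling constant. Shifting
  `ω j` for all neighbours `j` of `b` simultaneously, however, adds a potential which is nonnegative
  outside the cell and positive on the shell of sites through which the cell feels `G'`: there the
  summands are values of `u` outside its support or on its interior boundary. Matrix elements of
  the resolvent between shell sites are then boundary values of functions of the shift with
  values in a half-plane, whose moments of order less than one are bounded uniformly.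

Leaving first the cell and then the shell of `x` bounds the fractional moment of `G(x, y)` by
`C * lam ^ (-τ)` times a sum of boundedly many fractional moments of Green functions from sites near
`x` to `y`, on a smaller region that neither average affects. For large `lam` the iteration of this
inequality gives exponential decay.
-/

noncomputable section

namespace AlloyModel

section Multiplication

variable {α : Type*}

open scoped Classical in
/-- The vector `δ_y` of the canonical orthonormal basis of `ℓ²(α)`. -/
def basisVec (y : α) : ℓ²(α, ℂ) := lp.single 2 y 1

open scoped Classical in
theorem basisVec_apply (y x : α) : basisVec y x = if x = y then 1 else 0 := by
  rw [basisVec, lp.single_apply, Pi.single_apply]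

theorem norm_basisVec (y : α) : ‖basisVec y‖ = 1 := by
  classical
  rw [basisVec, lp.norm_single (by norm_num), norm_one]

theorem inner_basisVec_left (x : α) (ψ : ℓ²(α, ℂ)) : inner ℂ (basisVec x) ψ = ψ x := by
  classical
  rw [basisVec, lp.inner_single_left]
  simp

theorem hasSum_norm_sq (ψ : ℓ²(α, ℂ)) : HasSum (fun x => ‖ψ x‖ ^ 2) (‖ψ‖ ^ 2) := by
  simpa using lp.hasSum_norm (p := 2) (by norm_num) ψ

theorem norm_le_of_forall_norm_apply_le {φ ψ : ℓ²(α, ℂ)} {K : ℝ} (hK : 0 ≤ K)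
    (h : ∀ x, ‖φ x‖ ≤ K * ‖ψ x‖) : ‖φ‖ ≤ K * ‖ψ‖ := by
  refine le_of_sq_le_sq ?_ (by positivity)
  rw [mul_pow]
  refine hasSum_le (fun x => ?_) (hasSum_norm_sq φ) ((hasSum_norm_sq ψ).mul_left (K ^ 2))
  rw [← mul_pow]
  exact pow_le_pow_left₀ (norm_nonneg _) (h x) 2

open scoped Classical in
/-- The multiplication operator by a bounded complex function `w` on `ℓ²(α)`; as for `mulOp`, the
value at an unbounded function is `0`. -/
def mulCLM (w : α → ℂ) : ℓ²(α, ℂ) →L[ℂ] ℓ²(α, ℂ) :=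
  if h : ∃ K : ℝ, 0 ≤ K ∧ ∀ x, ‖w x‖ ≤ K then
    lp.mapCLM 2 (fun x => w x • ContinuousLinearMap.id ℂ ℂ) h.choose_spec.1
      fun x => by simpa [norm_smul] using h.choose_spec.2 x
  else 0

theorem mulCLM_apply {w : α → ℂ} (hw : ∃ K : ℝ, ∀ x, ‖w x‖ ≤ K) (ψ : ℓ²(α, ℂ)) (x : α) :
    mulCLM w ψ x = w x * ψ x := by
  obtain ⟨K, hK⟩ := hw
  have h : ∃ K : ℝ, 0 ≤ K ∧ ∀ x, ‖w x‖ ≤ K := ⟨K, (norm_nonneg _).trans (hK x), hK⟩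
  rw [mulCLM, dif_pos h]
  simp

theorem mulOp_eq_mulCLM {α : Type} {v : α → ℝ} {K : ℝ} (hK : ∀ x, |v x| ≤ K) :
    mulOp v = mulCLM fun x => (v x : ℂ) := by
  ext ψ x
  rw [mulOp_apply hK, mulCLM_apply ⟨K, fun x => by simpa using hK x⟩]

theorem isSelfAdjoint_mulCLM_ofReal {v : α → ℝ} (hv : ∃ K : ℝ, ∀ x, ‖(v x : ℂ)‖ ≤ K) :
    IsSelfAdjoint (mulCLM fun x => (v x : ℂ)) := by
  rw [ContinuousLinearMap.isSelfAdjoint_iff', eq_comm, ContinuousLinearMap.eq_adjoint_iff]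
  intro φ ψ
  rw [lp.inner_eq_tsum, lp.inner_eq_tsum]
  refine tsum_congr fun x => ?_
  simp only [mulCLM_apply hv, RCLike.inner_apply, map_mul, Complex.conj_ofReal]
  ring

theorem continuous_mulCLM_apply {X : Type*} [TopologicalSpace X] {w : X → α → ℂ} {K : ℝ}
    (hK : ∀ t x, ‖w t x‖ ≤ K) (hcont : ∀ x, Continuous fun t => w t x) (ψ : ℓ²(α, ℂ)) :
    Continuous fun t => mulCLM (w t) ψ := by
  have happly (t : X) (x : α) : mulCLM (w t) ψ x = w t x * ψ x := mulCLM_apply ⟨K, hK t⟩ ψ x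
  have hsq (s t : X) : ‖mulCLM (w t) ψ - mulCLM (w s) ψ‖ ^ 2 =
      ∑' x, ‖w t x - w s x‖ ^ 2 * ‖ψ x‖ ^ 2 := by
    rw [← (hasSum_norm_sq _).tsum_eq]
    refine tsum_congr fun x => ?_
    rw [lp.coeFn_sub, Pi.sub_apply, happly, happly, ← sub_mul, norm_mul, mul_pow]
  refine continuous_iff_continuousAt.2 fun s => tendsto_iff_norm_sub_tendsto_zero.2 ?_
  suffices h : Filter.Tendsto (fun t => ‖mulCLM (w t) ψ - mulCLM (w s) ψ‖ ^ 2) (nhds s) (nhds 0) by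
    simpa using h.sqrt
  have hzero : (0 : ℝ) = ∑' x, ‖w s x - w s x‖ ^ 2 * ‖ψ x‖ ^ 2 := by simp
  simp only [hsq s]
  rw [hzero]
  refine tendsto_tsum_of_dominated_convergence (bound := fun x => (2 * K) ^ 2 * ‖ψ x‖ ^ 2)
    ((hasSum_norm_sq ψ).summable.mul_left _)
    (fun x => ((((hcont x).sub continuous_const).norm.pow 2).mul continuous_const).tendsto s)
    (.of_forall fun t x => ?_)
  rw [Real.norm_of_nonneg (by positivity)]
  gcongr
  linarith [norm_sub_le (w t x) (w s x), hK t x, hK s x]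

end Multiplication

section Cutoff

variable {α : Type*}

/-- The orthogonal projection `χ_Γ` of `ℓ²(α)` onto the functions that vanish off `Γ`. -/
def cutoff (Γ : Set α) : ℓ²(α, ℂ) →L[ℂ] ℓ²(α, ℂ) :=
  mulCLM fun x => ((Γ.indicator 1 x : ℝ) : ℂ)

theorem norm_indicator_one_le_one (Γ : Set α) (x : α) : ‖((Γ.indicator 1 x : ℝ) : ℂ)‖ ≤ 1 := by
  by_cases hx : x ∈ Γ <;> simp [hx]

open scoped Classical in
theorem cutoff_apply (Γ : Set α) (ψ : ℓ²(α, ℂ)) (x : α) :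
    cutoff Γ ψ x = if x ∈ Γ then ψ x else 0 := by
  rw [cutoff, mulCLM_apply ⟨1, norm_indicator_one_le_one Γ⟩]
  by_cases hx : x ∈ Γ <;> simp [hx]

theorem isSelfAdjoint_cutoff (Γ : Set α) : IsSelfAdjoint (cutoff Γ) :=
  isSelfAdjoint_mulCLM_ofReal ⟨1, norm_indicator_one_le_one Γ⟩

theorem norm_cutoff_le_one (Γ : Set α) : ‖cutoff Γ‖ ≤ 1 := by
  refine ContinuousLinearMap.opNorm_le_bound _ zero_le_one fun ψ =>
    norm_le_of_forall_norm_apply_le zero_le_one fun x => ?_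
  rw [cutoff_apply]
  split_ifs <;> simp

theorem cutoff_eq_self_iff {Γ : Set α} {ψ : ℓ²(α, ℂ)} : cutoff Γ ψ = ψ ↔ ∀ x ∉ Γ, ψ x = 0 := by
  refine ⟨fun h x hx => ?_, fun h => ?_⟩
  · rw [← h, cutoff_apply, if_neg hx]
  · ext x
    rw [cutoff_apply]
    split_ifs with hx
    exacts [rfl, (h x hx).symm]

theorem cutoff_cutoff (Γ : Set α) (ψ : ℓ²(α, ℂ)) : cutoff Γ (cutoff Γ ψ) = cutoff Γ ψ :=
  cutoff_eq_self_iff.2 fun x hx => by rw [cutoff_apply, if_neg hx]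

theorem cutoff_eq_self_of_subset {Γ Γ' : Set α} (hΓ : Γ' ⊆ Γ) {ψ : ℓ²(α, ℂ)}
    (hψ : cutoff Γ' ψ = ψ) : cutoff Γ ψ = ψ :=
  cutoff_eq_self_iff.2 fun x hx => cutoff_eq_self_iff.1 hψ x fun h => hx (hΓ h)

theorem cutoff_basisVec {Γ : Set α} {y : α} (hy : y ∈ Γ) : cutoff Γ (basisVec y) = basisVec y :=
  cutoff_eq_self_iff.2 fun x hx => by
    rw [basisVec_apply, if_neg (ne_of_mem_of_not_mem hy hx).symm]

theorem cutoff_basisVec_of_notMem {Γ : Set α} {y : α} (hy : y ∉ Γ) : cutoff Γ (basisVec y) = 0 := by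
  ext x
  rw [cutoff_apply, basisVec_apply]
  split_ifs with hx hxy
  exacts [absurd (hxy ▸ hx) hy, rfl, rfl]

theorem cutoff_add_cutoff_diff {Γ Γ' : Set α} (hΓ : Γ' ⊆ Γ) (ψ : ℓ²(α, ℂ)) :
    cutoff Γ' ψ + cutoff (Γ \ Γ') ψ = cutoff Γ ψ := by
  classical
  ext x
  simp only [lp.coeFn_add, Pi.add_apply, cutoff_apply]
  by_cases hx' : x ∈ Γ'
  · rw [if_pos hx', if_neg fun h => h.2 hx', if_pos (hΓ hx'), add_zero]
  · rw [if_neg hx', zero_add]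
    exact if_congr (and_iff_left hx') rfl rfl

theorem cutoff_coe_finset (S : Finset α) (ψ : ℓ²(α, ℂ)) :
    cutoff (S : Set α) ψ = ∑ k ∈ S, ψ k • basisVec k := by
  classical
  ext x
  rw [cutoff_apply, lp.coeFn_sum, Finset.sum_apply]
  simp [basisVec_apply]

end Cutoff

section Schrodinger

variable {α : Type*}

/-- The compression `χ_Γ T χ_Γ` of the operator `T` to `Γ`, extended by `0` off `Γ`. -/
def compression (T : ℓ²(α, ℂ) →L[ℂ] ℓ²(α, ℂ)) (Γ : Set α) : ℓ²(α, ℂ) →L[ℂ] ℓ²(α, ℂ) :=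
  cutoff Γ * T * cutoff Γ

/-- The Schrödinger operator `-χ_Γ T χ_Γ + w` with hopping operator `T` and complex potential `w`.
It acts on `ℓ²(α)` and not on `ℓ²(Γ)`, so that operators for different `Γ` can be compared; the
two components `Γ` and `Γᶜ` decouple. The spectral parameter is part of `w`. -/
def schrodinger (T : ℓ²(α, ℂ) →L[ℂ] ℓ²(α, ℂ)) (Γ : Set α) (w : α → ℂ) :
    ℓ²(α, ℂ) →L[ℂ] ℓ²(α, ℂ) :=
  -compression T Γ + mulCLM w

/-- The inverse `(-χ_Γ T χ_Γ + w)⁻¹`; it is `0` if the operator is not invertible. -/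
def schrodingerInv (T : ℓ²(α, ℂ) →L[ℂ] ℓ²(α, ℂ)) (Γ : Set α) (w : α → ℂ) :
    ℓ²(α, ℂ) →L[ℂ] ℓ²(α, ℂ) :=
  Ring.inverse (schrodinger T Γ w)

/-- The Green function `⟨δ_x, (-χ_Γ T χ_Γ + w)⁻¹ δ_y⟩`. -/
def greenKernel (T : ℓ²(α, ℂ) →L[ℂ] ℓ²(α, ℂ)) (Γ : Set α) (w : α → ℂ) (x y : α) : ℂ :=
  schrodingerInv T Γ w (basisVec y) x

/-- A bounded complex potential `w` is dissipative with constant `c > 0` if `c ≤ im w`. -/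
structure IsDissipative (c : ℝ) (w : α → ℂ) : Prop where
  pos : 0 < c
  bdd : ∃ K : ℝ, ∀ x, ‖w x‖ ≤ K
  le_im : ∀ x, c ≤ (w x).im

variable {T : ℓ²(α, ℂ) →L[ℂ] ℓ²(α, ℂ)} {Γ Γ' : Set α} {w : α → ℂ} {c : ℝ}

theorem isSelfAdjoint_compression (hT : IsSelfAdjoint T) (Γ : Set α) :
    IsSelfAdjoint (compression T Γ) := by
  simpa only [compression, (isSelfAdjoint_cutoff Γ).star_eq] using hT.conjugate (cutoff Γ)

theorem norm_compression_le (T : ℓ²(α, ℂ) →L[ℂ] ℓ²(α, ℂ)) (Γ : Set α) :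
    ‖compression T Γ‖ ≤ ‖T‖ :=
  calc ‖compression T Γ‖ ≤ ‖cutoff Γ‖ * ‖T‖ * ‖cutoff Γ‖ :=
        (norm_mul_le _ _).trans (mul_le_mul_of_nonneg_right (norm_mul_le _ _) (norm_nonneg _))
    _ ≤ 1 * ‖T‖ * 1 := by gcongr <;> exact norm_cutoff_le_one Γ
    _ = ‖T‖ := by ring

theorem hasSum_im_inner_schrodinger (hT : IsSelfAdjoint T) (hw : IsDissipative c w)
    (ψ : ℓ²(α, ℂ)) :
    HasSum (fun x => (w x).im * ‖ψ x‖ ^ 2) (inner ℂ ψ (schrodinger T Γ w ψ)).im := by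
  have hhop : (inner ℂ ψ (compression T Γ ψ)).im = 0 :=
    (isSelfAdjoint_compression hT Γ).isSymmetric.im_inner_self_apply ψ
  have him : (inner ℂ ψ (schrodinger T Γ w ψ)).im = (inner ℂ ψ (mulCLM w ψ)).im := by
    rw [schrodinger, add_apply, neg_apply, inner_add_right, inner_neg_right, Complex.add_im,
      Complex.neg_im, hhop, neg_zero, zero_add]
  rw [him]
  convert Complex.hasSum_im (lp.hasSum_inner ψ (mulCLM w ψ)) using 2 with x
  rw [mulCLM_apply hw.bdd, RCLike.inner_apply, mul_assoc, Complex.mul_conj,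
    Complex.normSq_eq_norm_sq, Complex.im_mul_ofReal]

theorem le_im_inner_schrodinger (hT : IsSelfAdjoint T) (hw : IsDissipative c w) (ψ : ℓ²(α, ℂ)) :
    c * ‖ψ‖ ^ 2 ≤ (inner ℂ ψ (schrodinger T Γ w ψ)).im :=
  hasSum_le (fun x => mul_le_mul_of_nonneg_right (hw.le_im x) (by positivity))
    ((hasSum_norm_sq ψ).mul_left c) (hasSum_im_inner_schrodinger hT hw ψ)

theorem isUnit_schrodinger (hT : IsSelfAdjoint T) (hw : IsDissipative c w) :
    IsUnit (schrodinger T Γ w) := by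
  refine ContinuousLinearMap.isUnit_of_forall_le_norm_inner_map _ (c := ⟨c, hw.pos.le⟩) hw.pos
    fun ψ => ?_
  rw [norm_inner_symm]
  exact (mul_comm _ _).le.trans
    ((le_im_inner_schrodinger hT hw ψ).trans ((le_abs_self _).trans (Complex.abs_im_le_norm _)))

theorem schrodinger_schrodingerInv (hT : IsSelfAdjoint T) (hw : IsDissipative c w)
    (ψ : ℓ²(α, ℂ)) : schrodinger T Γ w (schrodingerInv T Γ w ψ) = ψ :=
  DFunLike.congr_fun (Ring.mul_inverse_cancel _ (isUnit_schrodinger hT hw)) ψ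

theorem schrodingerInv_schrodinger (hT : IsSelfAdjoint T) (hw : IsDissipative c w)
    (ψ : ℓ²(α, ℂ)) : schrodingerInv T Γ w (schrodinger T Γ w ψ) = ψ :=
  DFunLike.congr_fun (Ring.inverse_mul_cancel _ (isUnit_schrodinger hT hw)) ψ

theorem norm_schrodingerInv_apply_le (hT : IsSelfAdjoint T) (hw : IsDissipative c w)
    (ψ : ℓ²(α, ℂ)) : ‖schrodingerInv T Γ w ψ‖ ≤ c⁻¹ * ‖ψ‖ := by
  set φ := schrodingerInv T Γ w ψ with hφ
  have hle : c * ‖φ‖ ^ 2 ≤ ‖φ‖ * ‖ψ‖ :=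
    calc c * ‖φ‖ ^ 2 ≤ (inner ℂ φ (schrodinger T Γ w φ)).im := le_im_inner_schrodinger hT hw φ
      _ = (inner ℂ φ ψ).im := by rw [hφ, schrodinger_schrodingerInv hT hw]
      _ ≤ ‖φ‖ * ‖ψ‖ :=
        (le_abs_self _).trans ((Complex.abs_im_le_norm _).trans (norm_inner_le_norm _ _))
  rw [inv_mul_eq_div, le_div_iff₀ hw.pos]
  rcases (norm_nonneg φ).eq_or_lt with h | h
  · simp [← h]
  · nlinarith

theorem norm_greenKernel_le (hT : IsSelfAdjoint T) (hw : IsDissipative c w) (x y : α) :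
    ‖greenKernel T Γ w x y‖ ≤ c⁻¹ := by
  refine (lp.norm_apply_le_norm two_ne_zero _ x).trans
    ((norm_schrodingerInv_apply_le hT hw _).trans_eq ?_)
  rw [norm_basisVec, mul_one]

theorem norm_greenKernel_le_of_le_norm {L : ℝ} (hT : IsSelfAdjoint T) (hw : IsDissipative c w)
    (hL : 0 < L) (h : ∀ x, L + ‖T‖ ≤ ‖w x‖) (x y : α) : ‖greenKernel T Γ w x y‖ ≤ L⁻¹ := by
  refine (lp.norm_apply_le_norm two_ne_zero _ x).trans ?_
  set ψ := schrodingerInv T Γ w (basisVec y) with hψ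
  have hmul : mulCLM w ψ = basisVec y + compression T Γ ψ := by
    rw [← schrodinger_schrodingerInv hT hw (Γ := Γ) (basisVec y), ← hψ, schrodinger, add_apply,
      neg_apply]
    abel
  have hpos : 0 < L + ‖T‖ := by positivity
  have hlower : ‖ψ‖ ≤ (L + ‖T‖)⁻¹ * ‖mulCLM w ψ‖ := by
    refine norm_le_of_forall_norm_apply_le (by positivity) fun x => ?_
    rw [mulCLM_apply hw.bdd, norm_mul, inv_mul_eq_div, le_div_iff₀ hpos, mul_comm]
    exact mul_le_mul_of_nonneg_right (h x) (norm_nonneg _)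
  have hupper : ‖mulCLM w ψ‖ ≤ 1 + ‖T‖ * ‖ψ‖ := by
    rw [hmul]
    exact (norm_add_le _ _).trans (add_le_add (norm_basisVec y).le
      ((compression T Γ).le_of_opNorm_le (norm_compression_le T Γ) ψ))
  rw [inv_mul_eq_div, le_div_iff₀ hpos] at hlower
  rw [inv_eq_one_div, le_div_iff₀ hL]
  linarith

theorem commute_cutoff_schrodinger (hw : ∃ K : ℝ, ∀ x, ‖w x‖ ≤ K) :
    Commute (cutoff Γ) (schrodinger T Γ w) := by
  ext ψ x
  simp only [mul_apply_eq_comp, schrodinger, compression, add_apply, neg_apply,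
    map_add, map_neg, lp.coeFn_add, lp.coeFn_neg, Pi.add_apply, Pi.neg_apply, cutoff_cutoff]
  congr 1
  simp [cutoff_apply, mulCLM_apply hw]

theorem cutoff_schrodingerInv (hw : ∃ K : ℝ, ∀ x, ‖w x‖ ≤ K) {φ : ℓ²(α, ℂ)}
    (hφ : cutoff Γ φ = φ) : cutoff Γ (schrodingerInv T Γ w φ) = schrodingerInv T Γ w φ := by
  have hcomm : Commute (cutoff Γ) (schrodingerInv T Γ w) := by
    rw [schrodingerInv]
    by_cases hunit : IsUnit (schrodinger T Γ w)
    · obtain ⟨A, hA⟩ := hunit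
      rw [← hA, Ring.inverse_unit]
      exact Commute.units_inv_right (hA ▸ commute_cutoff_schrodinger hw)
    · rw [Ring.inverse_non_unit _ hunit]
      exact Commute.zero_right _
  simpa only [mul_apply_eq_comp, hφ] using DFunLike.congr_fun hcomm.eq φ

theorem greenKernel_eq_zero (hw : ∃ K : ℝ, ∀ x, ‖w x‖ ≤ K) {x y : α} (hx : x ∉ Γ) (hy : y ∈ Γ) :
    greenKernel T Γ w x y = 0 :=
  cutoff_eq_self_iff.1 (cutoff_schrodingerInv hw (cutoff_basisVec hy)) x hx

theorem schrodingerInv_congr {c' : ℝ} {w' : α → ℂ} (hT : IsSelfAdjoint T) (hw : IsDissipative c w)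
    (hw' : IsDissipative c' w') (h : ∀ x ∈ Γ, w x = w' x) {φ : ℓ²(α, ℂ)} (hφ : cutoff Γ φ = φ) :
    schrodingerInv T Γ w φ = schrodingerInv T Γ w' φ := by
  set ψ := schrodingerInv T Γ w φ with hψ
  have hmul : mulCLM w ψ = mulCLM w' ψ := by
    ext k
    rw [mulCLM_apply hw.bdd, mulCLM_apply hw'.bdd]
    by_cases hk : k ∈ Γ
    · rw [h k hk]
    · rw [cutoff_eq_self_iff.1 (cutoff_schrodingerInv hw.bdd hφ) k hk, mul_zero, mul_zero]
  have hψ' : schrodinger T Γ w' ψ = φ := by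
    rw [schrodinger, add_apply, ← hmul, ← add_apply, ← schrodinger, hψ,
      schrodinger_schrodingerInv hT hw]
  rw [← hψ', schrodingerInv_schrodinger hT hw']

theorem greenKernel_congr {c' : ℝ} {w' : α → ℂ} (hT : IsSelfAdjoint T) (hw : IsDissipative c w)
    (hw' : IsDissipative c' w') (h : ∀ x ∈ Γ, w x = w' x) (x : α) {y : α} (hy : y ∈ Γ) :
    greenKernel T Γ w x y = greenKernel T Γ w' x y := by
  rw [greenKernel, schrodingerInv_congr hT hw hw' h (cutoff_basisVec hy), greenKernel]

theorem schrodinger_apply_of_subset (hΓ : Γ' ⊆ Γ) {ψ : ℓ²(α, ℂ)} (hψ : cutoff Γ' ψ = ψ) :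
    schrodinger T Γ w ψ = schrodinger T Γ' w ψ - cutoff (Γ \ Γ') (T ψ) := by
  simp only [schrodinger, compression, add_apply, neg_apply, mul_apply_eq_comp, hψ,
    cutoff_eq_self_of_subset hΓ hψ, ← cutoff_add_cutoff_diff hΓ (T ψ)]
  abel

theorem greenKernel_eq_add_sum (hΓ : Γ' ⊆ Γ) {S : Finset α} (hS : (S : Set α) = Γ \ Γ')
    (hT : IsSelfAdjoint T) (hw : IsDissipative c w) (x : α) {y : α} (hy : y ∈ Γ') :
    greenKernel T Γ w x y = greenKernel T Γ' w x y +
      ∑ k ∈ S, T (schrodingerInv T Γ' w (basisVec y)) k * greenKernel T Γ w x k := by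
  set ψ := schrodingerInv T Γ' w (basisVec y) with hψ
  have hschr : schrodinger T Γ w ψ = basisVec y - ∑ k ∈ S, T ψ k • basisVec k := by
    rw [schrodinger_apply_of_subset hΓ (cutoff_schrodingerInv hw.bdd (cutoff_basisVec hy)), hψ,
      schrodinger_schrodingerInv hT hw, ← hS, cutoff_coe_finset]
  have h := congrArg (fun φ => schrodingerInv T Γ w φ x) hschr
  simp only [schrodingerInv_schrodinger hT hw, map_sub, map_sum, map_smul, lp.coeFn_sub,
    lp.coeFn_sum, lp.coeFn_smul, Pi.sub_apply, Finset.sum_apply, Pi.smul_apply, smul_eq_mul] at h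
  exact sub_eq_iff_eq_add.1 h.symm

/-- The matrix elements of the Schur complement of the block `Γ'` in the operator
`-χ_Γ T χ_Γ + w`. They do not depend on the larger set `Γ`. -/
def schur (T : ℓ²(α, ℂ) →L[ℂ] ℓ²(α, ℂ)) (Γ' : Set α) (w : α → ℂ) (k y : α) : ℂ :=
  w y * basisVec y k - T (basisVec y) k -
    T (schrodingerInv T Γ' w (cutoff Γ' (T (basisVec y)))) k

theorem sum_greenKernel_mul_schur (hΓ : Γ' ⊆ Γ) {S : Finset α} (hS : (S : Set α) = Γ \ Γ')
    (hT : IsSelfAdjoint T) (hw : IsDissipative c w) {x y : α} (hx : x ∈ S) (hy : y ∈ S) :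
    ∑ k ∈ S, greenKernel T Γ w x k * schur T Γ' w k y = basisVec y x := by
  have hmem {k : α} (hk : k ∈ S) : k ∈ Γ \ Γ' := hS ▸ Finset.mem_coe.2 hk
  set η := schrodingerInv T Γ' w (cutoff Γ' (T (basisVec y))) with hη
  have hηΓ' : cutoff Γ' η = η := cutoff_schrodingerInv hw.bdd (cutoff_cutoff _ _)
  have hδ : schrodinger T Γ w (basisVec y) =
      w y • basisVec y - cutoff (Γ \ Γ') (T (basisVec y)) - cutoff Γ' (T (basisVec y)) := by
    have hmul : mulCLM w (basisVec y) = w y • basisVec y := by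
      ext k
      rw [mulCLM_apply hw.bdd, lp.coeFn_smul, Pi.smul_apply, smul_eq_mul, basisVec_apply]
      split_ifs with hk <;> simp [hk]
    simp only [schrodinger, compression, add_apply, neg_apply, mul_apply_eq_comp,
      cutoff_basisVec (hmem hy).1, ← cutoff_add_cutoff_diff hΓ (T (basisVec y)), hmul]
    abel
  have hkey : schrodinger T Γ w (basisVec y + η) = ∑ k ∈ S, schur T Γ' w k y • basisVec k := by
    rw [map_add, hδ, schrodinger_apply_of_subset hΓ hηΓ', hη, schrodinger_schrodingerInv hT hw,
      ← hη]
    trans cutoff (S : Set α) (w y • basisVec y - T (basisVec y) - T η)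
    · rw [map_sub, map_sub, map_smul, cutoff_basisVec (Finset.mem_coe.2 hy), hS]
      abel
    · exact cutoff_coe_finset S _
  have h := congrArg (fun φ => schrodingerInv T Γ w φ x) hkey
  simp only [schrodingerInv_schrodinger hT hw, map_sum, map_smul, lp.coeFn_add, lp.coeFn_sum,
    lp.coeFn_smul, Pi.add_apply, Finset.sum_apply, Pi.smul_apply, smul_eq_mul,
    cutoff_eq_self_iff.1 hηΓ' x (hmem hx).2, add_zero] at h
  rw [h]
  exact Finset.sum_congr rfl fun k _ => mul_comm _ _

theorem of_greenKernel_mul_of_schur [DecidableEq α] (hΓ : Γ' ⊆ Γ) {S : Finset α}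
    (hS : (S : Set α) = Γ \ Γ') (hT : IsSelfAdjoint T) (hw : IsDissipative c w) :
    (Matrix.of fun k l : S => greenKernel T Γ w k l) * (Matrix.of fun k l : S => schur T Γ' w k l) =
      1 := by
  ext k l
  simp only [Matrix.mul_apply, Matrix.of_apply, Matrix.one_apply]
  rw [Finset.sum_coe_sort S fun i => greenKernel T Γ w k i * schur T Γ' w i l,
    sum_greenKernel_mul_schur hΓ hS hT hw k.2 l.2, basisVec_apply]
  by_cases hkl : k = l
  · rw [if_pos hkl, if_pos (congrArg _ hkl)]
  · rw [if_neg hkl, if_neg (Subtype.coe_ne_coe.2 hkl)]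

theorem schur_add {c' : ℝ} {v : α → ℂ} (hT : IsSelfAdjoint T) (hw : IsDissipative c w)
    (hwv : IsDissipative c' fun k => w k + v k) (hv : ∀ k ∈ Γ', v k = 0) (k l : α) :
    schur T Γ' (fun k => w k + v k) k l = schur T Γ' w k l + v l * basisVec l k := by
  rw [schur, schur, schrodingerInv_congr hT hwv hw (fun k hk => by rw [hv k hk, add_zero])
    (cutoff_cutoff _ _)]
  ring

theorem continuous_schrodingerInv_apply (hT : IsSelfAdjoint T) (Γ : Set α) {X : Type*}
    [TopologicalSpace X] {w : X → α → ℂ} {K : ℝ} (hw : ∀ t, IsDissipative c (w t))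
    (hK : ∀ t x, ‖w t x‖ ≤ K) (hcont : ∀ x, Continuous fun t => w t x) (φ : ℓ²(α, ℂ)) :
    Continuous fun t => schrodingerInv T Γ (w t) φ := by
  refine continuous_iff_continuousAt.2 fun s => tendsto_iff_norm_sub_tendsto_zero.2 ?_
  set ψ := schrodingerInv T Γ (w s) φ with hψ
  have hdiff (t : X) : schrodingerInv T Γ (w t) φ - ψ =
      -schrodingerInv T Γ (w t) (mulCLM (w t) ψ - mulCLM (w s) ψ) := by
    have hschr : mulCLM (w t) ψ - mulCLM (w s) ψ =
        schrodinger T Γ (w t) ψ - schrodinger T Γ (w s) ψ := by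
      simp only [schrodinger, add_apply]
      abel
    rw [hschr, map_sub, schrodingerInv_schrodinger hT (hw t), hψ,
      schrodinger_schrodingerInv hT (hw s), neg_sub]
  have hmul : Filter.Tendsto (fun t => c⁻¹ * ‖mulCLM (w t) ψ - mulCLM (w s) ψ‖) (nhds s)
      (nhds 0) := by
    have h := (continuous_mulCLM_apply hK hcont ψ).tendsto s
    simpa using (tendsto_iff_norm_sub_tendsto_zero.1 h).const_mul c⁻¹
  refine squeeze_zero (fun _ => norm_nonneg _) (fun t => ?_) hmul
  rw [hdiff, norm_neg]
  exact norm_schrodingerInv_apply_le hT (hw t) _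

theorem continuous_greenKernel (hT : IsSelfAdjoint T) (Γ : Set α) {X : Type*}
    [TopologicalSpace X] {w : X → α → ℂ} {K : ℝ} (hw : ∀ t, IsDissipative c (w t))
    (hK : ∀ t x, ‖w t x‖ ≤ K) (hcont : ∀ x, Continuous fun t => w t x) (x y : α) :
    Continuous fun t => greenKernel T Γ (w t) x y :=
  (lp.evalCLM ℂ (fun _ : α => ℂ) 2 x).continuous.comp
    (continuous_schrodingerInv_apply hT Γ hw hK hcont (basisVec y))

end Schrodinger

section HalfPlane

theorem cos_pi_mul_div_two_pos {p : ℝ} (hp₀ : 0 < p) (hp₁ : p < 1) :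
    0 < Real.cos (Real.pi * p / 2) := by
  refine Real.cos_pos_of_mem_Ioo ⟨?_, ?_⟩ <;> nlinarith [Real.pi_pos]

theorem cos_mul_norm_rpow_le_re_cpow {z : ℂ} {p : ℝ} (hp₀ : 0 < p) (hp₁ : p < 1)
    (hz : 0 ≤ z.re) : Real.cos (Real.pi * p / 2) * ‖z‖ ^ p ≤ (z ^ (p : ℂ)).re := by
  have harg : |z.arg| ≤ Real.pi / 2 := Complex.abs_arg_le_pi_div_two_iff.2 hz
  rw [Complex.cpow_ofReal_re, mul_comm (Real.cos _), ← Real.cos_abs (z.arg * p), abs_mul,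
    abs_of_pos hp₀]
  refine mul_le_mul_of_nonneg_left ?_ (Real.rpow_nonneg (norm_nonneg z) p)
  refine Real.cos_le_cos_of_nonneg_of_le_pi (by positivity) ?_ ?_ <;> nlinarith [Real.pi_pos]

variable {f F : ℂ → ℂ} {a p R : ℝ}

theorem integral_real_eq_of_differentiableAt (hR : 0 ≤ R)
    (hd : ∀ ζ : ℂ, 0 ≤ ζ.im → DifferentiableAt ℂ f ζ) :
    ∫ t in (-R)..R, f t = (∫ t in (-R)..R, f (t + R * Complex.I)) -
      Complex.I * (∫ y in (0 : ℝ)..R, f (R + y * Complex.I)) +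
      Complex.I * ∫ y in (0 : ℝ)..R, f ((-R : ℝ) + y * Complex.I) := by
  have hrect := Complex.integral_boundary_rect_eq_zero_of_differentiableOn f
    ((-R : ℝ) : ℂ) ((R : ℂ) + R * Complex.I) fun ζ hζ => (hd ζ ?_).differentiableWithinAt
  · simp only [Complex.ofReal_re, Complex.ofReal_im, Complex.add_re, Complex.add_im,
      Complex.mul_re, Complex.mul_im, Complex.I_re, Complex.I_im, mul_zero, mul_one, sub_zero,
      zero_add, add_zero, zero_mul, Complex.ofReal_zero, smul_eq_mul] at hrect
    linear_combination hrect
  · have him := hζ.2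
    simp only [Set.mem_preimage, Complex.ofReal_im, Complex.add_im, Complex.mul_im,
      Complex.ofReal_re, Complex.I_im, Complex.I_re, mul_one, mul_zero, add_zero, zero_add,
      Set.uIcc_of_le hR, Set.mem_Icc] at him
    exact him.1

theorem norm_integral_vertical_le (hp₁ : p < 1) (hR : 0 ≤ R)
    (hf : ∀ ζ : ℂ, 0 < ζ.im → ‖f ζ‖ ≤ a * ζ.im ^ (-p)) (x : ℝ) :
    ‖∫ y in (0 : ℝ)..R, f (x + y * Complex.I)‖ ≤ a * R ^ (1 - p) / (1 - p) := by
  have hint : IntervalIntegrable (fun y : ℝ => a * y ^ (-p)) volume 0 R :=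
    (intervalIntegral.intervalIntegrable_rpow' (by linarith)).const_mul _
  calc ‖∫ y in (0 : ℝ)..R, f (x + y * Complex.I)‖ ≤ ∫ y in (0 : ℝ)..R, a * y ^ (-p) := by
        refine intervalIntegral.norm_integral_le_of_norm_le hR
          (Filter.Eventually.of_forall fun y hy => ?_) hint
        simpa using hf (x + y * Complex.I) (by simpa using hy.1)
    _ = a * R ^ (1 - p) / (1 - p) := by
        rw [intervalIntegral.integral_const_mul, integral_rpow (Or.inl (by linarith)),
          neg_add_eq_sub, Real.zero_rpow (by linarith), sub_zero, mul_div_assoc]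

theorem norm_integral_horizontal_le (hR : 0 < R)
    (hf : ∀ ζ : ℂ, 0 < ζ.im → ‖f ζ‖ ≤ a * ζ.im ^ (-p)) :
    ‖∫ t in (-R)..R, f (t + R * Complex.I)‖ ≤ 2 * (a * R ^ (1 - p)) := by
  refine (intervalIntegral.norm_integral_le_of_norm_le_const (C := a * R ^ (-p))
    fun t _ => ?_).trans_eq ?_
  · simpa using hf (t + R * Complex.I) (by simpa using hR)
  · rw [sub_neg_eq_add, abs_of_pos (by linarith), show 1 - p = -p + 1 by ring,
      Real.rpow_add_one hR.ne']
    ring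

theorem norm_integral_le_of_norm_le_im_rpow (hp₁ : p < 1) (hR : 0 < R)
    (hd : ∀ ζ : ℂ, 0 ≤ ζ.im → DifferentiableAt ℂ f ζ)
    (hf : ∀ ζ : ℂ, 0 < ζ.im → ‖f ζ‖ ≤ a * ζ.im ^ (-p)) :
    ‖∫ t in (-R)..R, f t‖ ≤ (2 + 2 / (1 - p)) * (a * R ^ (1 - p)) := by
  rw [integral_real_eq_of_differentiableAt hR.le hd]
  refine (norm_add_le _ _).trans ((add_le_add (norm_sub_le _ _) le_rfl).trans ?_)
  rw [norm_mul, norm_mul, Complex.norm_I, one_mul, one_mul]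
  have hright := norm_integral_vertical_le hp₁ hR.le hf R
  have hleft := norm_integral_vertical_le hp₁ hR.le hf (-R)
  have htop := norm_integral_horizontal_le hR hf
  refine (add_le_add (add_le_add htop hright) hleft).trans_eq ?_
  ring

/-- The constant in the bound on the `p`-th moment of the boundary values of an analytic function
on the upper half-plane with positive real part: the numerator bounds the contour integral, the
denominator is the smallest value of `re (z ^ p)` for `|z| = 1` and `0 ≤ re z`. -/
def halfPlaneConst (p : ℝ) : ℝ :=
  (2 + 2 / (1 - p)) / Real.cos (Real.pi * p / 2)

theorem integral_norm_rpow_le_of_re_pos (hp₀ : 0 < p) (hp₁ : p < 1) (ha : 0 ≤ a) (hR : 0 < R)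
    (hd : ∀ ζ : ℂ, 0 ≤ ζ.im → DifferentiableAt ℂ F ζ)
    (hre : ∀ ζ : ℂ, 0 ≤ ζ.im → 0 < (F ζ).re) (hF : ∀ ζ : ℂ, 0 < ζ.im → ‖F ζ‖ ≤ a / ζ.im) :
    ∫ t in (-R)..R, ‖F t‖ ^ p ≤ halfPlaneConst p * (a ^ p * R ^ (1 - p)) := by
  set f : ℂ → ℂ := fun ζ => F ζ ^ (p : ℂ) with hf
  have hfd : ∀ ζ : ℂ, 0 ≤ ζ.im → DifferentiableAt ℂ f ζ := fun ζ hζ =>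
    (hd ζ hζ).cpow_const (Or.inl (hre ζ hζ))
  have hfle : ∀ ζ : ℂ, 0 < ζ.im → ‖f ζ‖ ≤ a ^ p * ζ.im ^ (-p) := fun ζ hζ => by
    rw [Complex.norm_cpow_real, Real.rpow_neg hζ.le, ← div_eq_mul_inv,
      ← Real.div_rpow ha hζ.le]
    exact Real.rpow_le_rpow (norm_nonneg _) (hF ζ hζ) hp₀.le
  have hcont : Continuous fun t : ℝ => f t := continuous_iff_continuousAt.2 fun t =>
    ContinuousAt.comp (f := fun t : ℝ => (t : ℂ)) (hfd t (by simp)).continuousAt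
      Complex.continuous_ofReal.continuousAt
  have hcos := cos_pi_mul_div_two_pos hp₀ hp₁
  rw [halfPlaneConst, div_mul_eq_mul_div, le_div_iff₀' hcos]
  calc Real.cos (Real.pi * p / 2) * ∫ t in (-R)..R, ‖F t‖ ^ p
      = ∫ t in (-R)..R, Real.cos (Real.pi * p / 2) * ‖f t‖ := by
        simp only [intervalIntegral.integral_const_mul, hf, Complex.norm_cpow_real]
    _ ≤ ∫ t in (-R)..R, (f t).re := by
        refine intervalIntegral.integral_mono_on (by linarith)
          (continuous_const.mul hcont.norm).continuousOn.intervalIntegrable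
          (Complex.continuous_re.comp hcont).continuousOn.intervalIntegrable fun t _ => ?_
        rw [hf, Complex.norm_cpow_real]
        exact cos_mul_norm_rpow_le_re_cpow hp₀ hp₁ (hre t (by simp)).le
    _ = (∫ t in (-R)..R, f t).re :=
        Complex.reCLM.intervalIntegral_comp_comm hcont.continuousOn.intervalIntegrable
    _ ≤ (2 + 2 / (1 - p)) * (a ^ p * R ^ (1 - p)) :=
        (Complex.re_le_norm _).trans (norm_integral_le_of_norm_le_im_rpow hp₁ hR hfd hfle)

theorem lintegral_enorm_rpow_le_of_re_pos (hp₀ : 0 < p) (hp₁ : p < 1) (ha : 0 ≤ a) (hR : 0 < R)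
    (hd : ∀ ζ : ℂ, 0 ≤ ζ.im → DifferentiableAt ℂ F ζ)
    (hre : ∀ ζ : ℂ, 0 ≤ ζ.im → 0 < (F ζ).re) (hF : ∀ ζ : ℂ, 0 < ζ.im → ‖F ζ‖ ≤ a / ζ.im) :
    ∫⁻ t in Set.Icc (-R) R, ‖F (t : ℝ)‖ₑ ^ p ≤
      ENNReal.ofReal (halfPlaneConst p * (a ^ p * R ^ (1 - p))) := by
  have hcont : Continuous fun t : ℝ => ‖F t‖ ^ p :=
    (continuous_iff_continuousAt.2 fun t =>
      ContinuousAt.comp (f := fun t : ℝ => (t : ℂ)) (hd t (by simp)).continuousAt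
        Complex.continuous_ofReal.continuousAt).norm.rpow_const fun _ => Or.inr hp₀.le
  calc ∫⁻ t in Set.Icc (-R) R, ‖F (t : ℝ)‖ₑ ^ p
      = ∫⁻ t in Set.Icc (-R) R, ENNReal.ofReal (‖F (t : ℝ)‖ ^ p) := by
        simp only [← ENNReal.ofReal_rpow_of_nonneg (norm_nonneg _) hp₀.le, ofReal_norm]
    _ = ENNReal.ofReal (∫ t in (-R)..R, ‖F t‖ ^ p) := by
        rw [← ofReal_integral_eq_lintegral_ofReal hcont.continuousOn.integrableOn_Icc
          (Filter.Eventually.of_forall fun t => by positivity),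
          integral_Icc_eq_integral_Ioc, ← intervalIntegral.integral_of_le (by linarith)]
    _ ≤ _ := ENNReal.ofReal_le_ofReal
        (integral_norm_rpow_le_of_re_pos hp₀ hp₁ ha hR hd hre hF)

end HalfPlane

section MonotoneAveraging

variable {α : Type*} {T : ℓ²(α, ℂ) →L[ℂ] ℓ²(α, ℂ)} {Γ J : Set α} {w : α → ℂ} {U : α → ℝ}
  {c m p R : ℝ} {φ : ℓ²(α, ℂ)}

theorem IsDissipative.add_mul (hw : IsDissipative c w) (hU : ∀ x, 0 ≤ U x)
    (hB : ∃ B : ℝ, ∀ x, U x ≤ B) {ζ : ℂ} (hζ : 0 ≤ ζ.im) :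
    IsDissipative c fun x => w x + ζ * U x := by
  obtain ⟨K, hK⟩ := hw.bdd
  obtain ⟨B, hB⟩ := hB
  refine ⟨hw.pos, ⟨K + ‖ζ‖ * B, fun x => ?_⟩, fun x => ?_⟩
  · refine (norm_add_le _ _).trans (add_le_add (hK x) ?_)
    rw [norm_mul, Complex.norm_of_nonneg (hU x)]
    exact mul_le_mul_of_nonneg_left (hB x) (norm_nonneg _)
  · rw [Complex.add_im, Complex.im_mul_ofReal]
    have := mul_nonneg hζ (hU x)
    linarith [hw.le_im x]

theorem schrodinger_add_mul (hw : ∃ K : ℝ, ∀ x, ‖w x‖ ≤ K)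
    (hU : ∃ B : ℝ, ∀ x, ‖(U x : ℂ)‖ ≤ B) (ζ : ℂ) :
    schrodinger T Γ (fun x => w x + ζ * U x) =
      schrodinger T Γ w + ζ • mulCLM fun x => (U x : ℂ) := by
  obtain ⟨K, hK⟩ := hw
  obtain ⟨B, hB⟩ := hU
  have hbdd : ∀ x, ‖w x + ζ * U x‖ ≤ K + ‖ζ‖ * B := fun x => by
    refine (norm_add_le _ _).trans (add_le_add (hK x) ?_)
    rw [norm_mul]
    exact mul_le_mul_of_nonneg_left (hB x) (norm_nonneg _)
  rw [schrodinger, schrodinger, add_assoc]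
  congr 1
  ext ψ x
  rw [add_apply, lp.coeFn_add, Pi.add_apply, smul_apply, lp.coeFn_smul, Pi.smul_apply,
    mulCLM_apply ⟨K, hK⟩, mulCLM_apply ⟨B, hB⟩, mulCLM_apply ⟨_, hbdd⟩, smul_eq_mul]
  ring

theorem differentiableAt_schrodingerInv (hT : IsSelfAdjoint T) (hw : IsDissipative c w)
    (hU : ∀ x, 0 ≤ U x) (hB : ∃ B : ℝ, ∀ x, U x ≤ B) {ζ : ℂ} (hζ : 0 ≤ ζ.im) :
    DifferentiableAt ℂ (fun ζ : ℂ => schrodingerInv T Γ fun x => w x + ζ * U x) ζ := by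
  have hadd := schrodinger_add_mul (T := T) (Γ := Γ) (U := U) hw.bdd
    (hB.imp fun B hB x => (Complex.norm_of_nonneg (hU x)).trans_le (hB x))
  have hunit := isUnit_schrodinger (Γ := Γ) hT (hw.add_mul hU hB hζ)
  rw [hadd] at hunit
  simp only [schrodingerInv, hadd]
  exact DifferentiableAt.inverse
    ((differentiableAt_const _).add (differentiableAt_id.smul_const _)) hunit

theorem im_inner_schrodingerInv_pos (hT : IsSelfAdjoint T) (hw : IsDissipative c w)
    (hφ : φ ≠ 0) : 0 < (inner ℂ (schrodingerInv T Γ w φ) φ).im := by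
  set ψ := schrodingerInv T Γ w φ
  have hψφ : schrodinger T Γ w ψ = φ := schrodinger_schrodingerInv hT hw φ
  have hψ₀ : ψ ≠ 0 := fun h => hφ (by rw [← hψφ, h, map_zero])
  rw [← hψφ]
  exact (mul_pos hw.pos (pow_pos (norm_pos_iff.2 hψ₀) 2)).trans_le
    (le_im_inner_schrodinger hT hw ψ)

theorem norm_inner_schrodingerInv_le (hT : IsSelfAdjoint T) (hw : IsDissipative c w) (hm : 0 < m)
    (hJ : ∀ x ∈ J, m ≤ (w x).im) (hφ : cutoff J φ = φ) :
    ‖inner ℂ (schrodingerInv T Γ w φ) φ‖ ≤ ‖φ‖ ^ 2 / m := by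
  set ψ := schrodingerInv T Γ w φ with hψ
  have hlower : m * ‖cutoff J ψ‖ ^ 2 ≤ (inner ℂ ψ φ).im := by
    have hsum := hasSum_im_inner_schrodinger (Γ := Γ) hT hw ψ
    rw [hψ, schrodinger_schrodingerInv hT hw, ← hψ] at hsum
    refine hasSum_le (fun x => ?_) ((hasSum_norm_sq (cutoff J ψ)).mul_left m) hsum
    rw [cutoff_apply]
    split_ifs with hx
    · exact mul_le_mul_of_nonneg_right (hJ x hx) (by positivity)
    · rw [norm_zero]
      have := mul_nonneg (hw.pos.le.trans (hw.le_im x)) (sq_nonneg ‖ψ x‖)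
      simpa using this
  have hupper : ‖inner ℂ ψ φ‖ ≤ ‖cutoff J ψ‖ * ‖φ‖ := by
    have hcut : inner ℂ ψ φ = inner ℂ (cutoff J ψ) φ := by
      nth_rw 1 [← hφ]
      exact ((isSelfAdjoint_cutoff J).isSymmetric ψ φ).symm
    rw [hcut]
    exact norm_inner_le_norm _ _
  have him : (inner ℂ ψ φ).im ≤ ‖inner ℂ ψ φ‖ :=
    (le_abs_self _).trans (Complex.abs_im_le_norm _)
  have hcut : m * ‖cutoff J ψ‖ ≤ ‖φ‖ := by
    rcases (norm_nonneg (cutoff J ψ)).eq_or_lt with h | h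
    · simp [← h]
    · nlinarith
  rw [le_div_iff₀ hm]
  nlinarith [norm_nonneg φ]

theorem lintegral_inner_schrodingerInv_le (hT : IsSelfAdjoint T) (hw : IsDissipative c w)
    (hU : ∀ x, 0 ≤ U x) (hB : ∃ B : ℝ, ∀ x, U x ≤ B) (hm : 0 < m) (hJ : ∀ x ∈ J, m ≤ U x)
    (hp₀ : 0 < p) (hp₁ : p < 1) (hR : 0 < R) (hφ : cutoff J φ = φ) :
    ∫⁻ t in Set.Icc (-R) R,
        ‖inner ℂ (schrodingerInv T Γ (fun x => w x + (t : ℂ) * U x) φ) φ‖ₑ ^ p ≤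
      ENNReal.ofReal (halfPlaneConst p * ((‖φ‖ ^ 2 / m) ^ p * R ^ (1 - p))) := by
  rcases eq_or_ne φ 0 with rfl | hφ₀
  · simp [hp₀]
  set F : ℂ → ℂ := fun ζ =>
    Complex.I * inner ℂ φ (schrodingerInv T Γ (fun x => w x + ζ * U x) φ) with hF
  have hnorm : ∀ ζ : ℂ,
      ‖F ζ‖ = ‖inner ℂ (schrodingerInv T Γ (fun x => w x + ζ * U x) φ) φ‖ := fun ζ => by
    rw [hF, norm_mul, Complex.norm_I, one_mul, norm_inner_symm]
  have hd : ∀ ζ : ℂ, 0 ≤ ζ.im → DifferentiableAt ℂ F ζ := fun ζ hζ =>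
    (((innerSL ℂ φ).differentiableAt).comp ζ ((differentiableAt_schrodingerInv hT hw hU hB
      hζ).clm_apply (differentiableAt_const φ))).const_mul Complex.I
  have hre : ∀ ζ : ℂ, 0 ≤ ζ.im → 0 < (F ζ).re := fun ζ hζ => by
    have hpos := im_inner_schrodingerInv_pos (Γ := Γ) hT (hw.add_mul hU hB hζ) hφ₀
    rwa [← inner_conj_symm, Complex.conj_im, ← Complex.I_mul_re] at hpos
  have hle : ∀ ζ : ℂ, 0 < ζ.im → ‖F ζ‖ ≤ (‖φ‖ ^ 2 / m) / ζ.im := fun ζ hζ => by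
    rw [hnorm, div_div]
    refine norm_inner_schrodingerInv_le hT (hw.add_mul hU hB hζ.le) (mul_pos hm hζ)
      (fun x hx => ?_) hφ
    rw [Complex.add_im, Complex.im_mul_ofReal, mul_comm]
    have := mul_le_mul_of_nonneg_left (hJ x hx) hζ.le
    linarith [hw.pos.le.trans (hw.le_im x)]
  simp only [← ofReal_norm, ← hnorm]
  simpa only [ofReal_norm] using
    lintegral_enorm_rpow_le_of_re_pos hp₀ hp₁ (by positivity) hR hd hre hle

theorem ennreal_sum_rpow_le {ι : Type*} (s : Finset ι) (f : ι → ℝ≥0∞) (hp₀ : 0 < p)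
    (hp₁ : p ≤ 1) : (∑ i ∈ s, f i) ^ p ≤ ∑ i ∈ s, f i ^ p :=
  Finset.le_sum_of_subadditive (· ^ p) (ENNReal.zero_rpow_of_pos hp₀).le
    (fun a b => ENNReal.rpow_add_le_add_rpow a b hp₀.le hp₁) s f

theorem enorm_inner_map_rpow_le {V : Type*} [NormedAddCommGroup V] [InnerProductSpace ℂ V]
    (A : V →L[ℂ] V) (x y : V) (hp₀ : 0 < p) (hp₁ : p ≤ 1) :
    ‖inner ℂ x (A y)‖ₑ ^ p ≤ ∑ k ∈ Finset.range 4,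
      ‖inner ℂ (A (x + Complex.I ^ k • y)) (x + Complex.I ^ k • y)‖ₑ ^ p := by
  refine le_trans (ENNReal.rpow_le_rpow ?_ hp₀.le) (ennreal_sum_rpow_le _ _ hp₀ hp₁)
  have hpol := inner_map_polarization A.toLinearMap x y
  simp only [ContinuousLinearMap.coe_coe] at hpol
  have hsymm : ‖inner ℂ x (A y)‖ₑ = ‖inner ℂ (A y) x‖ₑ := by
    rw [← ofReal_norm, ← ofReal_norm, norm_inner_symm]
  have hI : Complex.I ^ 3 = -Complex.I := by rw [pow_succ, Complex.I_sq, neg_one_mul]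
  have henormI : ‖Complex.I‖ₑ = 1 := by rw [← ofReal_norm, Complex.norm_I, ENNReal.ofReal_one]
  have hquarter : ∀ v : ℂ, ‖v / 4‖ₑ ≤ ‖v‖ₑ := fun v => enorm_le_iff_norm_le.2 <| by
    rw [norm_div, Complex.norm_ofNat]
    linarith [norm_nonneg v]
  have htri : ∀ a b u v : ℂ, ‖a - b + Complex.I * u - Complex.I * v‖ₑ ≤
      ‖a‖ₑ + ‖u‖ₑ + ‖b‖ₑ + ‖v‖ₑ := fun a b u v =>
    calc ‖a - b + Complex.I * u - Complex.I * v‖ₑ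
        ≤ ‖a‖ₑ + ‖b‖ₑ + ‖Complex.I * u‖ₑ + ‖Complex.I * v‖ₑ := by
          refine enorm_sub_le.trans (add_le_add ((enorm_add_le _ _).trans ?_) le_rfl)
          exact add_le_add enorm_sub_le le_rfl
      _ = ‖a‖ₑ + ‖u‖ₑ + ‖b‖ₑ + ‖v‖ₑ := by
          rw [enorm_mul, enorm_mul, henormI, one_mul, one_mul]
          ring
  rw [hsymm, hpol]
  refine (hquarter _).trans ((htri _ _ _ _).trans_eq ?_)
  simp only [Finset.sum_range_succ, Finset.sum_range_zero, zero_add, pow_zero, pow_one, one_smul,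
    Complex.I_sq, hI, neg_smul, ← sub_eq_add_neg]

theorem continuous_inner_schrodingerInv (hT : IsSelfAdjoint T) (hw : IsDissipative c w)
    (hU : ∀ x, 0 ≤ U x) (hB : ∃ B : ℝ, ∀ x, U x ≤ B) (φ : ℓ²(α, ℂ)) : Continuous fun t : ℝ =>
      inner ℂ (schrodingerInv T Γ (fun x => w x + (t : ℂ) * U x) φ) φ :=
  continuous_iff_continuousAt.2 fun t => ContinuousAt.inner
    (ContinuousAt.comp (f := fun t : ℝ => (t : ℂ))
      ((differentiableAt_schrodingerInv hT hw hU hB (by simp)).clm_apply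
        (differentiableAt_const φ)).continuousAt Complex.continuous_ofReal.continuousAt)
    continuousAt_const

theorem lintegral_greenKernel_le_of_monotone (hT : IsSelfAdjoint T) (hw : IsDissipative c w)
    (hU : ∀ x, 0 ≤ U x) (hB : ∃ B : ℝ, ∀ x, U x ≤ B) (hm : 0 < m) {x y : α} (hx : m ≤ U x)
    (hy : m ≤ U y) (hp₀ : 0 < p) (hp₁ : p < 1) (hR : 0 < R) :
    ∫⁻ t in Set.Icc (-R) R, ‖greenKernel T Γ (fun k => w k + (t : ℂ) * U k) x y‖ₑ ^ p ≤
      4 * ENNReal.ofReal (halfPlaneConst p * ((4 / m) ^ p * R ^ (1 - p))) := by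
  set A : ℝ → ℓ²(α, ℂ) →L[ℂ] ℓ²(α, ℂ) := fun t =>
    schrodingerInv T Γ fun k => w k + (t : ℂ) * U k
  set φ : ℕ → ℓ²(α, ℂ) := fun k => basisVec x + Complex.I ^ k • basisVec y with hφ
  have hcut : ∀ k, cutoff {x, y} (φ k) = φ k := fun k => by
    rw [hφ, map_add, map_smul, cutoff_basisVec (by simp), cutoff_basisVec (by simp)]
  have hnorm : ∀ k, ‖φ k‖ ^ 2 ≤ 4 := fun k => by
    have hle : ‖φ k‖ ≤ 1 + 1 := (norm_add_le _ _).trans_eq <| by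
      rw [norm_smul, norm_pow, Complex.norm_I, one_pow, one_mul, norm_basisVec, norm_basisVec]
    nlinarith [norm_nonneg (φ k)]
  have hconst : 0 ≤ halfPlaneConst p :=
    div_nonneg (add_nonneg zero_le_two (div_nonneg zero_le_two (by linarith)))
      (cos_pi_mul_div_two_pos hp₀ hp₁).le
  have hbound : ∀ k, ∫⁻ t in Set.Icc (-R) R, ‖inner ℂ (A t (φ k)) (φ k)‖ₑ ^ p ≤
      ENNReal.ofReal (halfPlaneConst p * ((4 / m) ^ p * R ^ (1 - p))) := fun k => by
    refine (lintegral_inner_schrodingerInv_le hT hw hU hB hm (J := {x, y})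
      (by rintro k (rfl | rfl) <;> assumption) hp₀ hp₁ hR (hcut k)).trans
      (ENNReal.ofReal_le_ofReal ?_)
    gcongr
    exact hnorm k
  calc ∫⁻ t in Set.Icc (-R) R, ‖greenKernel T Γ (fun k => w k + (t : ℂ) * U k) x y‖ₑ ^ p
      ≤ ∫⁻ t in Set.Icc (-R) R, ∑ k ∈ Finset.range 4, ‖inner ℂ (A t (φ k)) (φ k)‖ₑ ^ p :=
        lintegral_mono fun t => by
          rw [greenKernel, ← inner_basisVec_left]
          exact enorm_inner_map_rpow_le (A t) _ _ hp₀ hp₁.le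
    _ = ∑ k ∈ Finset.range 4, ∫⁻ t in Set.Icc (-R) R, ‖inner ℂ (A t (φ k)) (φ k)‖ₑ ^ p :=
        lintegral_finsetSum _ fun k _ =>
          (continuous_inner_schrodingerInv hT hw hU hB (φ k)).enorm.measurable.pow_const p
    _ ≤ ∑ _k ∈ Finset.range 4, _ := Finset.sum_le_sum fun k _ => hbound k
    _ = _ := by rw [Finset.sum_const, Finset.card_range, nsmul_eq_mul, Nat.cast_ofNat]

end MonotoneAveraging

section SingularIntegral

variable {p : ℝ}

theorem lintegral_abs_rpow_neg_lt_top (hp : p < 1) :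
    ∫⁻ r in Set.Icc (-1 : ℝ) 1, ENNReal.ofReal (|r| ^ (-p)) < ∞ := by
  have hint : IntervalIntegrable (fun r : ℝ => |r| ^ (-p)) volume (-1) 1 := by
    refine intervalIntegrable_of_even (fun r => by rw [abs_neg]) (fun b hb => ?_) (by simp)
      (by simp)
    refine (intervalIntegral.intervalIntegrable_rpow' (r := -p) (by linarith)).congr fun r hr => ?_
    rw [Set.uIoc_of_le hb.le] at hr
    simp only [abs_of_pos hr.1]
  rw [intervalIntegrable_iff_integrableOn_Icc_of_le (by norm_num)] at hint
  refine lt_of_eq_of_lt (lintegral_congr fun r => ?_) hint.2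
  rw [Real.enorm_eq_ofReal (by positivity)]

theorem exists_lintegral_abs_sub_rpow_neg_le (hp₀ : 0 ≤ p) (hp₁ : p < 1) (R : ℝ) :
    ∃ K : ℝ≥0∞, K ≠ ∞ ∧ ∀ c : ℝ,
      ∫⁻ r in Set.Icc (-R) R, ENNReal.ofReal (|r - c| ^ (-p)) ≤ K := by
  set f : ℝ → ℝ≥0∞ := fun r => ENNReal.ofReal (|r| ^ (-p)) with hf
  refine ⟨volume (Set.Icc (-R) R) + ∫⁻ r in Set.Icc (-1 : ℝ) 1, f r,
    ENNReal.add_ne_top.2 ⟨by simp, (lintegral_abs_rpow_neg_lt_top hp₁).ne⟩, fun c => ?_⟩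
  have hle : ∀ r, f r ≤ 1 + (Set.Icc (-1 : ℝ) 1).indicator f r := fun r => by
    by_cases hr : r ∈ Set.Icc (-1 : ℝ) 1
    · rw [Set.indicator_of_mem hr]
      exact le_add_self
    · rw [Set.indicator_of_notMem hr, add_zero, hf]
      have hr₁ : 1 ≤ |r| := (not_le.1 fun h => hr (abs_le.1 h)).le
      exact ENNReal.ofReal_le_one.2 (Real.rpow_le_one_of_one_le_of_nonpos hr₁ (by linarith))
  calc ∫⁻ r in Set.Icc (-R) R, f (r - c)
      ≤ ∫⁻ r in Set.Icc (-R) R, (1 + (Set.Icc (-1 : ℝ) 1).indicator f (r - c)) :=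
        lintegral_mono fun r => hle _
    _ = volume (Set.Icc (-R) R) +
        ∫⁻ r in Set.Icc (-R) R, (Set.Icc (-1 : ℝ) 1).indicator f (r - c) := by
        rw [lintegral_add_left measurable_const, lintegral_const, one_mul,
          Measure.restrict_apply_univ]
    _ ≤ volume (Set.Icc (-R) R) + ∫⁻ r, (Set.Icc (-1 : ℝ) 1).indicator f (r - c) := by
        gcongr
        exact Measure.restrict_le_self
    _ = _ := by
        rw [lintegral_sub_right_eq_self (fun r => (Set.Icc (-1 : ℝ) 1).indicator f r),
          lintegral_indicator measurableSet_Icc]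

end SingularIntegral

section MatrixInverse

open Matrix

theorem inv_pow_rpow_le_one_add {n : ℕ} {τ p t : ℝ} (hτ : 0 ≤ τ) (hp : n * τ ≤ p) (ht : 0 < t) :
    ((t ^ n)⁻¹) ^ τ ≤ 1 + t ^ (-p) := by
  rw [← Real.rpow_natCast, ← Real.rpow_neg ht.le, ← Real.rpow_mul ht.le]
  rcases le_total 1 t with h | h
  · refine (Real.rpow_le_one_of_one_le_of_nonpos h ?_).trans
      (le_add_of_nonneg_right (by positivity))
    rw [neg_mul, neg_nonpos]
    positivity
  · refine (Real.rpow_le_rpow_of_exponent_ge ht h ?_).trans (le_add_of_nonneg_left zero_le_one)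
    linarith

variable {ι : Type*} [DecidableEq ι]

theorem norm_add_smul_diagonal_apply_le {A : Matrix ι ι ℂ} {v : ι → ℂ} {a B R r : ℝ}
    (hA : ∀ i j, ‖A i j‖ ≤ a) (hv : ∀ i, ‖v i‖ ≤ B) (hr : |r| ≤ R) (i j : ι) :
    ‖(A + (r : ℂ) • diagonal v) i j‖ ≤ a + R * B := by
  refine (norm_add_le _ _).trans (add_le_add (hA i j) ?_)
  rw [Matrix.smul_apply, smul_eq_mul, norm_mul, Complex.norm_real, Real.norm_eq_abs]
  have hB : 0 ≤ B := (norm_nonneg _).trans (hv i)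
  refine mul_le_mul hr ?_ (norm_nonneg _) ((abs_nonneg r).trans hr)
  rw [diagonal_apply]
  split_ifs
  · exact hv i
  · rwa [norm_zero]

variable [Fintype ι]

theorem det_add_smul_diagonal {K : Type*} [Field K] (A : Matrix ι ι K) {v : ι → K}
    (hv : ∀ i, v i ≠ 0) (r : K) : (A + r • diagonal v).det =
      (∏ i, v i) * (-(diagonal (fun i => (v i)⁻¹) * A)).charpoly.eval r := by
  have hfactor : A + r • diagonal v =
      diagonal v * (scalar ι r - -(diagonal (fun i => (v i)⁻¹) * A)) := by
    have hinv : diagonal v * diagonal (fun i => (v i)⁻¹) = 1 := by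
      rw [diagonal_mul_diagonal, ← diagonal_one]
      exact congrArg diagonal (funext fun i => mul_inv_cancel₀ (hv i))
    rw [sub_neg_eq_add, mul_add, ← mul_assoc, hinv, one_mul, add_comm, scalar_apply,
      ← smul_one_eq_diagonal, mul_smul_comm, mul_one]
  rw [hfactor, det_mul, det_diagonal, ← eval_charpoly]

theorem exists_mem_pow_le_norm_prod_sub {s : Multiset ℂ} (hs : s ≠ 0) (r : ℂ) :
    ∃ ρ ∈ s, ‖r - ρ‖ ^ s.card ≤ ‖(s.map fun ρ => r - ρ).prod‖ := by
  obtain ⟨ρ, hρ, hmin⟩ := Multiset.exists_min_image (fun ρ => ‖r - ρ‖₊) hs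
  refine ⟨ρ, hρ, ?_⟩
  have hprod : ‖(s.map fun ρ => r - ρ).prod‖₊ = (s.map fun ρ => ‖r - ρ‖₊).prod := by
    simpa using map_multiset_prod (nnnormHom (α := ℂ)) (s.map fun ρ => r - ρ)
  have hle := Multiset.pow_card_le_prod (s := s.map fun ρ => ‖r - ρ‖₊) (a := ‖r - ρ‖₊)
    fun x hx => by
      obtain ⟨z, hz, rfl⟩ := Multiset.mem_map.1 hx
      exact hmin z hz
  rw [Multiset.card_map, ← hprod] at hle
  exact_mod_cast hle

theorem exists_pow_le_norm_det_add_smul_diagonal [Nonempty ι] (A : Matrix ι ι ℂ) {v : ι → ℂ}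
    {m : ℝ} (hm : 0 < m) (hv : ∀ i, m ≤ ‖v i‖) :
    ∃ s : Finset ℝ, s.card ≤ Fintype.card ι ∧ ∀ r : ℝ, ∃ c ∈ s,
      (m * |r - c|) ^ Fintype.card ι ≤ ‖(A + (r : ℂ) • diagonal v).det‖ := by
  classical
  have hv₀ : ∀ i, v i ≠ 0 := fun i => norm_pos_iff.1 (hm.trans_le (hv i))
  set P := (-(diagonal (fun i => (v i)⁻¹) * A)).charpoly with hP
  have hsplit : P.Splits := IsAlgClosed.splits P
  have hcard : P.roots.card = Fintype.card ι := by
    rw [← hsplit.natDegree_eq_card_roots, charpoly_natDegree_eq_dim]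
  have hne : P.roots ≠ 0 := fun h => by
    rw [h, Multiset.card_zero] at hcard
    exact Fintype.card_ne_zero hcard.symm
  refine ⟨P.roots.toFinset.image Complex.re,
    Finset.card_image_le.trans ((Multiset.toFinset_card_le _).trans hcard.le), fun r => ?_⟩
  obtain ⟨ρ, hρ, hle⟩ := exists_mem_pow_le_norm_prod_sub hne (r : ℂ)
  refine ⟨ρ.re, Finset.mem_image_of_mem _ (Multiset.mem_toFinset.2 hρ), ?_⟩
  rw [det_add_smul_diagonal A hv₀, ← hP,
    hsplit.eval_eq_prod_roots_of_monic (charpoly_monic _), norm_mul, mul_pow]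
  refine mul_le_mul ?_ (le_trans ?_ hle) (by positivity) (norm_nonneg _)
  · rw [norm_prod, ← Finset.card_univ, ← Finset.prod_const]
    exact Finset.prod_le_prod (fun _ _ => hm.le) fun i _ => hv i
  · rw [hcard]
    refine pow_le_pow_left₀ (abs_nonneg _) ?_ _
    simpa using Complex.abs_re_le_norm ((r : ℂ) - ρ)

theorem norm_adjugate_apply_le {M : Matrix ι ι ℂ} {x : ℝ} (hx : 1 ≤ x)
    (h : ∀ i j, ‖M i j‖ ≤ x) (i j : ι) :
    ‖M.adjugate i j‖ ≤ (Fintype.card ι).factorial * x ^ Fintype.card ι := by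
  rw [adjugate_apply, ← nsmul_eq_mul]
  refine det_le (abv := NormedField.toAbsoluteValue ℂ) fun k l => ?_
  change ‖(M.updateRow j (Pi.single i 1)) k l‖ ≤ x
  rw [updateRow_apply]
  split_ifs
  · rcases eq_or_ne l i with rfl | hl
    · simpa using hx
    · rw [Pi.single_eq_of_ne hl, norm_zero]
      exact zero_le_one.trans hx
  · exact h k l

theorem norm_inv_apply_le {M : Matrix ι ι ℂ} {x : ℝ} (hx : 1 ≤ x)
    (h : ∀ i j, ‖M i j‖ ≤ x) (i j : ι) :
    ‖M⁻¹ i j‖ ≤ (Fintype.card ι).factorial * x ^ Fintype.card ι / ‖M.det‖ := by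
  rw [inv_def, Ring.inverse_eq_inv', Matrix.smul_apply, smul_eq_mul, norm_mul, norm_inv,
    inv_mul_eq_div]
  exact div_le_div_of_nonneg_right (norm_adjugate_apply_le hx h i j) (norm_nonneg _)

theorem norm_inv_add_smul_diagonal_apply_le {N : ℕ} {m B R a c r : ℝ} (hm : 0 < m) (hm₁ : m ≤ 1)
    (hN : Fintype.card ι ≤ N) {A : Matrix ι ι ℂ} {v : ι → ℂ} (ha : 1 ≤ a)
    (hA : ∀ i j, ‖A i j‖ ≤ a) (hv : ∀ i, ‖v i‖ ≤ B) (hr : |r| ≤ R) (hrc : r ≠ c)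
    (hdet : (m * |r - c|) ^ Fintype.card ι ≤ ‖(A + (r : ℂ) • diagonal v).det‖) (i j : ι) :
    ‖(A + (r : ℂ) • diagonal v)⁻¹ i j‖ ≤
      N.factorial * ((1 + R * B) / m) ^ N * a ^ N * (|r - c| ^ Fintype.card ι)⁻¹ := by
  set n := Fintype.card ι
  have hRB : 0 ≤ R * B :=
    mul_nonneg ((abs_nonneg r).trans hr) ((norm_nonneg _).trans (hv i))
  have hentry : ∀ k l, ‖(A + (r : ℂ) • diagonal v) k l‖ ≤ a * (1 + R * B) := fun k l =>
    (norm_add_smul_diagonal_apply_le hA hv hr k l).trans (by nlinarith)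
  have hb : 1 ≤ (1 + R * B) / m := by
    rw [one_le_div hm]
    linarith
  have hn : (n.factorial : ℝ) ≤ N.factorial := by exact_mod_cast Nat.factorial_le hN
  calc ‖(A + (r : ℂ) • diagonal v)⁻¹ i j‖
      ≤ n.factorial * (a * (1 + R * B)) ^ n / ‖(A + (r : ℂ) • diagonal v).det‖ :=
        norm_inv_apply_le (one_le_mul_of_one_le_of_one_le ha (by linarith)) hentry i j
    _ ≤ n.factorial * (a * (1 + R * B)) ^ n / (m * |r - c|) ^ n := by gcongr
    _ = n.factorial * ((1 + R * B) / m * a) ^ n * (|r - c| ^ n)⁻¹ := by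
        simp only [mul_pow, div_pow]
        field_simp
    _ ≤ N.factorial * ((1 + R * B) / m * a) ^ N * (|r - c| ^ n)⁻¹ := by
        gcongr
        exact one_le_mul_of_one_le_of_one_le hb ha
    _ = _ := by rw [mul_pow, ← mul_assoc (N.factorial : ℝ)]

theorem exists_enorm_inv_add_smul_diagonal_rpow_le {N : ℕ} {m B R τ p a : ℝ} (hm : 0 < m)
    (hm₁ : m ≤ 1) (hτ : 0 < τ) (hp : N * τ ≤ p) (hN : Fintype.card ι ≤ N) {A : Matrix ι ι ℂ}
    {v : ι → ℂ} (ha : 1 ≤ a) (hA : ∀ i j, ‖A i j‖ ≤ a) (hvm : ∀ i, m ≤ ‖v i‖)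
    (hvB : ∀ i, ‖v i‖ ≤ B) (i j : ι) :
    ∃ s : Finset ℝ, s.card ≤ N ∧ ∀ r : ℝ, |r| ≤ R → r ∉ s →
      ‖(A + (r : ℂ) • diagonal v)⁻¹ i j‖ₑ ^ τ ≤
        ENNReal.ofReal ((N.factorial * ((1 + R * B) / m) ^ N * a ^ N) ^ τ) *
          (1 + ∑ c ∈ s, ENNReal.ofReal (|r - c| ^ (-p))) := by
  have : Nonempty ι := ⟨i⟩
  obtain ⟨s, hs, hdet⟩ := exists_pow_le_norm_det_add_smul_diagonal A hm hvm
  refine ⟨s, hs.trans hN, fun r hr hrs => ?_⟩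
  obtain ⟨c, hc, hle⟩ := hdet r
  have hrc : r ≠ c := fun h => hrs (h ▸ hc)
  have hRB : 0 ≤ R * B :=
    mul_nonneg ((abs_nonneg r).trans hr) ((norm_nonneg _).trans (hvB i))
  set Q : ℝ := N.factorial * ((1 + R * B) / m) ^ N * a ^ N
  have hQ₀ : 0 ≤ Q := by positivity
  have hexp : (Fintype.card ι : ℝ) * τ ≤ p :=
    (mul_le_mul_of_nonneg_right (by exact_mod_cast hN) hτ.le).trans hp
  have hreal : ‖(A + (r : ℂ) • diagonal v)⁻¹ i j‖ ^ τ ≤ Q ^ τ * (1 + |r - c| ^ (-p)) := by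
    refine (Real.rpow_le_rpow (norm_nonneg _) (norm_inv_add_smul_diagonal_apply_le hm hm₁ hN ha hA
      hvB hr hrc hle i j) hτ.le).trans ?_
    rw [Real.mul_rpow hQ₀ (by positivity)]
    exact mul_le_mul_of_nonneg_left
      (inv_pow_rpow_le_one_add hτ.le hexp (abs_pos.2 (sub_ne_zero.2 hrc))) (by positivity)
  rw [← ofReal_norm, ENNReal.ofReal_rpow_of_nonneg (norm_nonneg _) hτ.le]
  refine (ENNReal.ofReal_le_ofReal hreal).trans ?_
  rw [ENNReal.ofReal_mul (by positivity), ENNReal.ofReal_add zero_le_one (by positivity),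
    ENNReal.ofReal_one]
  gcongr
  exact Finset.single_le_sum (f := fun c => ENNReal.ofReal (|r - c| ^ (-p)))
    (fun _ _ => zero_le) hc

theorem exists_lintegral_inv_add_smul_diagonal_le (N : ℕ) {m B R τ : ℝ} (hm : 0 < m)
    (hB : 0 ≤ B) (hR : 0 ≤ R) (hτ : 0 < τ) (hNτ : N * τ < 1) :
    ∃ C : ℝ≥0∞, C ≠ ∞ ∧ ∀ (ι : Type*) [Fintype ι] [DecidableEq ι], Fintype.card ι ≤ N →
      ∀ (A : Matrix ι ι ℂ) (v : ι → ℂ) (a : ℝ), 1 ≤ a → (∀ i j, ‖A i j‖ ≤ a) →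
        (∀ i, m ≤ ‖v i‖) → (∀ i, ‖v i‖ ≤ B) → ∀ i j,
        ∫⁻ r in Set.Icc (-R) R, ‖(A + ((r : ℝ) : ℂ) • diagonal v)⁻¹ i j‖ₑ ^ τ ≤
          C * ENNReal.ofReal (a ^ (N * τ)) := by
  obtain ⟨K, hK, hKle⟩ := exists_lintegral_abs_sub_rpow_neg_le (by positivity) hNτ R
  have hm₀ : 0 < min m 1 := lt_min hm one_pos
  set b := (1 + R * B) / min m 1 with hb
  refine ⟨ENNReal.ofReal ((N.factorial * b ^ N) ^ τ) * (volume (Set.Icc (-R) R) + N * K),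
    ENNReal.mul_ne_top ENNReal.ofReal_ne_top (ENNReal.add_ne_top.2
      ⟨by simp, ENNReal.mul_ne_top (ENNReal.natCast_ne_top N) hK⟩), ?_⟩
  intro ι _ _ hN A v a ha hA hvm hvB i j
  obtain ⟨s, hs, hpt⟩ := exists_enorm_inv_add_smul_diagonal_rpow_le (R := R) hm₀ (min_le_right m 1)
    hτ le_rfl hN ha hA (fun i => (min_le_left m 1).trans (hvm i)) hvB i j
  rw [← hb] at hpt
  set Q : ℝ := N.factorial * b ^ N * a ^ N with hQ
  have hQa : ENNReal.ofReal (Q ^ τ) =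
      ENNReal.ofReal ((N.factorial * b ^ N) ^ τ) * ENNReal.ofReal (a ^ (N * τ)) := by
    rw [← ENNReal.ofReal_mul (by positivity), hQ, Real.mul_rpow (by positivity) (by positivity),
      ← Real.rpow_natCast a N, ← Real.rpow_mul (by linarith)]
  calc ∫⁻ r in Set.Icc (-R) R, ‖(A + ((r : ℝ) : ℂ) • diagonal v)⁻¹ i j‖ₑ ^ τ
      ≤ ∫⁻ r in Set.Icc (-R) R, ENNReal.ofReal (Q ^ τ) *
          (1 + ∑ c ∈ s, ENNReal.ofReal (|r - c| ^ (-(N * τ)))) := by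
        refine lintegral_mono_ae ?_
        filter_upwards [ae_restrict_of_ae (s.finite_toSet.countable.ae_notMem volume),
          ae_restrict_mem measurableSet_Icc] with r hrs hr
        exact hpt r (abs_le.2 hr) hrs
    _ = ENNReal.ofReal (Q ^ τ) * (volume (Set.Icc (-R) R) +
          ∑ c ∈ s, ∫⁻ r in Set.Icc (-R) R, ENNReal.ofReal (|r - c| ^ (-(N * τ)))) := by
        rw [lintegral_const_mul' _ _ ENNReal.ofReal_ne_top, lintegral_add_left measurable_const,
          lintegral_const, one_mul, Measure.restrict_apply_univ,
          lintegral_finsetSum _ fun c _ => by fun_prop]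
    _ ≤ ENNReal.ofReal (Q ^ τ) * (volume (Set.Icc (-R) R) + N * K) := by
        gcongr
        refine (Finset.sum_le_card_nsmul _ _ K fun c _ => hKle c).trans ?_
        rw [nsmul_eq_mul]
        gcongr
    _ = _ := by rw [hQa]; ring

end MatrixInverse

section BlockAveraging

variable {α : Type*} {T : ℓ²(α, ℂ) →L[ℂ] ℓ²(α, ℂ)} {Γ Γ' : Set α} {w : α → ℂ} {c : ℝ}
  {U : α → ℝ} {B : ℝ}

theorem IsDissipative.add_real (hw : IsDissipative c w) (hB : ∀ k, |U k| ≤ B) :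
    IsDissipative c fun k => w k + U k := by
  obtain ⟨K, hK⟩ := hw.bdd
  refine ⟨hw.pos, ⟨K + B, fun k => ?_⟩, fun k => ?_⟩
  · exact (norm_add_le _ _).trans (add_le_add (hK k) ((Complex.norm_real _).trans_le (hB k)))
  · simpa using hw.le_im k

theorem greenKernel_add_smul_eq_inv [DecidableEq α] (hΓ : Γ' ⊆ Γ) {S : Finset α}
    (hS : (S : Set α) = Γ \ Γ') (hT : IsSelfAdjoint T) (hw : IsDissipative c w)
    (hU : ∀ k ∈ Γ', U k = 0) (hB : ∀ k, |U k| ≤ B) {lam : ℝ} (hlam : lam ≠ 0) (r : ℝ) (x y : S) :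
    greenKernel T Γ (fun k => w k + ((lam * r * U k : ℝ) : ℂ)) x y = (lam : ℂ)⁻¹ *
      ((Matrix.of fun k l : S => (lam : ℂ)⁻¹ * schur T Γ' w k l) +
        (r : ℂ) • Matrix.diagonal fun k : S => (U k : ℂ))⁻¹ x y := by
  have hwU : IsDissipative c fun k => w k + ((lam * r * U k : ℝ) : ℂ) :=
    hw.add_real (B := |lam * r| * B) fun k => by
      rw [abs_mul]
      exact mul_le_mul_of_nonneg_left (hB k) (abs_nonneg _)
  have hlamC : (lam : ℂ) ≠ 0 := Complex.ofReal_ne_zero.2 hlam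
  have hschur : (Matrix.of fun k l : S => schur T Γ' (fun k => w k + ((lam * r * U k : ℝ) : ℂ)) k l)
      = (lam : ℂ) • ((Matrix.of fun k l : S => (lam : ℂ)⁻¹ * schur T Γ' w k l) +
        (r : ℂ) • Matrix.diagonal fun k : S => (U k : ℂ)) := by
    ext k l
    have hdiag : Matrix.diagonal (fun k : S => (U k : ℂ)) k l = U l * basisVec (l : α) (k : α) := by
      rw [basisVec_apply, Matrix.diagonal_apply]
      by_cases hkl : k = l
      · simp [hkl]
      · simp [hkl, Subtype.coe_ne_coe.2 hkl]
    rw [Matrix.of_apply,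
      schur_add hT hw hwU fun k hk => by rw [hU k hk, mul_zero, Complex.ofReal_zero],
      Matrix.smul_apply, Matrix.add_apply, Matrix.smul_apply, hdiag, Matrix.of_apply]
    simp only [smul_eq_mul, mul_add, mul_inv_cancel_left₀ hlamC]
    push_cast
    ring
  have hinv := of_greenKernel_mul_of_schur hΓ hS hT hwU
  rw [hschur, Matrix.mul_smul, ← Matrix.smul_mul] at hinv
  rw [Matrix.inv_eq_left_inv hinv, Matrix.smul_apply, Matrix.of_apply, smul_eq_mul,
    inv_mul_cancel_left₀ hlamC]

theorem exists_lintegral_greenKernel_le (N : ℕ) {m B R τ : ℝ} (hm : 0 < m) (hB : 0 ≤ B)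
    (hR : 0 ≤ R) (hτ : 0 < τ) (hNτ : N * τ < 1) :
    ∃ C : ℝ≥0∞, C ≠ ∞ ∧ ∀ {α : Type*} {T : ℓ²(α, ℂ) →L[ℂ] ℓ²(α, ℂ)} {Γ Γ' : Set α} {S : Finset α}
      {w : α → ℂ} {U : α → ℝ} {c lam a : ℝ}, Γ' ⊆ Γ → (S : Set α) = Γ \ Γ' → S.card ≤ N →
      IsSelfAdjoint T → IsDissipative c w → (∀ k ∈ Γ', U k = 0) → (∀ k ∈ S, m ≤ |U k|) →
      (∀ k, |U k| ≤ B) → 0 < lam → 1 ≤ a → (∀ k ∈ S, ∀ y ∈ S, ‖schur T Γ' w k y‖ ≤ lam * a) →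
      ∀ x ∈ S, ∀ y ∈ S,
      ∫⁻ r in Set.Icc (-R) R, ‖greenKernel T Γ (fun k => w k + ((lam * r * U k : ℝ) : ℂ)) x y‖ₑ ^ τ
        ≤ C * ENNReal.ofReal (lam ^ (-τ)) * ENNReal.ofReal (a ^ (N * τ)) := by
  classical
  obtain ⟨C, hC, hCle⟩ := exists_lintegral_inv_add_smul_diagonal_le N hm hB hR hτ hNτ
  refine ⟨C, hC, fun {α T Γ Γ' S w U c lam a} hΓ hS hSN hT hw hU hUm hUB hlam ha hschur x hx y hy =>
    ?_⟩
  have hscale (r : ℝ) : ‖greenKernel T Γ (fun k => w k + ((lam * r * U k : ℝ) : ℂ)) x y‖ₑ ^ τ =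
      ENNReal.ofReal (lam ^ (-τ)) *
        ‖((Matrix.of fun k l : S => (lam : ℂ)⁻¹ * schur T Γ' w k l) +
          (r : ℂ) • Matrix.diagonal fun k : S => (U k : ℂ))⁻¹ ⟨x, hx⟩ ⟨y, hy⟩‖ₑ ^ τ := by
    rw [greenKernel_add_smul_eq_inv hΓ hS hT hw hU hUB hlam.ne' r ⟨x, hx⟩ ⟨y, hy⟩, enorm_mul,
      ENNReal.mul_rpow_of_nonneg _ _ hτ.le]
    congr 1
    rw [← ofReal_norm, norm_inv, Complex.norm_of_nonneg hlam.le,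
      ENNReal.ofReal_rpow_of_nonneg (by positivity) hτ.le, Real.inv_rpow hlam.le,
      Real.rpow_neg hlam.le]
  simp only [hscale]
  rw [lintegral_const_mul' _ _ ENNReal.ofReal_ne_top, mul_right_comm, mul_comm]
  gcongr
  refine hCle S (by simpa using hSN) _ _ a ha (fun i j => ?_) (fun i => ?_) (fun i => ?_) _ _
  · rw [Matrix.of_apply, norm_mul, norm_inv, Complex.norm_of_nonneg hlam.le,
      inv_mul_le_iff₀ hlam]
    exact hschur i i.2 j j.2
  · exact (hUm i i.2).trans_eq (Complex.norm_real _).symm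
  · exact (Complex.norm_real _).trans_le (hUB i)

end BlockAveraging

section ProductMeasure

variable {ι : Type*} {X : ι → Type*} [∀ i, MeasurableSpace (X i)]

theorem pi_le_pi [Fintype ι] {μ ν : ∀ i, Measure (X i)} [∀ i, SigmaFinite (μ i)]
    (h : ∀ i, μ i ≤ ν i) : Measure.pi μ ≤ Measure.pi ν := by
  have houter : (Measure.pi μ).toOuterMeasure ≤ OuterMeasure.pi fun i => (ν i).toOuterMeasure :=
    OuterMeasure.le_pi.2 fun s _ =>
      (Measure.pi_pi μ s).trans_le (Finset.prod_le_prod' fun i _ => h i (s i))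
  refine Measure.le_iff.2 fun s hs => (houter s).trans_eq ?_
  rw [Measure.pi_def, toMeasure_apply _ _ hs]

variable [DecidableEq ι]

theorem map_updateFinset_infinitePi (μ : ∀ i, Measure (X i)) [∀ i, IsProbabilityMeasure (μ i)]
    (S : Finset ι) :
    ((Measure.infinitePi μ).prod (Measure.pi fun i : S => μ i)).map
      (fun p => Function.updateFinset p.1 S p.2) = Measure.infinitePi μ := by
  refine Measure.eq_infinitePi _ fun s t ht => ?_
  rw [Measure.map_apply measurable_updateFinset'
    (MeasurableSet.pi s.countable_toSet fun i _ => ht i)]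
  have hpre : (fun p : (∀ i, X i) × (∀ i : S, X i) => Function.updateFinset p.1 S p.2) ⁻¹'
      Set.pi s t = Set.pi (s \ S : Finset ι) t ×ˢ
        Set.univ.pi fun i : S => if (i : ι) ∈ s then t i else Set.univ := by
    ext ⟨ω, y⟩
    simp only [Set.mem_preimage, Set.mem_pi, Finset.mem_coe, Set.mem_prod, Finset.mem_sdiff,
      Set.mem_univ, true_implies, Function.updateFinset]
    constructor
    · refine fun h => ⟨fun i hi => by simpa [hi.2] using h i hi.1, fun i => ?_⟩
      split_ifs with hi
      · simpa using h i hi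
      · trivial
    · rintro ⟨hω, hy⟩ i hi
      split_ifs with hS
      · simpa [hi] using hy ⟨i, hS⟩
      · exact hω i ⟨hi, hS⟩
  have hprod : ∏ i : S, μ i (if (i : ι) ∈ s then t i else Set.univ) = ∏ i ∈ s ∩ S, μ i (t i) := by
    rw [Finset.prod_coe_sort S fun i => μ i (if i ∈ s then t i else Set.univ), Finset.inter_comm,
      ← Finset.filter_mem_eq_inter, Finset.prod_filter]
    refine Finset.prod_congr rfl fun i _ => ?_
    split_ifs <;> simp
  rw [hpre, Measure.prod_prod, Measure.pi_pi, Measure.infinitePi_pi _ fun i _ => ht i, hprod,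
    mul_comm, Finset.prod_inter_mul_prod_sdiff]

theorem lintegral_infinitePi_eq_lintegral_lmarginal (μ : ∀ i, Measure (X i))
    [∀ i, IsProbabilityMeasure (μ i)] (S : Finset ι) {f : (∀ i, X i) → ℝ≥0∞} (hf : Measurable f) :
    ∫⁻ ω, f ω ∂Measure.infinitePi μ =
      ∫⁻ ω, lmarginal μ S f ω ∂Measure.infinitePi μ := by
  nth_rw 1 [← map_updateFinset_infinitePi μ S]
  rw [lintegral_map hf measurable_updateFinset',
    lintegral_prod (fun p => f (Function.updateFinset p.1 S p.2))
      (hf.comp measurable_updateFinset').aemeasurable]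
  rfl

end ProductMeasure

section BoundedDensity

/-- The distribution `μ` has a density which is bounded by `K` and supported in `[-R, R]`. -/
structure HasBoundedDensity (μ : Measure ℝ) (K : ℝ≥0∞) (R : ℝ) : Prop where
  ne_top : K ≠ ∞
  pos : 0 < R
  le : μ ≤ K • volume.restrict (Set.Icc (-R) R)

variable {ι : Type*} {μ : Measure ℝ} {K : ℝ≥0∞} {R : ℝ}

theorem lintegral_infinitePi_le_update [DecidableEq ι] [IsProbabilityMeasure μ]
    (hμ : HasBoundedDensity μ K R) (b : ι) {f : (ι → ℝ) → ℝ≥0∞} (hf : Measurable f) :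
    ∫⁻ ω, f ω ∂Measure.infinitePi (fun _ : ι => μ) ≤
      ∫⁻ ω, (K * ∫⁻ r in Set.Icc (-R) R, f (Function.update ω b r))
        ∂Measure.infinitePi fun _ : ι => μ := by
  rw [lintegral_infinitePi_eq_lintegral_lmarginal _ {b} hf, lmarginal_singleton]
  refine lintegral_mono fun ω => (lintegral_mono' hμ.le le_rfl).trans_eq ?_
  rw [lintegral_smul_measure, smul_eq_mul]

theorem HasBoundedDensity.le_map_add (hμ : HasBoundedDensity μ K R) {t : ℝ}
    (ht : t ∈ Set.Icc (-R) R) :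
    μ ≤ (K • volume.restrict (Set.Icc (-(2 * R)) (2 * R))).map (fun r => r + t) := by
  refine hμ.le.trans ?_
  rw [Measure.map_smul]
  gcongr
  refine Measure.le_iff.2 fun s hs => ?_
  rw [Measure.map_apply (measurable_add_const t) hs, Measure.restrict_apply hs,
    Measure.restrict_apply (measurable_add_const t hs),
    ← measure_preimage_add_right volume t (s ∩ Set.Icc (-R) R)]
  refine measure_mono fun r hr => ⟨hr.1, ?_⟩
  have hrt := hr.2
  simp only [Set.mem_Icc] at hrt ht ⊢
  constructor <;> linarith

variable [IsProbabilityMeasure μ]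

theorem HasBoundedDensity.lintegral_pi_le_shift [Fintype ι] (hμ : HasBoundedDensity μ K R)
    {t : ℝ} (ht : t ∈ Set.Icc (-R) R) {h : (ι → ℝ) → ℝ≥0∞} (hh : Measurable h) :
    ∫⁻ y, h y ∂Measure.pi (fun _ : ι => μ) ≤ ∫⁻ y, h (fun i => y i + t)
      ∂Measure.pi fun _ : ι => K • volume.restrict (Set.Icc (-(2 * R)) (2 * R)) := by
  have : IsFiniteMeasure (K • (volume : Measure ℝ).restrict (Set.Icc (-(2 * R)) (2 * R))) :=
    Measure.smul_finite _ hμ.ne_top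
  refine (lintegral_mono' (pi_le_pi fun _ => hμ.le_map_add ht) le_rfl).trans_eq ?_
  rw [← Measure.pi_map_pi (f := fun _ r => r + t)
    fun _ => (measurable_add_const t).aemeasurable, lintegral_map hh (by fun_prop)]

theorem lintegral_pi_le_of_shift [Fintype ι] (hμ : HasBoundedDensity μ K R)
    {h : (ι → ℝ) → ℝ≥0∞} (hh : Measurable h) {C : ℝ≥0∞}
    (hC : ∀ y : ι → ℝ, (∀ i, y i ∈ Set.Icc (-(2 * R)) (2 * R)) →
      ∫⁻ t in Set.Icc (-R) R, h (fun i => y i + t) ≤ C) :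
    ∫⁻ y, h y ∂Measure.pi (fun _ : ι => μ) ≤
      (ENNReal.ofReal (2 * R))⁻¹ * ((K * ENNReal.ofReal (4 * R)) ^ Fintype.card ι * C) := by
  set κ : Measure ℝ := K • volume.restrict (Set.Icc (-(2 * R)) (2 * R)) with hκ
  have hR := hμ.pos
  have : IsFiniteMeasure κ := Measure.smul_finite _ hμ.ne_top
  have hsupp : ∀ᵐ y ∂Measure.pi (fun _ : ι => κ), ∀ i, y i ∈ Set.Icc (-(2 * R)) (2 * R) :=
    ae_all_iff.2 fun i => (Measure.tendsto_eval_ae_ae (μ := fun _ : ι => κ)).eventually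
      (Measure.ae_smul_measure (ae_restrict_mem measurableSet_Icc) K)
  have hmass : Measure.pi (fun _ : ι => κ) Set.univ =
      (K * ENNReal.ofReal (4 * R)) ^ Fintype.card ι := by
    rw [Measure.pi_univ, Finset.prod_const, Finset.card_univ, hκ, Measure.smul_apply,
      Measure.restrict_apply_univ, Real.volume_Icc, smul_eq_mul]
    ring_nf
  have hvol : volume (Set.Icc (-R) R) = ENNReal.ofReal (2 * R) := by
    rw [Real.volume_Icc]
    ring_nf
  have hvol₀ : ENNReal.ofReal (2 * R) ≠ 0 := by simpa using hR
  rw [← ENNReal.div_eq_inv_mul, ENNReal.le_div_iff_mul_le (Or.inl hvol₀)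
    (Or.inl ENNReal.ofReal_ne_top)]
  calc (∫⁻ y, h y ∂Measure.pi fun _ : ι => μ) * ENNReal.ofReal (2 * R)
      = ∫⁻ _ in Set.Icc (-R) R, ∫⁻ y, h y ∂Measure.pi fun _ : ι => μ := by
        rw [lintegral_const, Measure.restrict_apply_univ, hvol]
    _ ≤ ∫⁻ t in Set.Icc (-R) R, ∫⁻ y, h (fun i => y i + t) ∂Measure.pi fun _ : ι => κ :=
        setLIntegral_mono' measurableSet_Icc fun t ht => hμ.lintegral_pi_le_shift ht hh
    _ = ∫⁻ y, (∫⁻ t in Set.Icc (-R) R, h (fun i => y i + t)) ∂Measure.pi fun _ : ι => κ :=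
        lintegral_lintegral_swap (hh.comp (by fun_prop)).aemeasurable
    _ ≤ ∫⁻ _, C ∂Measure.pi fun _ : ι => κ := lintegral_mono_ae (hsupp.mono hC)
    _ = _ := by rw [lintegral_const, hmass, mul_comm]

theorem lintegral_infinitePi_mul_le_of_shift [DecidableEq ι] (hμ : HasBoundedDensity μ K R)
    (S : Finset ι) {h g : (ι → ℝ) → ℝ≥0∞} (hh : Measurable h) (hg : Measurable g)
    (hgS : DependsOn g (Sᶜ : Set ι)) {C : ℝ≥0∞}
    (hC : ∀ ω : ι → ℝ, (∀ i ∈ S, ω i ∈ Set.Icc (-(2 * R)) (2 * R)) →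
      ∫⁻ t in Set.Icc (-R) R, h (fun i => ω i + if i ∈ S then t else 0) ≤ C) :
    ∫⁻ ω, h ω * g ω ∂Measure.infinitePi (fun _ : ι => μ) ≤
      ((ENNReal.ofReal (2 * R))⁻¹ * ((K * ENNReal.ofReal (4 * R)) ^ S.card * C)) *
        ∫⁻ ω, g ω ∂Measure.infinitePi fun _ : ι => μ := by
  rw [lintegral_infinitePi_eq_lintegral_lmarginal _ S (f := fun ω => h ω * g ω)
    (hh.mul hg), ← lintegral_const_mul _ hg]
  refine lintegral_mono fun ω => ?_
  have hgω (y : S → ℝ) : g (Function.updateFinset ω S y) = g ω :=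
    hgS fun i hi => by simp [Function.updateFinset, Finset.mem_coe.not.1 hi]
  simp only [lmarginal, hgω]
  rw [lintegral_mul_const (f := fun y => h (Function.updateFinset ω S y)) (g ω)
    (hh.comp measurable_updateFinset)]
  gcongr
  refine (lintegral_pi_le_of_shift hμ (hh.comp measurable_updateFinset) (C := C)
    fun y hy => ?_).trans_eq (by rw [Fintype.card_coe])
  refine le_of_eq_of_le (lintegral_congr fun t => congrArg h (funext fun i => ?_))
    (hC (Function.updateFinset ω S y) fun i hi => ?_)
  · by_cases hi : i ∈ S <;> simp [Function.updateFinset, hi]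
  · simpa [Function.updateFinset, hi] using hy ⟨i, hi⟩

end BoundedDensity

section Laplacian

variable {d : ℕ}

/-- The nearest neighbours of a lattice site. -/
def neighbors (x : Lattice d) : Finset (Lattice d) := (unitVectors d).image fun e => x + e

theorem mem_neighbors {x y : Lattice d} : y ∈ neighbors x ↔ l1Norm (y - x) = 1 := by
  rw [neighbors, Finset.mem_image, ← mem_unitVectors]
  refine ⟨?_, fun h => ⟨y - x, h, add_sub_cancel x y⟩⟩
  rintro ⟨e, he, rfl⟩
  rwa [add_sub_cancel_left]

theorem mem_neighbors_comm {x y : Lattice d} : y ∈ neighbors x ↔ x ∈ neighbors y := by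
  simp only [mem_neighbors, l1Norm, Pi.sub_apply, abs_sub_comm]

theorem card_neighbors (x : Lattice d) : (neighbors x).card = (unitVectors d).card :=
  Finset.card_image_of_injective _ (add_right_injective x)

theorem norm_sub_le_one_of_mem_neighbors {x y : Lattice d} (h : y ∈ neighbors x) :
    ‖y - x‖ ≤ 1 := by
  rw [mem_neighbors] at h
  refine (pi_norm_le_iff_of_nonneg zero_le_one).2 fun i => ?_
  have hi : |(y - x) i| ≤ 1 := h ▸
    Finset.single_le_sum (f := fun j => |(y - x) j|) (fun j _ => abs_nonneg _) (Finset.mem_univ i)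
  rw [Int.norm_eq_abs]
  exact_mod_cast hi

theorem laplacian_apply (ψ : ℓ²(Lattice d, ℂ)) (x : Lattice d) :
    laplacian d ψ x = ∑ y ∈ neighbors x, ψ y := by
  rw [neighbors, Finset.sum_image fun _ _ _ _ h => add_left_cancel h]
  simp only [laplacian, sum_apply, lp.coeFn_sum, Finset.sum_apply, compOp_apply]

theorem laplacian_basisVec (y : Lattice d) :
    laplacian d (basisVec y) = ∑ x ∈ neighbors y, basisVec x := by
  ext x
  rw [laplacian_apply, lp.coeFn_sum, Finset.sum_apply]
  simp only [basisVec_apply]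
  convert (Finset.sum_ite_eq' (neighbors x) y fun _ => (1 : ℂ)).trans
    ((if_congr mem_neighbors_comm rfl rfl).trans
      (Finset.sum_ite_eq (neighbors y) x fun _ => (1 : ℂ)).symm)

theorem isSelfAdjoint_laplacian (d : ℕ) : IsSelfAdjoint (laplacian d) := by
  rw [ContinuousLinearMap.isSelfAdjoint_iff']
  ext ψ x
  rw [← inner_basisVec_left, ContinuousLinearMap.adjoint_inner_right, laplacian_basisVec,
    sum_inner, laplacian_apply]
  simp only [inner_basisVec_left]

theorem norm_laplacian_le (d : ℕ) : ‖laplacian d‖ ≤ (unitVectors d).card :=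
  (norm_sum_le_of_le _ fun _ _ => LinearMap.mkContinuous_norm_le _ zero_le_one _).trans_eq
    (by simp)

theorem norm_schur_laplacian_le {Γ : Set (Lattice d)} {w : Lattice d → ℂ} {k y : Lattice d}
    {M : ℝ} (hM : 0 ≤ M) (hG : ∀ i ∈ neighbors k, ∀ j ∈ neighbors y, j ∈ Γ →
      ‖greenKernel (laplacian d) Γ w i j‖ ≤ M) :
    ‖schur (laplacian d) Γ w k y‖ ≤
      ‖w y‖ + (unitVectors d).card + (unitVectors d).card ^ 2 * M := by
  have hdiag : ‖w y * basisVec y k‖ ≤ ‖w y‖ := by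
    rw [basisVec_apply, mul_ite, mul_one, mul_zero]
    split_ifs <;> simp
  have hhop : ‖laplacian d (basisVec y) k‖ ≤ (unitVectors d).card :=
    (lp.norm_apply_le_norm (by norm_num) _ k).trans <| ((laplacian d).le_opNorm _).trans <| by
      rw [norm_basisVec, mul_one]
      exact norm_laplacian_le d
  have hterm (i) (hi : i ∈ neighbors k) (j) (hj : j ∈ neighbors y) :
      ‖schrodingerInv (laplacian d) Γ w (cutoff Γ (basisVec j)) i‖ ≤ M := by
    by_cases hjΓ : j ∈ Γ
    · rw [cutoff_basisVec hjΓ]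
      exact hG i hi j hj hjΓ
    · rw [cutoff_basisVec_of_notMem hjΓ, map_zero]
      simpa using hM
  have hself : ‖laplacian d (schrodingerInv (laplacian d) Γ w
      (cutoff Γ (laplacian d (basisVec y)))) k‖ ≤ (unitVectors d).card ^ 2 * M := by
    simp only [laplacian_basisVec, map_sum, laplacian_apply, lp.coeFn_sum, Finset.sum_apply]
    refine (norm_sum_le_of_le _ fun j hj => norm_sum_le_of_le _ fun i hi =>
      hterm i hi j hj).trans_eq ?_
    simp only [Finset.sum_const, nsmul_eq_mul, card_neighbors]
    ring
  exact (norm_sub_le _ _).trans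
    (add_le_add ((norm_sub_le _ _).trans (add_le_add hdiag hhop)) hself)

end Laplacian

section Hamiltonian

variable {d : ℕ} {u : Lattice d → ℝ} {lam K : ℝ} {ω : Lattice d → ℝ} {Γ : Set (Lattice d)} {z : ℂ}

theorem potential_eq_sum (hu : (Function.support u).Finite) (ω : Lattice d → ℝ) (x : Lattice d) :
    potential u ω x = ∑ θ ∈ hu.toFinset, ω (x - θ) * u θ := by
  rw [potential, ← (Equiv.subLeft x).tsum_eq]
  simp only [Equiv.subLeft_apply, sub_sub_cancel]
  refine tsum_eq_sum fun θ hθ => ?_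
  have huθ : u θ = 0 := by simpa using hθ
  rw [huθ, mul_zero]

theorem isSelfAdjoint_hamiltonianOn (hK : ∀ x, |potential u ω x| ≤ K) (Γ : Set (Lattice d)) :
    IsSelfAdjoint (hamiltonianOn u lam ω Γ) := by
  have hV : IsSelfAdjoint (mulOp (potential u ω)) := by
    rw [mulOp_eq_mulCLM hK]
    exact isSelfAdjoint_mulCLM_ofReal ⟨K, fun x => by simpa using hK x⟩
  have hH : IsSelfAdjoint (hamiltonian u lam ω) :=
    (isSelfAdjoint_laplacian d).neg.add (IsSelfAdjoint.smul (Complex.conj_ofReal lam) hV)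
  exact hH.conj_adjoint (proj Γ)

theorem proj_apply (ψ : ℓ²(Lattice d, ℂ)) (x : Γ) : proj Γ ψ x = ψ x := rfl

theorem proj_basisVec [DecidableEq Γ] (y : Γ) :
    proj Γ (basisVec (y : Lattice d)) = lp.single 2 y (1 : ℂ) := by
  ext x
  rw [proj_apply, basisVec_apply, lp.single_apply, Pi.single_apply]
  simp only [Subtype.ext_iff]
  congr

theorem adjoint_proj_proj (Γ : Set (Lattice d)) (ψ : ℓ²(Lattice d, ℂ)) :
    ContinuousLinearMap.adjoint (proj Γ) (proj Γ ψ) = cutoff Γ ψ := by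
  classical
  ext x
  rw [← inner_basisVec_left, ContinuousLinearMap.adjoint_inner_right, cutoff_apply]
  split_ifs with hx
  · rw [proj_basisVec ⟨x, hx⟩, lp.inner_single_left]
    simp [proj_apply]
  · have hproj : proj Γ (basisVec x) = 0 := by
      ext k
      rw [proj_apply, basisVec_apply, if_neg (ne_of_mem_of_not_mem k.2 hx)]
      rfl
    rw [hproj, inner_zero_left]

theorem hamiltonianOn_sub_proj (hK : ∀ x, |potential u ω x| ≤ K) {ψ : ℓ²(Lattice d, ℂ)}
    (hψ : cutoff Γ ψ = ψ) :
    (hamiltonianOn u lam ω Γ - z • ContinuousLinearMap.id ℂ ℓ²(Γ, ℂ)) (proj Γ ψ) =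
      proj Γ (schrodinger (laplacian d) Γ (fun x => (lam * potential u ω x : ℝ) - z) ψ) := by
  have hbdd : ∃ M : ℝ, ∀ x, ‖((lam * potential u ω x : ℝ) - z : ℂ)‖ ≤ M :=
    ⟨|lam| * K + ‖z‖, fun x => (norm_sub_le _ _).trans <| add_le_add_left (by
      rw [Complex.norm_real, Real.norm_eq_abs, abs_mul]
      exact mul_le_mul_of_nonneg_left (hK x) (abs_nonneg lam)) _⟩
  ext x
  simp only [hamiltonianOn, hamiltonian, schrodinger, compression, sub_apply, add_apply,
    neg_apply, smul_apply, ContinuousLinearMap.comp_apply, mul_apply_eq_comp,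
    ContinuousLinearMap.id_apply, adjoint_proj_proj, hψ, lp.coeFn_sub, lp.coeFn_smul,
    lp.coeFn_add, lp.coeFn_neg, Pi.sub_apply, Pi.smul_apply, Pi.add_apply, Pi.neg_apply, proj_apply,
    cutoff_apply, if_pos x.2, mulOp_apply hK, mulCLM_apply hbdd, smul_eq_mul]
  push_cast
  ring

theorem green_eq_greenKernel (hK : ∀ x, |potential u ω x| ≤ K) {c : ℝ}
    (hw : IsDissipative c fun x => (lam * potential u ω x : ℝ) - z) (hz : z.im ≠ 0) (x y : Γ) :
    green u lam ω Γ z x y =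
      greenKernel (laplacian d) Γ (fun x => (lam * potential u ω x : ℝ) - z) x y := by
  classical
  set A := hamiltonianOn u lam ω Γ - z • ContinuousLinearMap.id ℂ ℓ²(Γ, ℂ)
  set ψ := schrodingerInv (laplacian d) Γ (fun x => (lam * potential u ω x : ℝ) - z) (basisVec y)
  have hunit : IsUnit A := by
    have h := spectrum.notMem_iff.1 fun h =>
      hz ((isSelfAdjoint_hamiltonianOn (lam := lam) hK Γ).im_eq_zero_of_mem_spectrum h)
    rw [← IsUnit.neg_iff, neg_sub, Algebra.algebraMap_eq_smul_one] at h
    exact h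
  have hAψ : A (proj Γ ψ) = lp.single 2 y (1 : ℂ) := by
    rw [hamiltonianOn_sub_proj hK (cutoff_schrodingerInv hw.bdd (cutoff_basisVec y.2)),
      schrodinger_schrodingerInv (isSelfAdjoint_laplacian d) hw, proj_basisVec]
  have hinv : Ring.inverse A (lp.single 2 y (1 : ℂ)) = proj Γ ψ := by
    rw [← hAψ]
    exact congrArg (fun T : ℓ²(Γ, ℂ) →L[ℂ] ℓ²(Γ, ℂ) => T (proj Γ ψ))
      (Ring.inverse_mul_cancel A hunit)
  have hgreen : greenKernel (laplacian d) Γ (fun x => (lam * potential u ω x : ℝ) - z) x y =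
    proj Γ ψ x := rfl
  rw [hgreen, ← hinv, green, lp.inner_single_left]
  simp only [RCLike.inner_apply, map_one, mul_one]
  congr!

theorem norm_green_conj (hK : ∀ x, |potential u ω x| ≤ K) (z : ℂ) (x y : Γ) :
    ‖green u lam ω Γ z x y‖ = ‖green u lam ω Γ (starRingEnd ℂ z) y x‖ := by
  have hstar : hamiltonianOn u lam ω Γ - starRingEnd ℂ z • ContinuousLinearMap.id ℂ ℓ²(Γ, ℂ) =
      star (hamiltonianOn u lam ω Γ - z • ContinuousLinearMap.id ℂ ℓ²(Γ, ℂ)) := by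
    rw [star_sub, star_smul, (isSelfAdjoint_hamiltonianOn hK Γ).star_eq]
    congr 2
    exact (star_one (ℓ²(Γ, ℂ) →L[ℂ] ℓ²(Γ, ℂ))).symm
  rw [green, green, hstar, Ring.inverse_star, ContinuousLinearMap.star_eq_adjoint,
    ContinuousLinearMap.adjoint_inner_right, norm_inner_symm]

end Hamiltonian

/-- A finitely supported single-site potential `u` which is positive at the sites of its support
that have a neighbour outside, and a bound `R` for the coupling constants. -/
structure AlloyData (d : ℕ) where
  u : Lattice d → ℝ
  finite_support : (Function.support u).Finite
  u_zero_ne_zero : u 0 ≠ 0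
  u_pos : ∀ k, u k ≠ 0 → ∀ j ∈ neighbors k, u j = 0 → 0 < u k
  R : ℝ
  R_pos : 0 < R

namespace AlloyData

variable {d : ℕ} (a : AlloyData d)

section Geometry

/-- The number of sites in the support of the single-site potential. -/
def N : ℕ := a.finite_support.toFinset.card

/-- A bound for the single-site potential. -/
def B : ℝ := ∑ θ ∈ a.finite_support.toFinset, |a.u θ|

/-- A bound for the distance of `b` from the sites in the cell and in the shell of `b`. -/
def L : ℝ := (∑ θ ∈ a.finite_support.toFinset, ‖θ‖) + 1

/-- The support of the single-site potential centred at `b`. -/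
def cell (b : Lattice d) : Finset (Lattice d) := a.finite_support.toFinset.image fun θ => b + θ

/-- The sites outside the cell of `b` which belong to the cell of a neighbour of `b`. -/
def shell (b : Lattice d) : Finset (Lattice d) := (neighbors b).biUnion a.cell \ a.cell b

/-- The potential produced by unit coupling constants at all neighbours of `b`. -/
def ringPotential (b k : Lattice d) : ℝ := ∑ j ∈ neighbors b, a.u (k - j)

variable {a} {b j k : Lattice d}

theorem mem_cell : k ∈ a.cell b ↔ a.u (k - b) ≠ 0 := by
  rw [cell, Finset.mem_image]
  refine ⟨?_, fun h => ⟨k - b, by simpa using h, add_sub_cancel b k⟩⟩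
  rintro ⟨θ, hθ, rfl⟩
  simpa using hθ

theorem notMem_cell : k ∉ a.cell b ↔ a.u (k - b) = 0 := mem_cell.not_left

theorem mem_shell : k ∈ a.shell b ↔ (∃ j ∈ neighbors b, k ∈ a.cell j) ∧ k ∉ a.cell b := by
  rw [shell, Finset.mem_sdiff, Finset.mem_biUnion]

variable (a) in
theorem self_mem_cell (b : Lattice d) : b ∈ a.cell b :=
  mem_cell.2 (by simpa using a.u_zero_ne_zero)

variable (a) in
theorem card_cell_le (b : Lattice d) : (a.cell b).card ≤ a.N := Finset.card_image_le

variable (a) in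
theorem card_shell_le (b : Lattice d) : (a.shell b).card ≤ (unitVectors d).card * a.N :=
  (Finset.card_le_card Finset.sdiff_subset).trans
    ((Finset.card_biUnion_le_card_mul _ _ _ fun j _ => a.card_cell_le j).trans_eq
      (by rw [card_neighbors]))

theorem mem_shell_of_mem_neighbors (hk : k ∈ a.cell b) (hj : j ∈ neighbors k)
    (hjb : j ∉ a.cell b) : j ∈ a.shell b := by
  refine mem_shell.2 ⟨⟨b + (j - k), ?_, ?_⟩, hjb⟩
  · rw [mem_neighbors] at hj ⊢
    rwa [add_sub_cancel_left]
  · rw [mem_cell] at hk ⊢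
    rwa [← sub_sub, sub_sub_sub_cancel_left]

theorem u_sub_nonneg (hk : k ∉ a.cell b) (hj : j ∈ neighbors b) : 0 ≤ a.u (k - j) := by
  rcases eq_or_ne (a.u (k - j)) 0 with h | h
  · exact h.ge
  · refine (a.u_pos _ h (k - b) ?_ (notMem_cell.1 hk)).le
    rw [mem_neighbors] at hj
    rwa [mem_neighbors, sub_sub_sub_cancel_left]

variable (a) in
theorem B_nonneg : 0 ≤ a.B := Finset.sum_nonneg fun _ _ => abs_nonneg _

variable (a) in
theorem abs_u_le (k : Lattice d) : |a.u k| ≤ a.B := by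
  rcases eq_or_ne (a.u k) 0 with h | h
  · rw [h, abs_zero]
    exact a.B_nonneg
  · exact Finset.single_le_sum (f := fun θ => |a.u θ|) (fun _ _ => abs_nonneg _)
      (by simpa using h)

variable (a) in
theorem exists_le_abs_u : ∃ m : ℝ, 0 < m ∧ ∀ k, a.u k ≠ 0 → m ≤ |a.u k| := by
  obtain ⟨θ, hθ, hmin⟩ := Finset.exists_min_image a.finite_support.toFinset (fun θ => |a.u θ|)
    ⟨0, by simpa using a.u_zero_ne_zero⟩
  exact ⟨|a.u θ|, abs_pos.2 (by simpa using hθ), fun k hk => hmin k (by simpa using hk)⟩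

theorem ringPotential_nonneg (hk : k ∉ a.cell b) : 0 ≤ a.ringPotential b k :=
  Finset.sum_nonneg fun _ hj => u_sub_nonneg hk hj

variable (a) in
theorem ringPotential_le (b k : Lattice d) : a.ringPotential b k ≤ (unitVectors d).card * a.B :=
  (Finset.sum_le_card_nsmul _ _ a.B fun j _ => (le_abs_self _).trans (a.abs_u_le _)).trans_eq
    (by rw [nsmul_eq_mul, card_neighbors])

theorem le_ringPotential {m : ℝ} (hm : ∀ k, a.u k ≠ 0 → m ≤ |a.u k|) (hk : k ∈ a.shell b) :
    m ≤ a.ringPotential b k := by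
  obtain ⟨⟨j, hj, hkj⟩, hkb⟩ := mem_shell.1 hk
  calc m ≤ |a.u (k - j)| := hm _ (mem_cell.1 hkj)
    _ = a.u (k - j) := abs_of_nonneg (u_sub_nonneg hkb hj)
    _ ≤ a.ringPotential b k :=
      Finset.single_le_sum (f := fun j => a.u (k - j)) (fun j hj => u_sub_nonneg hkb hj) hj

variable (a) in
theorem L_nonneg : 0 ≤ a.L := add_nonneg (Finset.sum_nonneg fun _ _ => norm_nonneg _) zero_le_one

theorem norm_sub_add_one_le_of_mem_cell (hk : k ∈ a.cell b) : ‖k - b‖ + 1 ≤ a.L :=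
  add_le_add_left (Finset.single_le_sum (f := fun θ : Lattice d => ‖θ‖)
    (fun _ _ => norm_nonneg _) (by simpa using mem_cell.1 hk)) 1

theorem norm_sub_le_of_mem_cell (hk : k ∈ a.cell b) : ‖k - b‖ ≤ a.L :=
  (le_add_of_nonneg_right zero_le_one).trans (norm_sub_add_one_le_of_mem_cell hk)

theorem norm_sub_le_of_mem_shell (hk : k ∈ a.shell b) : ‖k - b‖ ≤ a.L := by
  obtain ⟨⟨j, hj, hkj⟩, -⟩ := mem_shell.1 hk
  exact (norm_sub_le_norm_sub_add_norm_sub k j b).trans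
    ((add_le_add_right (norm_sub_le_one_of_mem_neighbors hj) _).trans
      (norm_sub_add_one_le_of_mem_cell hkj))

end Geometry

end AlloyData

theorem enorm_greenKernel_laplacian_rpow_le {d : ℕ} {Γ Γ' : Set (Lattice d)}
    {S : Finset (Lattice d)} {w : Lattice d → ℂ} {c p : ℝ} {x y : Lattice d} (hΓ : Γ' ⊆ Γ)
    (hS : (S : Set (Lattice d)) = Γ \ Γ') (hw : IsDissipative c w) (hx : x ∉ Γ') (hy : y ∈ Γ')
    (hp₀ : 0 < p) (hp₁ : p ≤ 1) :
    ‖greenKernel (laplacian d) Γ w x y‖ₑ ^ p ≤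
      ∑ k ∈ S, (∑ j ∈ neighbors k, ‖greenKernel (laplacian d) Γ' w j y‖ₑ ^ p) *
        ‖greenKernel (laplacian d) Γ w x k‖ₑ ^ p := by
  rw [greenKernel_eq_add_sum hΓ hS (isSelfAdjoint_laplacian d) hw x hy,
    greenKernel_eq_zero hw.bdd hx hy, zero_add]
  refine (ENNReal.rpow_le_rpow (enorm_sum_le _ _) hp₀.le).trans
    ((ennreal_sum_rpow_le _ _ hp₀ hp₁).trans (Finset.sum_le_sum fun k _ => ?_))
  rw [enorm_mul, ENNReal.mul_rpow_of_nonneg _ _ hp₀.le, laplacian_apply]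
  gcongr
  exact (ENNReal.rpow_le_rpow (enorm_sum_le _ _) hp₀.le).trans (ennreal_sum_rpow_le _ _ hp₀ hp₁)

namespace AlloyData

variable {d : ℕ} (a : AlloyData d)

section Regions

/-- `Γ` without the cell of `b`. -/
def exterior (Γ : Set (Lattice d)) (b : Lattice d) : Set (Lattice d) := Γ \ a.cell b

/-- `Γ` without the cell and the shell of `b`. -/
def farExterior (Γ : Set (Lattice d)) (b : Lattice d) : Set (Lattice d) :=
  a.exterior Γ b \ a.shell b

open scoped Classical in
/-- The part of the cell of `b` inside `Γ`. -/
def cellIn (Γ : Set (Lattice d)) (b : Lattice d) : Finset (Lattice d) := {k ∈ a.cell b | k ∈ Γ}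

open scoped Classical in
/-- The part of the shell of `b` inside `Γ`. -/
def shellIn (Γ : Set (Lattice d)) (b : Lattice d) : Finset (Lattice d) := {k ∈ a.shell b | k ∈ Γ}

variable {a} {Γ : Set (Lattice d)} {b j k x y : Lattice d}

theorem mem_cellIn : k ∈ a.cellIn Γ b ↔ k ∈ a.cell b ∧ k ∈ Γ := by
  classical
  exact Finset.mem_filter

theorem mem_shellIn : k ∈ a.shellIn Γ b ↔ k ∈ a.shell b ∧ k ∈ Γ := by
  classical
  exact Finset.mem_filter

theorem notMem_exterior (hk : k ∈ a.cellIn Γ b) : k ∉ a.exterior Γ b :=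
  fun h => h.2 (mem_cellIn.1 hk).1

theorem mem_exterior (hk : k ∈ a.shellIn Γ b) : k ∈ a.exterior Γ b :=
  ⟨(mem_shellIn.1 hk).2, (mem_shell.1 (mem_shellIn.1 hk).1).2⟩

theorem notMem_farExterior (hk : k ∈ a.shellIn Γ b) : k ∉ a.farExterior Γ b :=
  fun h => h.2 (mem_shellIn.1 hk).1

theorem mem_cellIn_of_notMem_exterior (hk : k ∈ Γ) (h : k ∉ a.exterior Γ b) :
    k ∈ a.cellIn Γ b :=
  mem_cellIn.2 ⟨by_contra fun hkb => h ⟨hk, hkb⟩, hk⟩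

theorem mem_shellIn_of_notMem_farExterior (hk : k ∈ a.exterior Γ b) (h : k ∉ a.farExterior Γ b) :
    k ∈ a.shellIn Γ b :=
  mem_shellIn.2 ⟨by_contra fun hkb => h ⟨hk, hkb⟩, hk.1⟩

theorem coe_cellIn : (a.cellIn Γ b : Set (Lattice d)) = Γ \ a.exterior Γ b :=
  Set.ext fun _ => ⟨fun h => ⟨(mem_cellIn.1 h).2, notMem_exterior h⟩,
    fun h => mem_cellIn_of_notMem_exterior h.1 h.2⟩

theorem coe_shellIn : (a.shellIn Γ b : Set (Lattice d)) = a.exterior Γ b \ a.farExterior Γ b :=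
  Set.ext fun _ => ⟨fun h => ⟨mem_exterior h, notMem_farExterior h⟩,
    fun h => mem_shellIn_of_notMem_farExterior h.1 h.2⟩

theorem mem_shellIn_of_mem_neighbors (hk : k ∈ a.cellIn Γ b) (hj : j ∈ neighbors k)
    (hjb : j ∈ a.exterior Γ b) : j ∈ a.shellIn Γ b :=
  mem_shellIn.2 ⟨mem_shell_of_mem_neighbors (mem_cellIn.1 hk).1 hj hjb.2, hjb.1⟩

variable (a) in
theorem card_cellIn_le (Γ : Set (Lattice d)) (b : Lattice d) : (a.cellIn Γ b).card ≤ a.N := by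
  classical
  exact (Finset.card_filter_le _ _).trans (a.card_cell_le b)

variable (a) in
theorem card_shellIn_le (Γ : Set (Lattice d)) (b : Lattice d) :
    (a.shellIn Γ b).card ≤ (unitVectors d).card * a.N := by
  classical
  exact (Finset.card_filter_le _ _).trans (a.card_shell_le b)

variable (a) in
/-- The sum over pairs of shell sites of the moduli of the Green functions of the exterior region,
which controls the influence of the exterior on the cell. -/
def shellSum (Γ : Set (Lattice d)) (b : Lattice d) (w : Lattice d → ℂ) : ℝ≥0∞ :=
  ∑ i ∈ a.shellIn Γ b, ∑ j ∈ a.shellIn Γ b, ‖greenKernel (laplacian d) (a.exterior Γ b) w i j‖ₑ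

open scoped Classical in
variable (a) in
/-- The sum of the `p`-th powers of the moduli of the Green functions of the far exterior from
neighbours of the shell to `y`, replaced by `1` if `y` is not in the far exterior. -/
def tailSum (p : ℝ) (Γ : Set (Lattice d)) (b : Lattice d) (w : Lattice d → ℂ)
    (y : Lattice d) : ℝ≥0∞ :=
  if y ∈ a.farExterior Γ b then
    ∑ i ∈ a.shellIn Γ b, ∑ j ∈ neighbors i,
      ‖greenKernel (laplacian d) (a.farExterior Γ b) w j y‖ₑ ^ p
  else 1

variable {w : Lattice d → ℂ} {c p : ℝ}

variable (a) in
theorem shellSum_ne_top (Γ : Set (Lattice d)) (b : Lattice d) (w : Lattice d → ℂ) :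
    a.shellSum Γ b w ≠ ∞ :=
  ENNReal.sum_ne_top.2 fun _ _ => ENNReal.sum_ne_top.2 fun _ _ => enorm_ne_top

theorem enorm_greenKernel_le_shellSum (hj : j ∈ a.shellIn Γ b) (hk : k ∈ a.shellIn Γ b) :
    ‖greenKernel (laplacian d) (a.exterior Γ b) w j k‖ₑ ≤ a.shellSum Γ b w :=
  (Finset.single_le_sum (f := fun k => ‖greenKernel (laplacian d) (a.exterior Γ b) w j k‖ₑ)
    (fun _ _ => zero_le) hk).trans
    (Finset.single_le_sum (f := fun j => ∑ k ∈ a.shellIn Γ b,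
      ‖greenKernel (laplacian d) (a.exterior Γ b) w j k‖ₑ) (fun _ _ => zero_le) hj)

theorem enorm_greenKernel_rpow_le_shellSum_mul_tailSum (hw : IsDissipative c w)
    (hj : j ∈ a.shellIn Γ b) (hy : y ∈ a.exterior Γ b) (hp₀ : 0 < p) (hp₁ : p ≤ 1) :
    ‖greenKernel (laplacian d) (a.exterior Γ b) w j y‖ₑ ^ p ≤
      a.shellSum Γ b w ^ p * a.tailSum p Γ b w y := by
  by_cases hyf : y ∈ a.farExterior Γ b
  · rw [tailSum, if_pos hyf, mul_comm, Finset.sum_mul]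
    exact (enorm_greenKernel_laplacian_rpow_le Set.sdiff_subset coe_shellIn hw
      (notMem_farExterior hj) hyf hp₀ hp₁).trans (Finset.sum_le_sum fun i hi =>
        mul_le_mul_right (ENNReal.rpow_le_rpow (enorm_greenKernel_le_shellSum hj hi) hp₀.le) _)
  · rw [tailSum, if_neg hyf, mul_one]
    exact ENNReal.rpow_le_rpow (enorm_greenKernel_le_shellSum hj
      (mem_shellIn_of_notMem_farExterior hy hyf)) hp₀.le

theorem sum_enorm_greenKernel_rpow_le (hw : IsDissipative c w) (hk : k ∈ a.cellIn Γ b)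
    (hy : y ∈ a.exterior Γ b) (hp₀ : 0 < p) (hp₁ : p ≤ 1) :
    ∑ j ∈ neighbors k, ‖greenKernel (laplacian d) (a.exterior Γ b) w j y‖ₑ ^ p ≤
      (unitVectors d).card * (a.shellSum Γ b w ^ p * a.tailSum p Γ b w y) := by
  rw [← card_neighbors k, ← nsmul_eq_mul]
  refine Finset.sum_le_card_nsmul _ _ _ fun j hj => ?_
  by_cases hjb : j ∈ a.exterior Γ b
  · exact enorm_greenKernel_rpow_le_shellSum_mul_tailSum hw
      (mem_shellIn_of_mem_neighbors hk hj hjb) hy hp₀ hp₁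
  · rw [greenKernel_eq_zero hw.bdd hjb hy, enorm_zero, ENNReal.zero_rpow_of_pos hp₀]
    exact zero_le

variable (a) in
/-- The contribution of the cell site `k` to the bound for the `p`-th power of the modulus of the
Green function from `x` to `y` obtained by leaving first the cell and then the shell of `b`. -/
def stepTerm (p : ℝ) (Γ : Set (Lattice d)) (b : Lattice d) (w : Lattice d → ℂ)
    (x k y : Lattice d) : ℝ≥0∞ :=
  ‖greenKernel (laplacian d) Γ w x k‖ₑ ^ p *
    ((1 + a.shellSum Γ b w) ^ p * a.tailSum p Γ b w y)

theorem enorm_greenKernel_rpow_le_sum (hw : IsDissipative c w) (hx : x ∈ a.cellIn Γ b)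
    (hy : y ∈ Γ) (hp₀ : 0 < p) (hp₁ : p ≤ 1) :
    ‖greenKernel (laplacian d) Γ w x y‖ₑ ^ p ≤
      (1 + (unitVectors d).card) * ∑ k ∈ a.cellIn Γ b, a.stepTerm p Γ b w x k y := by
  simp only [stepTerm]
  by_cases hyb : y ∈ a.exterior Γ b
  · refine (enorm_greenKernel_laplacian_rpow_le Set.sdiff_subset coe_cellIn hw
      (notMem_exterior hx) hyb hp₀ hp₁).trans ?_
    rw [Finset.mul_sum]
    refine Finset.sum_le_sum fun k hk => ?_
    rw [mul_left_comm, mul_comm]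
    gcongr
    refine (sum_enorm_greenKernel_rpow_le hw hk hyb hp₀ hp₁).trans ?_
    gcongr <;> exact le_add_self
  · have hyf : y ∉ a.farExterior Γ b := fun h => hyb h.1
    rw [tailSum, if_neg hyf, mul_one, ← Finset.sum_mul]
    calc ‖greenKernel (laplacian d) Γ w x y‖ₑ ^ p
        ≤ ∑ k ∈ a.cellIn Γ b, ‖greenKernel (laplacian d) Γ w x k‖ₑ ^ p :=
          Finset.single_le_sum (f := fun k => ‖greenKernel (laplacian d) Γ w x k‖ₑ ^ p)
            (fun _ _ => zero_le) (mem_cellIn_of_notMem_exterior hy hyb)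
      _ = 1 * ((∑ k ∈ a.cellIn Γ b, ‖greenKernel (laplacian d) Γ w x k‖ₑ ^ p) * 1 ^ p) := by
          rw [ENNReal.one_rpow, mul_one, one_mul]
      _ ≤ _ := by gcongr <;> exact le_self_add

end Regions

end AlloyData

theorem potential_add {d : ℕ} {u : Lattice d → ℝ} (hu : (Function.support u).Finite)
    (ω η : Lattice d → ℝ) (x : Lattice d) :
    potential u (ω + η) x = potential u ω x + potential u η x := by
  simp only [potential_eq_sum hu, Pi.add_apply, add_mul, Finset.sum_add_distrib]

theorem potential_ite_mem {d : ℕ} (u : Lattice d → ℝ) (S : Finset (Lattice d)) (t : ℝ)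
    (x : Lattice d) :
    potential u (fun k => if k ∈ S then t else 0) x = t * ∑ k ∈ S, u (x - k) := by
  rw [potential, tsum_eq_sum (s := S) fun k hk => by rw [if_neg hk, zero_mul], Finset.mul_sum]
  exact Finset.sum_congr rfl fun k hk => by rw [if_pos hk]

namespace AlloyData

variable {d : ℕ} (a : AlloyData d)

section RandomPotential

/-- The truncation of a coupling constant to `[-3R, 3R]`. It makes the potential bounded for every
realisation, while leaving room for changing coupling constants in `[-2R, 2R]` by at most `R`. -/
def clamp (t : ℝ) : ℝ := max (-(3 * a.R)) (min (3 * a.R) t)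

/-- The alloy-type potential with truncated coupling constants. -/
def truncPotential (ω : Lattice d → ℝ) (x : Lattice d) : ℝ := potential a.u (a.clamp ∘ ω) x

/-- The complex potential `lam V_ω - z` with truncated coupling constants. -/
def complexPotential (lam : ℝ) (z : ℂ) (ω : Lattice d → ℝ) (x : Lattice d) : ℂ :=
  (lam * a.truncPotential ω x : ℝ) - z

theorem abs_clamp_le (t : ℝ) : |a.clamp t| ≤ 3 * a.R :=
  abs_le.2 ⟨le_max_left _ _, max_le (by linarith [a.R_pos]) (min_le_left _ _)⟩

theorem continuous_clamp : Continuous a.clamp :=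
  continuous_const.max (continuous_const.min continuous_id)

variable {a} {lam : ℝ} {z : ℂ} {ω ω' : Lattice d → ℝ} {Γ : Set (Lattice d)} {b x y : Lattice d}
  {t : ℝ}

theorem clamp_eq_self (ht : |t| ≤ 3 * a.R) : a.clamp t = t := by
  rw [clamp, min_eq_right (abs_le.1 ht).2, max_eq_right (abs_le.1 ht).1]

variable (a) in
theorem truncPotential_eq_sum (ω : Lattice d → ℝ) (x : Lattice d) :
    a.truncPotential ω x = ∑ θ ∈ a.finite_support.toFinset, a.clamp (ω (x - θ)) * a.u θ :=
  potential_eq_sum a.finite_support _ x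

variable (a) in
theorem abs_truncPotential_le (ω : Lattice d → ℝ) (x : Lattice d) :
    |a.truncPotential ω x| ≤ 3 * a.R * a.B := by
  rw [truncPotential_eq_sum, B, Finset.mul_sum]
  refine (Finset.abs_sum_le_sum_abs _ _).trans (Finset.sum_le_sum fun θ _ => ?_)
  rw [abs_mul]
  exact mul_le_mul_of_nonneg_right (a.abs_clamp_le _) (abs_nonneg _)

variable (a) in
theorem continuous_truncPotential (x : Lattice d) : Continuous fun ω => a.truncPotential ω x := by
  simp only [truncPotential_eq_sum]
  exact continuous_finsetSum _ fun θ _ =>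
    (a.continuous_clamp.comp (continuous_apply _)).mul continuous_const

theorem truncPotential_congr (h : ∀ k, x ∈ a.cell k → ω k = ω' k) :
    a.truncPotential ω x = a.truncPotential ω' x := by
  simp only [truncPotential_eq_sum]
  refine Finset.sum_congr rfl fun θ hθ => ?_
  rw [h (x - θ) (mem_cell.2 (by simpa using hθ))]

theorem truncPotential_add_ite {S : Finset (Lattice d)} (ht : t ∈ Set.Icc (-a.R) a.R)
    (hω : ∀ i ∈ S, ω i ∈ Set.Icc (-(2 * a.R)) (2 * a.R)) (x : Lattice d) :
    a.truncPotential (fun i => ω i + if i ∈ S then t else 0) x =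
      a.truncPotential ω x + t * ∑ j ∈ S, a.u (x - j) := by
  rw [truncPotential, truncPotential, ← potential_ite_mem, ← potential_add a.finite_support]
  congr 1
  funext i
  by_cases hi : i ∈ S
  · have hωi := abs_le.2 (hω i hi)
    have hti := (abs_add_le (ω i) t).trans (add_le_add hωi (abs_le.2 ht))
    simp only [Function.comp_apply, Pi.add_apply, if_pos hi]
    rw [clamp_eq_self (hωi.trans (by linarith [a.R_pos])), clamp_eq_self (by linarith)]
  · simp only [Function.comp_apply, Pi.add_apply, if_neg hi, add_zero]

theorem complexPotential_add_ite {S : Finset (Lattice d)} (ht : t ∈ Set.Icc (-a.R) a.R)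
    (hω : ∀ i ∈ S, ω i ∈ Set.Icc (-(2 * a.R)) (2 * a.R)) (x : Lattice d) :
    a.complexPotential lam z (fun i => ω i + if i ∈ S then t else 0) x =
      a.complexPotential lam z ω x + ((lam * t * ∑ j ∈ S, a.u (x - j) : ℝ) : ℂ) := by
  rw [complexPotential, complexPotential, truncPotential_add_ite ht hω]
  push_cast
  ring

theorem complexPotential_update (ht : t ∈ Set.Icc (-a.R) a.R) (x : Lattice d) :
    a.complexPotential lam z (Function.update ω b t) x =
      a.complexPotential lam z (Function.update ω b 0) x + ((lam * t * a.u (x - b) : ℝ) : ℂ) := by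
  have hupdate : Function.update ω b t =
      fun i => Function.update ω b 0 i + if i ∈ ({b} : Finset (Lattice d)) then t else 0 := by
    funext i
    rcases eq_or_ne i b with rfl | hi
    · simp
    · simp [hi]
  rw [hupdate, complexPotential_add_ite ht (by simp [a.R_pos.le]), Finset.sum_singleton]

theorem norm_complexPotential_le (hlam : 0 ≤ lam) (z : ℂ) (ω : Lattice d → ℝ) (x : Lattice d) :
    ‖a.complexPotential lam z ω x‖ ≤ lam * (3 * a.R * a.B) + ‖z‖ := by
  refine (norm_sub_le _ _).trans (add_le_add_left ?_ _)
  rw [Complex.norm_real, Real.norm_eq_abs, abs_mul, abs_of_nonneg hlam]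
  exact mul_le_mul_of_nonneg_left (a.abs_truncPotential_le ω x) hlam

theorem sub_le_norm_complexPotential (hlam : 0 ≤ lam) (z : ℂ) (ω : Lattice d → ℝ)
    (x : Lattice d) : ‖z‖ - lam * (3 * a.R * a.B) ≤ ‖a.complexPotential lam z ω x‖ := by
  rw [complexPotential, norm_sub_rev]
  refine le_trans (sub_le_sub_left ?_ _) (norm_sub_norm_le _ _)
  rw [Complex.norm_real, Real.norm_eq_abs, abs_mul, abs_of_nonneg hlam]
  exact mul_le_mul_of_nonneg_left (a.abs_truncPotential_le ω x) hlam

theorem isDissipative_complexPotential (hlam : 0 ≤ lam) (hz : z.im < 0) (ω : Lattice d → ℝ) :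
    IsDissipative (-z.im) (a.complexPotential lam z ω) where
  pos := neg_pos.2 hz
  bdd := ⟨_, norm_complexPotential_le hlam z ω⟩
  le_im x := by simp [complexPotential]

variable (a) in
theorem continuous_greenKernel_complexPotential (hlam : 0 ≤ lam) (hz : z.im < 0)
    (Γ : Set (Lattice d)) (x y : Lattice d) :
    Continuous fun ω => greenKernel (laplacian d) Γ (a.complexPotential lam z ω) x y :=
  continuous_greenKernel (isSelfAdjoint_laplacian d) Γ (isDissipative_complexPotential hlam hz)
    (norm_complexPotential_le hlam z) (fun x => (Complex.continuous_ofReal.comp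
      (continuous_const.mul (a.continuous_truncPotential x))).sub continuous_const) x y

variable (a) in
theorem measurable_enorm_greenKernel_rpow (hlam : 0 ≤ lam) (hz : z.im < 0) (Γ : Set (Lattice d))
    (x y : Lattice d) (p : ℝ) :
    Measurable fun ω => ‖greenKernel (laplacian d) Γ (a.complexPotential lam z ω) x y‖ₑ ^ p :=
  (a.continuous_greenKernel_complexPotential hlam hz Γ x y).enorm.measurable.pow_const p

theorem greenKernel_complexPotential_congr (hlam : 0 ≤ lam) (hz : z.im < 0)
    (h : ∀ k, Disjoint Γ (a.cell k) ∨ ω k = ω' k) (x : Lattice d) (hy : y ∈ Γ) :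
    greenKernel (laplacian d) Γ (a.complexPotential lam z ω) x y =
      greenKernel (laplacian d) Γ (a.complexPotential lam z ω') x y := by
  refine greenKernel_congr (isSelfAdjoint_laplacian d) (isDissipative_complexPotential hlam hz ω)
    (isDissipative_complexPotential hlam hz ω') (fun p hp => ?_) x hy
  rw [complexPotential, complexPotential, truncPotential_congr fun k hpk =>
    (h k).resolve_left (Set.not_disjoint_iff.2 ⟨p, hp, hpk⟩)]

theorem disjoint_exterior_cell : Disjoint (a.exterior Γ b) (a.cell b) :=
  Set.disjoint_sdiff_left

theorem disjoint_farExterior_cell_of_mem_neighbors {j : Lattice d} (hj : j ∈ neighbors b) :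
    Disjoint (a.farExterior Γ b) (a.cell j) :=
  Set.disjoint_left.2 fun _ hk hkj => hk.2 (mem_shell.2 ⟨⟨j, hj, hkj⟩, hk.1.2⟩)

theorem measurable_shellSum (hlam : 0 ≤ lam) (hz : z.im < 0) (Γ : Set (Lattice d))
    (b : Lattice d) : Measurable fun ω => a.shellSum Γ b (a.complexPotential lam z ω) :=
  Finset.measurable_sum _ fun i _ => Finset.measurable_sum _ fun j _ =>
    (a.continuous_greenKernel_complexPotential hlam hz (a.exterior Γ b) i j).enorm.measurable

theorem measurable_tailSum (hlam : 0 ≤ lam) (hz : z.im < 0) (p : ℝ) (Γ : Set (Lattice d))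
    (b y : Lattice d) : Measurable fun ω => a.tailSum p Γ b (a.complexPotential lam z ω) y := by
  unfold tailSum
  split_ifs
  · exact Finset.measurable_sum _ fun i _ => Finset.measurable_sum _ fun j _ =>
      a.measurable_enorm_greenKernel_rpow hlam hz _ _ _ _
  · exact measurable_const

theorem measurable_stepTerm (hlam : 0 ≤ lam) (hz : z.im < 0) (p : ℝ) (Γ : Set (Lattice d))
    (b x k y : Lattice d) :
    Measurable fun ω => a.stepTerm p Γ b (a.complexPotential lam z ω) x k y :=
  (a.measurable_enorm_greenKernel_rpow hlam hz Γ x k p).mul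
    ((((measurable_shellSum hlam hz Γ b).const_add 1).pow_const p).mul
      (measurable_tailSum hlam hz p Γ b y))

theorem shellSum_update (hlam : 0 ≤ lam) (hz : z.im < 0) (Γ : Set (Lattice d)) (b : Lattice d)
    (ω : Lattice d → ℝ) (r : ℝ) :
    a.shellSum Γ b (a.complexPotential lam z (Function.update ω b r)) =
      a.shellSum Γ b (a.complexPotential lam z ω) := by
  refine Finset.sum_congr rfl fun i _ => Finset.sum_congr rfl fun j hj => ?_
  rw [greenKernel_complexPotential_congr hlam hz (fun k => ?_) i (mem_exterior hj)]
  rcases eq_or_ne k b with rfl | hk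
  · exact Or.inl disjoint_exterior_cell
  · exact Or.inr (Function.update_of_ne hk r ω)

theorem tailSum_congr (hlam : 0 ≤ lam) (hz : z.im < 0) (p : ℝ) (Γ : Set (Lattice d))
    (b y : Lattice d) (h : ∀ i, i ≠ b → i ∉ neighbors b → ω i = ω' i) :
    a.tailSum p Γ b (a.complexPotential lam z ω) y =
      a.tailSum p Γ b (a.complexPotential lam z ω') y := by
  unfold tailSum
  split_ifs with hy
  · refine Finset.sum_congr rfl fun i _ => Finset.sum_congr rfl fun j _ => ?_
    rw [greenKernel_complexPotential_congr hlam hz (fun k => ?_) j hy]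
    rcases eq_or_ne k b with rfl | hkb
    · exact Or.inl (disjoint_exterior_cell.mono_left Set.sdiff_subset)
    · exact or_iff_not_imp_left.2 fun hk =>
        h k hkb fun hkn => hk (disjoint_farExterior_cell_of_mem_neighbors hkn)
  · rfl

end RandomPotential

end AlloyData

namespace AlloyData

variable {d : ℕ} {a : AlloyData d}

section Averaging

variable {lam Z τ p : ℝ} {z : ℂ} {ω : Lattice d → ℝ} {Γ : Set (Lattice d)} {b i j k x y : Lattice d}

theorem norm_schur_complexPotential_le (hlam : 1 ≤ lam) (hz : z.im < 0) (hzZ : ‖z‖ ≤ lam * Z)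
    (hZ : 0 ≤ Z) (hk : k ∈ a.cellIn Γ b) (hy : y ∈ a.cellIn Γ b) :
    ‖schur (laplacian d) (a.exterior Γ b) (a.complexPotential lam z ω) k y‖ ≤
      lam * ((3 * a.R * a.B + Z + (unitVectors d).card + (unitVectors d).card ^ 2 + 1) *
        (1 + (a.shellSum Γ b (a.complexPotential lam z ω)).toReal)) := by
  have hlam0 : 0 ≤ lam := zero_le_one.trans hlam
  set w := a.complexPotential lam z ω with hw
  set M := (a.shellSum Γ b w).toReal with hM
  set n : ℝ := ((unitVectors d).card : ℝ) with hn
  have hM0 : 0 ≤ M := ENNReal.toReal_nonneg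
  have hRB : 0 ≤ a.R * a.B := mul_nonneg a.R_pos.le a.B_nonneg
  have hG (i) (hi : i ∈ neighbors k) (j) (hj : j ∈ neighbors y) (hjb : j ∈ a.exterior Γ b) :
      ‖greenKernel (laplacian d) (a.exterior Γ b) w i j‖ ≤ M := by
    by_cases hib : i ∈ a.exterior Γ b
    · rw [← toReal_enorm]
      exact ENNReal.toReal_mono (a.shellSum_ne_top Γ b w) (enorm_greenKernel_le_shellSum
        (mem_shellIn_of_mem_neighbors hk hi hib) (mem_shellIn_of_mem_neighbors hy hj hjb))
    · rw [greenKernel_eq_zero (isDissipative_complexPotential hlam0 hz ω).bdd hib hjb, norm_zero]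
      exact hM0
  calc ‖schur (laplacian d) (a.exterior Γ b) w k y‖
      ≤ ‖w y‖ + n + n ^ 2 * M := norm_schur_laplacian_le hM0 hG
    _ ≤ lam * (3 * a.R * a.B + Z) * (1 + M) + lam * n * (1 + M) + lam * (n ^ 2 + 1) * (1 + M) := by
        have hn0 : 0 ≤ n := Nat.cast_nonneg _
        have h1 : 1 ≤ 1 + M := le_add_of_nonneg_right hM0
        refine add_le_add (add_le_add ?_ ?_) ?_
        · refine le_trans ?_ (le_mul_of_one_le_right (mul_nonneg hlam0 (by linarith)) h1)
          exact (norm_complexPotential_le hlam0 z ω y).trans (by linarith)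
        · exact (le_mul_of_one_le_left hn0 hlam).trans
            (le_mul_of_one_le_right (by positivity) h1)
        · refine (mul_le_mul (le_add_of_nonneg_right zero_le_one)
            (le_add_of_nonneg_left zero_le_one) hM0 (by positivity)).trans ?_
          rw [mul_assoc]
          exact le_mul_of_one_le_left (by positivity) hlam
    _ = _ := by ring

theorem exists_lintegral_update_le_of_norm_le (a : AlloyData d) (hZ : 0 ≤ Z) (hτ : 0 < τ)
    (hNτ : a.N * τ < 1) :
    ∃ C : ℝ≥0∞, C ≠ ∞ ∧ ∀ {lam : ℝ} {z : ℂ} {Γ : Set (Lattice d)} {b x k : Lattice d},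
      1 ≤ lam → z.im < 0 → ‖z‖ ≤ lam * Z → x ∈ a.cellIn Γ b → k ∈ a.cellIn Γ b →
      ∀ ω : Lattice d → ℝ, ∫⁻ r in Set.Icc (-a.R) a.R, ‖greenKernel (laplacian d) Γ
          (a.complexPotential lam z (Function.update ω b r)) x k‖ₑ ^ τ ≤
        C * ENNReal.ofReal (lam ^ (-τ)) *
          (1 + a.shellSum Γ b (a.complexPotential lam z ω)) ^ (a.N * τ) := by
  obtain ⟨m, hm, hmu⟩ := a.exists_le_abs_u
  obtain ⟨C, hC, hCle⟩ := exists_lintegral_greenKernel_le a.N hm a.B_nonneg a.R_pos.le hτ hNτ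
  set D : ℝ := 3 * a.R * a.B + Z + (unitVectors d).card + (unitVectors d).card ^ 2 + 1 with hD
  have hD1 : 1 ≤ D := by
    have := mul_nonneg a.R_pos.le a.B_nonneg
    have : (0 : ℝ) ≤ (unitVectors d).card ^ 2 := by positivity
    linarith [(unitVectors d).card.cast_nonneg (α := ℝ)]
  refine ⟨C * ENNReal.ofReal (D ^ (a.N * τ)), ENNReal.mul_ne_top hC ENNReal.ofReal_ne_top,
    fun {lam z Γ b x k} hlam hz hzZ hx hk ω => ?_⟩
  have hlam0 : 0 < lam := one_pos.trans_le hlam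
  rw [← shellSum_update hlam0.le hz Γ b ω 0]
  set w := a.complexPotential lam z (Function.update ω b 0) with hw
  have hfactor : ENNReal.ofReal ((D * (1 + (a.shellSum Γ b w).toReal)) ^ (a.N * τ)) =
      ENNReal.ofReal (D ^ (a.N * τ)) * (1 + a.shellSum Γ b w) ^ (a.N * τ) := by
    have hM0 : 0 ≤ (a.shellSum Γ b w).toReal := ENNReal.toReal_nonneg
    rw [Real.mul_rpow (by positivity) (by positivity), ENNReal.ofReal_mul (by positivity),
      ← ENNReal.ofReal_rpow_of_nonneg (x := 1 + _) (by positivity) (by positivity),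
      ENNReal.ofReal_add zero_le_one hM0, ENNReal.ofReal_one,
      ENNReal.ofReal_toReal (a.shellSum_ne_top Γ b w)]
  calc ∫⁻ r in Set.Icc (-a.R) a.R, ‖greenKernel (laplacian d) Γ
          (a.complexPotential lam z (Function.update ω b r)) x k‖ₑ ^ τ
      = ∫⁻ r in Set.Icc (-a.R) a.R, ‖greenKernel (laplacian d) Γ
          (fun l => w l + ((lam * r * a.u (l - b) : ℝ) : ℂ)) x k‖ₑ ^ τ :=
        setLIntegral_congr_fun measurableSet_Icc fun r hr => by
          simp only [funext (complexPotential_update hr), hw]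
    _ ≤ C * ENNReal.ofReal (lam ^ (-τ)) *
          ENNReal.ofReal ((D * (1 + (a.shellSum Γ b w).toReal)) ^ (a.N * τ)) :=
        hCle (U := fun l => a.u (l - b)) Set.sdiff_subset coe_cellIn (a.card_cellIn_le Γ b)
          (isSelfAdjoint_laplacian d) (isDissipative_complexPotential hlam0.le hz _)
          (fun l hl => notMem_cell.1 hl.2) (fun l hl => hmu _ (mem_cell.1 (mem_cellIn.1 hl).1))
          (fun l => a.abs_u_le _) hlam0
          (one_le_mul_of_one_le_of_one_le hD1 (le_add_of_nonneg_right ENNReal.toReal_nonneg))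
          (fun l hl y hy => norm_schur_complexPotential_le hlam hz hzZ hZ hl hy) x hx k hk
    _ = _ := by rw [hfactor]; ring

theorem enorm_greenKernel_rpow_le_of_lt_norm (hlam : 1 ≤ lam) (hz : z.im < 0)
    (hzZ : lam * (3 * a.R * a.B + 1 + (unitVectors d).card) < ‖z‖) (hτ : 0 ≤ τ) :
    ‖greenKernel (laplacian d) Γ (a.complexPotential lam z ω) x y‖ₑ ^ τ ≤
      ENNReal.ofReal (lam ^ (-τ)) := by
  have hlam0 : 0 < lam := one_pos.trans_le hlam
  have hbound : ‖greenKernel (laplacian d) Γ (a.complexPotential lam z ω) x y‖ ≤ lam⁻¹ := by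
    refine norm_greenKernel_le_of_le_norm (isSelfAdjoint_laplacian d)
      (isDissipative_complexPotential hlam0.le hz ω) hlam0 (fun l => ?_) x y
    have hcard : ((unitVectors d).card : ℝ) ≤ lam * (unitVectors d).card :=
      le_mul_of_one_le_left (Nat.cast_nonneg _) hlam
    linarith [sub_le_norm_complexPotential (a := a) hlam0.le z ω l, norm_laplacian_le d]
  rw [Real.rpow_neg hlam0.le, ← Real.inv_rpow hlam0.le,
    ← ENNReal.ofReal_rpow_of_nonneg (by positivity) hτ, ← ofReal_norm]
  gcongr

theorem exists_lintegral_update_le (a : AlloyData d) (hτ : 0 < τ) (hNτ : a.N * τ < 1) :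
    ∃ C : ℝ≥0∞, C ≠ ∞ ∧ ∀ {lam : ℝ} {z : ℂ} {Γ : Set (Lattice d)} {b x k : Lattice d},
      1 ≤ lam → z.im < 0 → x ∈ a.cellIn Γ b → k ∈ a.cellIn Γ b →
      ∀ ω : Lattice d → ℝ, ∫⁻ r in Set.Icc (-a.R) a.R, ‖greenKernel (laplacian d) Γ
          (a.complexPotential lam z (Function.update ω b r)) x k‖ₑ ^ τ ≤
        C * ENNReal.ofReal (lam ^ (-τ)) *
          (1 + a.shellSum Γ b (a.complexPotential lam z ω)) ^ (a.N * τ) := by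
  set Z : ℝ := 3 * a.R * a.B + 1 + (unitVectors d).card
  have hZ0 : 0 ≤ Z := by
    have := mul_nonneg a.R_pos.le a.B_nonneg
    linarith [(unitVectors d).card.cast_nonneg (α := ℝ)]
  obtain ⟨C, hC, hCle⟩ := a.exists_lintegral_update_le_of_norm_le hZ0 hτ hNτ
  refine ⟨C + volume (Set.Icc (-a.R) a.R), ENNReal.add_ne_top.2 ⟨hC, by simp⟩,
    fun {lam z Γ b x k} hlam hz hx hk ω => ?_⟩
  rcases le_or_gt ‖z‖ (lam * Z) with hzZ | hzZ
  · refine (hCle hlam hz hzZ hx hk ω).trans ?_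
    gcongr
    exact le_self_add
  · calc ∫⁻ r in Set.Icc (-a.R) a.R, ‖greenKernel (laplacian d) Γ
            (a.complexPotential lam z (Function.update ω b r)) x k‖ₑ ^ τ
        ≤ ∫⁻ _ in Set.Icc (-a.R) a.R, ENNReal.ofReal (lam ^ (-τ)) :=
          lintegral_mono fun r => enorm_greenKernel_rpow_le_of_lt_norm hlam hz hzZ hτ.le
      _ = volume (Set.Icc (-a.R) a.R) * ENNReal.ofReal (lam ^ (-τ)) * 1 ^ (a.N * τ) := by
          rw [setLIntegral_const, ENNReal.one_rpow, mul_one, mul_comm]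
      _ ≤ _ := by
          gcongr
          · exact le_add_self
          · exact le_self_add

/-- The sum over pairs of shell sites of the `p`-th powers of the moduli of the Green functions of
the exterior region, increased by `1`. -/
def shellMoment (a : AlloyData d) (p : ℝ) (Γ : Set (Lattice d)) (b : Lattice d)
    (w : Lattice d → ℂ) : ℝ≥0∞ :=
  1 + ∑ i ∈ a.shellIn Γ b, ∑ j ∈ a.shellIn Γ b,
    ‖greenKernel (laplacian d) (a.exterior Γ b) w i j‖ₑ ^ p

theorem one_add_shellSum_rpow_le (hp₀ : 0 < p) (hp₁ : p ≤ 1) (w : Lattice d → ℂ) :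
    (1 + a.shellSum Γ b w) ^ p ≤ a.shellMoment p Γ b w := by
  refine (ENNReal.rpow_add_le_add_rpow _ _ hp₀.le hp₁).trans ?_
  rw [ENNReal.one_rpow, shellMoment, shellSum]
  gcongr
  exact (ennreal_sum_rpow_le _ _ hp₀ hp₁).trans
    (Finset.sum_le_sum fun i _ => ennreal_sum_rpow_le _ _ hp₀ hp₁)

theorem measurable_shellMoment (hlam : 0 ≤ lam) (hz : z.im < 0) (p : ℝ) (Γ : Set (Lattice d))
    (b : Lattice d) : Measurable fun ω => a.shellMoment p Γ b (a.complexPotential lam z ω) :=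
  (Finset.measurable_sum _ fun i _ => Finset.measurable_sum _ fun j _ =>
    a.measurable_enorm_greenKernel_rpow hlam hz (a.exterior Γ b) i j p).const_add _

theorem lintegral_enorm_greenKernel_exterior_le {m : ℝ} (hm : 0 < m)
    (hmu : ∀ k, a.u k ≠ 0 → m ≤ |a.u k|) (hp₀ : 0 < p) (hp₁ : p < 1) (hlam : 1 ≤ lam)
    (hz : z.im < 0) (hω : ∀ l ∈ neighbors b, ω l ∈ Set.Icc (-(2 * a.R)) (2 * a.R))
    (hi : i ∈ a.shellIn Γ b) (hj : j ∈ a.shellIn Γ b) :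
    ∫⁻ t in Set.Icc (-a.R) a.R, ‖greenKernel (laplacian d) (a.exterior Γ b)
        (a.complexPotential lam z fun l => ω l + if l ∈ neighbors b then t else 0) i j‖ₑ ^ p ≤
      4 * ENNReal.ofReal (halfPlaneConst p * ((4 / m) ^ p * a.R ^ (1 - p))) := by
  have hlam0 : 0 ≤ lam := zero_le_one.trans hlam
  set U : Lattice d → ℝ := fun l => if l ∈ a.cell b then 0 else lam * a.ringPotential b l with hU
  have hU0 (l) : 0 ≤ U l := by
    simp only [hU]
    split_ifs with h
    · exact le_rfl
    · exact mul_nonneg hlam0 (ringPotential_nonneg h)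
  have hUB (l) : U l ≤ lam * ((unitVectors d).card * a.B) := by
    simp only [hU]
    split_ifs
    · exact mul_nonneg hlam0 (mul_nonneg (Nat.cast_nonneg _) a.B_nonneg)
    · exact mul_le_mul_of_nonneg_left (a.ringPotential_le b l) hlam0
  have hUm (l) (hl : l ∈ a.shellIn Γ b) : m ≤ U l := by
    have hlb : l ∉ a.cell b := (mem_exterior hl).2
    rw [show U l = lam * a.ringPotential b l from if_neg hlb]
    exact (le_ringPotential hmu (mem_shellIn.1 hl).1).trans
      (le_mul_of_one_le_left (ringPotential_nonneg hlb) hlam)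
  have hw := isDissipative_complexPotential (a := a) hlam0 hz
  refine le_trans (le_of_eq ?_) (lintegral_greenKernel_le_of_monotone (isSelfAdjoint_laplacian d)
    (hw ω) hU0 ⟨_, hUB⟩ hm (hUm i hi) (hUm j hj) hp₀ hp₁ a.R_pos (Γ := a.exterior Γ b))
  refine setLIntegral_congr_fun measurableSet_Icc fun t ht => ?_
  rw [greenKernel_congr (isSelfAdjoint_laplacian d) (hw _)
    ((hw ω).add_mul hU0 ⟨_, hUB⟩ (ζ := (t : ℂ)) (by simp)) (fun l hl => ?_) i (mem_exterior hj)]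
  have hUl : U l = lam * ∑ k ∈ neighbors b, a.u (l - k) := if_neg hl.2
  rw [complexPotential_add_ite ht hω, hUl]
  push_cast
  ring

theorem exists_lintegral_shellMoment_le (a : AlloyData d) (hp₀ : 0 < p) (hp₁ : p < 1) :
    ∃ C : ℝ≥0∞, C ≠ ∞ ∧ ∀ {lam : ℝ} {z : ℂ} (Γ : Set (Lattice d)) {b : Lattice d}
      {ω : Lattice d → ℝ}, 1 ≤ lam → z.im < 0 →
      (∀ l ∈ neighbors b, ω l ∈ Set.Icc (-(2 * a.R)) (2 * a.R)) →
      ∫⁻ t in Set.Icc (-a.R) a.R, a.shellMoment p Γ b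
        (a.complexPotential lam z fun l => ω l + if l ∈ neighbors b then t else 0) ≤ C := by
  obtain ⟨m, hm, hmu⟩ := a.exists_le_abs_u
  set C := 4 * ENNReal.ofReal (halfPlaneConst p * ((4 / m) ^ p * a.R ^ (1 - p)))
  set n := (unitVectors d).card * a.N
  have hCtop : C ≠ ∞ := ENNReal.mul_ne_top (by norm_num) ENNReal.ofReal_ne_top
  refine ⟨volume (Set.Icc (-a.R) a.R) + n • n • C,
    ENNReal.add_ne_top.2 ⟨by simp, by simp only [nsmul_eq_mul]; finiteness⟩,
    fun {lam z} Γ {b ω} hlam hz hω => ?_⟩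
  have hshift : Measurable fun (t : ℝ) (l : Lattice d) => ω l + if l ∈ neighbors b then t else 0 :=
    measurable_pi_lambda _ fun l => by split_ifs <;> fun_prop
  have hmeas (i j) : Measurable fun t : ℝ => ‖greenKernel (laplacian d) (a.exterior Γ b)
      (a.complexPotential lam z fun l => ω l + if l ∈ neighbors b then t else 0) i j‖ₑ ^ p :=
    (a.measurable_enorm_greenKernel_rpow (zero_le_one.trans hlam) hz _ i j p).comp hshift
  have hsum {f : Lattice d → ℝ≥0∞} {D : ℝ≥0∞} (hf : ∀ l ∈ a.shellIn Γ b, f l ≤ D) :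
      ∑ l ∈ a.shellIn Γ b, f l ≤ n • D :=
    (Finset.sum_le_card_nsmul _ _ D hf).trans (nsmul_le_nsmul_left zero_le (a.card_shellIn_le Γ b))
  simp only [shellMoment]
  rw [lintegral_add_left measurable_const, setLIntegral_const, one_mul,
    lintegral_finsetSum _ fun i _ => Finset.measurable_sum _ fun j _ => hmeas i j]
  gcongr
  refine hsum fun i hi => ?_
  rw [lintegral_finsetSum _ fun j _ => hmeas i j]
  exact hsum fun j hj => lintegral_enorm_greenKernel_exterior_le hm hmu hp₀ hp₁ hlam hz hω hi hj

end Averaging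

end AlloyData

namespace AlloyData

variable {d : ℕ} {a : AlloyData d}

section OneStep

variable {τ p : ℝ} {μ : Measure ℝ} [IsProbabilityMeasure μ] {K : ℝ≥0∞}

theorem exists_lintegral_stepTerm_update_le (a : AlloyData d) (hτ : 0 < τ)
    (hNτ : (a.N + 1) * τ < 1) :
    ∃ C : ℝ≥0∞, C ≠ ∞ ∧ ∀ {lam : ℝ} {z : ℂ} {Γ : Set (Lattice d)} {b x k : Lattice d}
      (y : Lattice d), 1 ≤ lam → z.im < 0 → x ∈ a.cellIn Γ b → k ∈ a.cellIn Γ b →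
      ∀ ω : Lattice d → ℝ, ∫⁻ r in Set.Icc (-a.R) a.R,
          a.stepTerm τ Γ b (a.complexPotential lam z (Function.update ω b r)) x k y ≤
        C * ENNReal.ofReal (lam ^ (-τ)) *
          (a.shellMoment ((a.N + 1) * τ) Γ b (a.complexPotential lam z ω) *
            a.tailSum τ Γ b (a.complexPotential lam z ω) y) := by
  obtain ⟨C, hC, hCle⟩ := a.exists_lintegral_update_le hτ (by linarith)
  refine ⟨C, hC, fun {lam z Γ b x k} y hlam hz hx hk ω => ?_⟩
  have hlam0 : 0 ≤ lam := zero_le_one.trans hlam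
  set S := a.shellSum Γ b (a.complexPotential lam z ω) with hS
  set Y := a.tailSum τ Γ b (a.complexPotential lam z ω) y
  have hYr (r) : a.tailSum τ Γ b (a.complexPotential lam z (Function.update ω b r)) y = Y :=
    tailSum_congr hlam0 hz τ Γ b y fun i hi _ => Function.update_of_ne hi r ω
  simp only [stepTerm, shellSum_update hlam0 hz Γ b ω, hYr, ← hS]
  rw [lintegral_mul_const (f := fun r => ‖greenKernel (laplacian d) Γ
    (a.complexPotential lam z (Function.update ω b r)) x k‖ₑ ^ τ) _
    ((a.measurable_enorm_greenKernel_rpow hlam0 hz Γ x k τ).comp (measurable_update ω))]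
  calc _ ≤ C * ENNReal.ofReal (lam ^ (-τ)) * (1 + S) ^ (a.N * τ) * ((1 + S) ^ τ * Y) :=
        mul_le_mul_left (hCle hlam hz hx hk ω) _
    _ = C * ENNReal.ofReal (lam ^ (-τ)) * ((1 + S) ^ ((a.N + 1) * τ) * Y) := by
        rw [add_mul, one_mul, ENNReal.rpow_add_of_nonneg _ _ (by positivity) hτ.le]
        ring
    _ ≤ _ := by
        gcongr
        exact one_add_shellSum_rpow_le (by positivity) hNτ.le _

theorem exists_lintegral_shellMoment_mul_tailSum_le (hμ : HasBoundedDensity μ K a.R)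
    (hp₀ : 0 < p) (hp₁ : p < 1) (τ : ℝ) :
    ∃ C : ℝ≥0∞, C ≠ ∞ ∧ ∀ {lam : ℝ} {z : ℂ} (Γ : Set (Lattice d)) (b y : Lattice d),
      1 ≤ lam → z.im < 0 →
      ∫⁻ ω, a.shellMoment p Γ b (a.complexPotential lam z ω) *
          a.tailSum τ Γ b (a.complexPotential lam z ω) y ∂law d μ ≤
        C * ∫⁻ ω, a.tailSum τ Γ b (a.complexPotential lam z ω) y ∂law d μ := by
  obtain ⟨C, hC, hCle⟩ := a.exists_lintegral_shellMoment_le hp₀ hp₁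
  have hR : ENNReal.ofReal (2 * a.R) ≠ 0 := by simpa using a.R_pos
  refine ⟨(ENNReal.ofReal (2 * a.R))⁻¹ *
    ((K * ENNReal.ofReal (4 * a.R)) ^ (unitVectors d).card * C),
    ENNReal.mul_ne_top (ENNReal.inv_ne_top.2 hR) (ENNReal.mul_ne_top (ENNReal.pow_ne_top
      (ENNReal.mul_ne_top hμ.ne_top ENNReal.ofReal_ne_top)) hC),
    fun {lam z} Γ b y hlam hz => ?_⟩
  have hlam0 : 0 ≤ lam := zero_le_one.trans hlam
  rw [← card_neighbors b]
  exact lintegral_infinitePi_mul_le_of_shift hμ (neighbors b)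
    (measurable_shellMoment hlam0 hz p Γ b) (measurable_tailSum hlam0 hz τ Γ b y)
    (fun ω ω' h => tailSum_congr hlam0 hz τ Γ b y fun i _ hi => h i hi)
    fun ω hω => hCle Γ hlam hz hω

theorem exists_lintegral_stepTerm_le (hμ : HasBoundedDensity μ K a.R) (hτ : 0 < τ)
    (hNτ : (a.N + 1) * τ < 1) :
    ∃ C : ℝ≥0∞, C ≠ ∞ ∧ ∀ {lam : ℝ} {z : ℂ} {Γ : Set (Lattice d)} {b x k : Lattice d}
      (y : Lattice d), 1 ≤ lam → z.im < 0 → x ∈ a.cellIn Γ b → k ∈ a.cellIn Γ b →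
      ∫⁻ ω, a.stepTerm τ Γ b (a.complexPotential lam z ω) x k y ∂law d μ ≤
        C * ENNReal.ofReal (lam ^ (-τ)) *
          ∫⁻ ω, a.tailSum τ Γ b (a.complexPotential lam z ω) y ∂law d μ := by
  obtain ⟨C₁, hC₁, hC₁le⟩ := a.exists_lintegral_stepTerm_update_le hτ hNτ
  obtain ⟨C₂, hC₂, hC₂le⟩ :=
    exists_lintegral_shellMoment_mul_tailSum_le hμ (by positivity) hNτ τ
  refine ⟨K * C₁ * C₂, ENNReal.mul_ne_top (ENNReal.mul_ne_top hμ.ne_top hC₁) hC₂,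
    fun {lam z Γ b x k} y hlam hz hx hk => ?_⟩
  have hlam0 : 0 ≤ lam := zero_le_one.trans hlam
  set w := a.complexPotential lam z
  calc ∫⁻ ω, a.stepTerm τ Γ b (w ω) x k y ∂law d μ
      ≤ ∫⁻ ω, (K * ∫⁻ r in Set.Icc (-a.R) a.R,
          a.stepTerm τ Γ b (w (Function.update ω b r)) x k y) ∂law d μ :=
        lintegral_infinitePi_le_update hμ b (measurable_stepTerm hlam0 hz τ Γ b x k y)
    _ ≤ ∫⁻ ω, K * (C₁ * ENNReal.ofReal (lam ^ (-τ)) *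
          (a.shellMoment ((a.N + 1) * τ) Γ b (w ω) * a.tailSum τ Γ b (w ω) y)) ∂law d μ :=
        lintegral_mono fun ω => mul_le_mul_right (hC₁le y hlam hz hx hk ω) K
    _ = K * (C₁ * ENNReal.ofReal (lam ^ (-τ))) *
          ∫⁻ ω, a.shellMoment ((a.N + 1) * τ) Γ b (w ω) * a.tailSum τ Γ b (w ω) y ∂law d μ := by
        simp only [← mul_assoc K]
        exact lintegral_const_mul _ ((measurable_shellMoment hlam0 hz _ Γ b).mul
          (measurable_tailSum hlam0 hz τ Γ b y))
    _ ≤ K * (C₁ * ENNReal.ofReal (lam ^ (-τ))) *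
          (C₂ * ∫⁻ ω, a.tailSum τ Γ b (w ω) y ∂law d μ) :=
        mul_le_mul_right (hC₂le Γ b y hlam hz) _
    _ = _ := by ring

theorem exists_lintegral_greenKernel_le_tailSum (hμ : HasBoundedDensity μ K a.R) (hτ : 0 < τ)
    (hNτ : (a.N + 1) * τ < 1) :
    ∃ C : ℝ≥0∞, C ≠ ∞ ∧ ∀ {lam : ℝ} {z : ℂ} {Γ : Set (Lattice d)} {x y : Lattice d},
      1 ≤ lam → z.im < 0 → x ∈ Γ → y ∈ Γ →
      ∫⁻ ω, ‖greenKernel (laplacian d) Γ (a.complexPotential lam z ω) x y‖ₑ ^ τ ∂law d μ ≤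
        C * ENNReal.ofReal (lam ^ (-τ)) *
          ∫⁻ ω, a.tailSum τ Γ x (a.complexPotential lam z ω) y ∂law d μ := by
  obtain ⟨C, hC, hCle⟩ := exists_lintegral_stepTerm_le hμ hτ hNτ
  have hτ1 : τ ≤ 1 := by nlinarith [a.N.cast_nonneg (α := ℝ)]
  refine ⟨(1 + (unitVectors d).card) * (a.N * C), by finiteness,
    fun {lam z Γ x y} hlam hz hx hy => ?_⟩
  have hlam0 : 0 ≤ lam := zero_le_one.trans hlam
  have hxc : x ∈ a.cellIn Γ x := mem_cellIn.2 ⟨a.self_mem_cell x, hx⟩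
  set w := a.complexPotential lam z
  have hmeas (k) : Measurable fun ω => a.stepTerm τ Γ x (w ω) x k y :=
    measurable_stepTerm hlam0 hz τ Γ x x k y
  calc ∫⁻ ω, ‖greenKernel (laplacian d) Γ (w ω) x y‖ₑ ^ τ ∂law d μ
      ≤ ∫⁻ ω, (1 + (unitVectors d).card) *
          ∑ k ∈ a.cellIn Γ x, a.stepTerm τ Γ x (w ω) x k y ∂law d μ :=
        lintegral_mono fun ω => enorm_greenKernel_rpow_le_sum
          (isDissipative_complexPotential hlam0 hz ω) hxc hy hτ hτ1
    _ = (1 + (unitVectors d).card) *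
          ∑ k ∈ a.cellIn Γ x, ∫⁻ ω, a.stepTerm τ Γ x (w ω) x k y ∂law d μ := by
        rw [lintegral_const_mul _ (Finset.measurable_sum _ fun k _ => hmeas k),
          lintegral_finsetSum _ fun k _ => hmeas k]
    _ ≤ (1 + (unitVectors d).card) * (a.N * (C * ENNReal.ofReal (lam ^ (-τ)) *
          ∫⁻ ω, a.tailSum τ Γ x (w ω) y ∂law d μ)) := by
        gcongr
        refine (Finset.sum_le_card_nsmul _ _ _ fun k hk => hCle y hlam hz hxc hk).trans ?_
        rw [nsmul_eq_mul]
        gcongr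
        exact a.card_cellIn_le Γ x
    _ = _ := by ring

end OneStep

end AlloyData

section Iteration

variable {ι κ : Type*} {f g : ι → ℝ≥0∞} {q E M : ℝ≥0∞} {n : ℕ}

theorem le_add_pow_mul_of_forall_le_or_le_sum (hfM : ∀ i, f i ≤ M) (hE : 1 ≤ E)
    (hq : q * (n * E) ≤ 2⁻¹)
    (h : ∀ i, f i ≤ g i ∨ ∃ (s : Finset κ) (φ : κ → ι), s.card ≤ n ∧
      (∀ j ∈ s, g (φ j) ≤ E * g i) ∧ f i ≤ q * ∑ j ∈ s, f (φ j)) (k : ℕ) (i : ι) :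
    f i ≤ g i + 2⁻¹ ^ k * M := by
  induction k generalizing i with
  | zero => simpa using (hfM i).trans le_add_self
  | succ k ih =>
    rcases h i with hi | ⟨s, φ, hs, hg, hfi⟩
    · exact hi.trans le_self_add
    have hqn : q * n ≤ 2⁻¹ := le_trans (by gcongr; exact le_mul_of_one_le_right' hE) hq
    calc f i ≤ q * ∑ j ∈ s, f (φ j) := hfi
      _ ≤ q * (n * (E * g i + 2⁻¹ ^ k * M)) := by
          gcongr
          refine (Finset.sum_le_card_nsmul s _ (E * g i + 2⁻¹ ^ k * M) fun j hj =>
            (ih (φ j)).trans (add_le_add_left (hg j hj) _)).trans ?_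
          rw [nsmul_eq_mul]
          gcongr
      _ = q * (n * E) * g i + q * n * (2⁻¹ ^ k * M) := by ring
      _ ≤ 1 * g i + 2⁻¹ * (2⁻¹ ^ k * M) := by
          gcongr
          exact hq.trans (by simp)
      _ = g i + 2⁻¹ ^ (k + 1) * M := by rw [one_mul, pow_succ', mul_assoc]

theorem le_of_forall_le_or_le_sum (hM : M ≠ ∞) (hfM : ∀ i, f i ≤ M) (hE : 1 ≤ E)
    (hq : q * (n * E) ≤ 2⁻¹)
    (h : ∀ i, f i ≤ g i ∨ ∃ (s : Finset κ) (φ : κ → ι), s.card ≤ n ∧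
      (∀ j ∈ s, g (φ j) ≤ E * g i) ∧ f i ≤ q * ∑ j ∈ s, f (φ j)) (i : ι) : f i ≤ g i := by
  have hlim : Filter.Tendsto (fun k : ℕ => g i + 2⁻¹ ^ k * M) Filter.atTop
      (nhds (g i + 0 * M)) :=
    tendsto_const_nhds.add (ENNReal.Tendsto.mul_const
      (ENNReal.tendsto_pow_atTop_nhds_zero_of_lt_one (by simp)) (Or.inr hM))
  rw [zero_mul, add_zero] at hlim
  exact ge_of_tendsto' hlim fun k => le_add_pow_mul_of_forall_le_or_le_sum hfM hE hq h k i

end Iteration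

instance isProbabilityMeasure_law (d : ℕ) (μ : Measure ℝ) [IsProbabilityMeasure μ] :
    IsProbabilityMeasure (law d μ) := by
  unfold law
  infer_instance

namespace AlloyData

variable {d : ℕ} {a : AlloyData d}

section Decay

variable {Γ : Set (Lattice d)} {i j x y : Lattice d} {τ γ lam : ℝ} {z : ℂ} {q : ℝ≥0∞}
  {μ : Measure ℝ}

theorem norm_sub_le_of_notMem_farExterior (hy : y ∈ Γ) (hyx : y ∉ a.farExterior Γ x) :
    ‖x - y‖ ≤ a.L := by
  rw [norm_sub_rev]
  by_cases hyc : y ∈ a.exterior Γ x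
  · exact norm_sub_le_of_mem_shell
      (mem_shellIn.1 (mem_shellIn_of_notMem_farExterior hyc hyx)).1
  · exact norm_sub_le_of_mem_cell (mem_cellIn.1 (mem_cellIn_of_notMem_exterior hy hyc)).1

theorem norm_sub_le_of_mem_neighbors_shellIn (hi : i ∈ a.shellIn Γ x) (hj : j ∈ neighbors i)
    (y : Lattice d) : ‖x - y‖ ≤ a.L + 1 + ‖j - y‖ := by
  have hxi := norm_sub_le_of_mem_shell (mem_shellIn.1 hi).1
  have hij := norm_sub_le_one_of_mem_neighbors hj
  rw [norm_sub_rev] at hxi hij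
  linarith [norm_sub_le_norm_sub_add_norm_sub x i y, norm_sub_le_norm_sub_add_norm_sub i j y]

theorem lintegral_tailSum_of_mem (hlam : 0 ≤ lam) (hz : z.im < 0) (p : ℝ)
    (hy : y ∈ a.farExterior Γ x) :
    ∫⁻ ω, a.tailSum p Γ x (a.complexPotential lam z ω) y ∂law d μ =
      ∑ v ∈ (a.shellIn Γ x).sigma neighbors, ∫⁻ ω, ‖greenKernel (laplacian d) (a.farExterior Γ x)
        (a.complexPotential lam z ω) v.2 y‖ₑ ^ p ∂law d μ := by
  have hmeas := fun j => a.measurable_enorm_greenKernel_rpow hlam hz (a.farExterior Γ x) j y p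
  simp only [tailSum, if_pos hy, Finset.sum_sigma]
  rw [lintegral_finsetSum _ fun i _ => Finset.measurable_sum _ fun j _ => hmeas j]
  exact Finset.sum_congr rfl fun i _ => lintegral_finsetSum _ fun j _ => hmeas j

theorem card_sigma_neighbors_shellIn_le (Γ : Set (Lattice d)) (x : Lattice d) :
    ((a.shellIn Γ x).sigma neighbors).card ≤ (unitVectors d).card * a.N * (unitVectors d).card := by
  simp only [Finset.card_sigma, card_neighbors, Finset.sum_const, smul_eq_mul]
  exact Nat.mul_le_mul_right _ (a.card_shellIn_le Γ x)

variable [IsProbabilityMeasure μ]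

theorem lintegral_greenKernel_le_exp (hτ : 0 < τ) (hγ : 0 ≤ γ) (hlam : 0 ≤ lam) (hz : z.im < 0)
    (hq₁ : q ≤ 1) (hq : q * (((unitVectors d).card * a.N * (unitVectors d).card : ℕ) *
      ENNReal.ofReal (Real.exp (γ * (a.L + 1)))) ≤ 2⁻¹)
    (hstep : ∀ {Γ : Set (Lattice d)} {x y : Lattice d}, x ∈ Γ → y ∈ Γ →
      ∫⁻ ω, ‖greenKernel (laplacian d) Γ (a.complexPotential lam z ω) x y‖ₑ ^ τ ∂law d μ ≤
        q * ∫⁻ ω, a.tailSum τ Γ x (a.complexPotential lam z ω) y ∂law d μ) (hy : y ∈ Γ) :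
    ∫⁻ ω, ‖greenKernel (laplacian d) Γ (a.complexPotential lam z ω) x y‖ₑ ^ τ ∂law d μ ≤
      ENNReal.ofReal (Real.exp (γ * a.L) * Real.exp (-γ * ‖x - y‖)) := by
  have hdiss := isDissipative_complexPotential (a := a) hlam hz
  refine le_of_forall_le_or_le_sum (ι := {Γ : Set (Lattice d) // y ∈ Γ} × Lattice d)
    (κ := Σ _ : Lattice d, Lattice d)
    (f := fun v => ∫⁻ ω, ‖greenKernel (laplacian d) v.1.1 (a.complexPotential lam z ω) v.2 y‖ₑ ^ τ
      ∂law d μ)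
    (g := fun v => ENNReal.ofReal (Real.exp (γ * a.L) * Real.exp (-γ * ‖v.2 - y‖)))
    (M := ENNReal.ofReal (-z.im)⁻¹ ^ τ) (ENNReal.rpow_ne_top_of_nonneg hτ.le ENNReal.ofReal_ne_top)
    (fun v => ?_) ?_ hq ?_ (⟨Γ, hy⟩, x)
  · refine (lintegral_mono fun ω => ENNReal.rpow_le_rpow (z := τ) ?_ hτ.le).trans_eq
      (by rw [lintegral_const, measure_univ, mul_one])
    rw [← ofReal_norm]
    exact ENNReal.ofReal_le_ofReal (norm_greenKernel_le (isSelfAdjoint_laplacian d) (hdiss ω) _ _)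
  · exact ENNReal.one_le_ofReal.2 (Real.one_le_exp (mul_nonneg hγ (by linarith [a.L_nonneg])))
  rintro ⟨⟨Γ, hy⟩, x⟩
  by_cases hx : x ∈ Γ
  swap
  · left
    simp only [greenKernel_eq_zero (hdiss _).bdd hx hy, enorm_zero, ENNReal.zero_rpow_of_pos hτ,
      lintegral_zero]
    exact zero_le
  by_cases hyx : y ∈ a.farExterior Γ x
  · refine Or.inr ⟨(a.shellIn Γ x).sigma neighbors, fun v => (⟨a.farExterior Γ x, hyx⟩, v.2),
      card_sigma_neighbors_shellIn_le Γ x, fun v hv => ?_,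
      (hstep hx hy).trans_eq (by rw [lintegral_tailSum_of_mem hlam hz τ hyx])⟩
    obtain ⟨hi, hj⟩ := Finset.mem_sigma.1 hv
    rw [← ENNReal.ofReal_mul (Real.exp_pos _).le]
    simp only [← Real.exp_add]
    refine ENNReal.ofReal_le_ofReal (Real.exp_le_exp.2 ?_)
    nlinarith [norm_sub_le_of_mem_neighbors_shellIn hi hj y]
  · left
    refine ((hstep hx hy).trans_eq ?_).trans (hq₁.trans ?_)
    · simp only [tailSum, if_neg hyx]
      rw [lintegral_const, measure_univ, one_mul, mul_one]
    · rw [← Real.exp_add, ENNReal.one_le_ofReal]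
      refine Real.one_le_exp ?_
      nlinarith [norm_sub_le_of_notMem_farExterior hy hyx]

theorem tendsto_mul_ofReal_rpow_neg {C : ℝ≥0∞} (hC : C ≠ ∞) (hτ : 0 < τ) :
    Filter.Tendsto (fun lam : ℝ => C * ENNReal.ofReal (lam ^ (-τ))) Filter.atTop (nhds 0) := by
  have h := ENNReal.Tendsto.const_mul (a := C)
    (ENNReal.tendsto_ofReal (tendsto_rpow_neg_atTop hτ)) (Or.inr hC)
  rwa [ENNReal.ofReal_zero, mul_zero] at h

theorem exists_lintegral_greenKernel_le_exp {K : ℝ≥0∞} (hμ : HasBoundedDensity μ K a.R)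
    (hτ : 0 < τ) (hNτ : (a.N + 1) * τ < 1) (hγ : 0 ≤ γ) :
    ∃ lam₀ : ℝ, 0 < lam₀ ∧ ∀ {lam : ℝ} {z : ℂ} {Γ : Set (Lattice d)} (x : Lattice d)
      {y : Lattice d}, lam₀ ≤ lam → z.im < 0 → y ∈ Γ →
      ∫⁻ ω, ‖greenKernel (laplacian d) Γ (a.complexPotential lam z ω) x y‖ₑ ^ τ ∂law d μ ≤
        ENNReal.ofReal (Real.exp (γ * a.L) * Real.exp (-γ * ‖x - y‖)) := by
  obtain ⟨C, hC, hCle⟩ := exists_lintegral_greenKernel_le_tailSum hμ hτ hNτ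
  set D : ℝ≥0∞ := ((unitVectors d).card * a.N * (unitVectors d).card : ℕ) *
    ENNReal.ofReal (Real.exp (γ * (a.L + 1))) with hD
  have hq := tendsto_mul_ofReal_rpow_neg hC hτ
  have hqD : Filter.Tendsto (fun lam : ℝ => C * ENNReal.ofReal (lam ^ (-τ)) * D) Filter.atTop
      (nhds 0) := by
    simpa using ENNReal.Tendsto.mul_const hq (b := D) (Or.inr (by rw [hD]; finiteness))
  obtain ⟨lam₀, hlam₀⟩ := Filter.eventually_atTop.1 ((hq.eventually_le_const one_pos).and
    (hqD.eventually_le_const (u := 2⁻¹) (by simp)))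
  refine ⟨max 1 lam₀, by positivity, fun {lam z Γ} x {y} hlam hz hy => ?_⟩
  have hlam1 : 1 ≤ lam := (le_max_left _ _).trans hlam
  obtain ⟨hq₁, hq₂⟩ := hlam₀ lam ((le_max_right _ _).trans hlam)
  exact lintegral_greenKernel_le_exp hτ hγ (zero_le_one.trans hlam1) hz hq₁ hq₂
    (hCle hlam1 hz) hy

end Decay

end AlloyData

section InteriorBoundary

variable {d : ℕ}

theorem exists_eq_single_of_l1Norm_eq_one {e : Lattice d} (he : l1Norm e = 1) :
    ∃ i, e = Pi.single i 1 ∨ e = Pi.single i (-1) := by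
  obtain ⟨i, hi⟩ : ∃ i, e i ≠ 0 := by
    by_contra! h
    simp [l1Norm, h] at he
  have hsplit := Finset.add_sum_erase Finset.univ (fun j => |e j|) (Finset.mem_univ i)
  have hrest : 0 ≤ ∑ j ∈ Finset.univ.erase i, |e j| := Finset.sum_nonneg fun _ _ => abs_nonneg _
  have hpos : 0 < |e i| := abs_pos.2 hi
  rw [l1Norm] at he
  have hsum : ∑ j ∈ Finset.univ.erase i, |e j| = 0 := by linarith
  have hzero : ∀ j ≠ i, e j = 0 := fun j hj =>
    abs_eq_zero.1 ((Finset.sum_eq_zero_iff_of_nonneg fun _ _ => abs_nonneg _).1 hsum j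
      (Finset.mem_erase.2 ⟨hj, Finset.mem_univ j⟩))
  have hsingle : e = Pi.single i (e i) := by
    ext j
    rcases eq_or_ne j i with rfl | hj
    · rw [Pi.single_eq_same]
    · rw [Pi.single_eq_of_ne hj, hzero j hj]
  refine ⟨i, ((abs_eq zero_le_one).1 (by linarith : |e i| = 1)).imp (fun h => ?_) fun h => ?_⟩
  all_goals rwa [h] at hsingle

theorem card_unitVectors_le (d : ℕ) : (unitVectors d).card ≤ 2 * d := by
  have hsub : unitVectors d ⊆ Finset.univ.image (fun i => Pi.single i (1 : ℤ)) ∪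
      Finset.univ.image fun i => Pi.single i (-1) := fun e he => by
    obtain ⟨i, rfl | rfl⟩ := exists_eq_single_of_l1Norm_eq_one ((mem_unitVectors e).1 he)
    · exact Finset.mem_union_left _ (Finset.mem_image_of_mem _ (Finset.mem_univ i))
    · exact Finset.mem_union_right _ (Finset.mem_image_of_mem _ (Finset.mem_univ i))
  calc (unitVectors d).card ≤ _ := (Finset.card_le_card hsub).trans (Finset.card_union_le _ _)
    _ ≤ d + d := add_le_add (Finset.card_image_le.trans_eq (Finset.card_fin d))
        (Finset.card_image_le.trans_eq (Finset.card_fin d))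
    _ = 2 * d := (two_mul d).symm

theorem mem_interiorBoundary_of_mem_neighbors {S : Set (Lattice d)} {j k : Lattice d}
    (hk : k ∈ S) (hj : j ∈ neighbors k) (hjS : j ∉ S) : k ∈ interiorBoundary S := by
  refine ⟨hk, ?_⟩
  have hsub : {i | i ∈ S ∧ l1Norm (k - i) = 1} ⊂ (neighbors k : Set (Lattice d)) :=
    Set.ssubset_iff_of_subset (fun i hi => mem_neighbors_comm.2 (mem_neighbors.2 hi.2)) |>.2
      ⟨j, hj, fun h => hjS h.1⟩
  calc _ < (neighbors k : Set (Lattice d)).ncard :=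
        Set.ncard_lt_ncard hsub (Finset.finite_toSet _)
    _ = (unitVectors d).card := by rw [Set.ncard_coe_finset, card_neighbors]
    _ ≤ 2 * d := card_unitVectors_le d

end InteriorBoundary

section Expectation

theorem exists_hasBoundedDensity {μ : Measure ℝ} {ρ : ℝ → ℝ} (hρ_bdd : MemLp ρ ∞ volume)
    (hρ_supp : HasCompactSupport ρ)
    (hμ : μ = volume.withDensity (fun t => ENNReal.ofReal (ρ t))) :
    ∃ K R, HasBoundedDensity μ K R := by
  obtain ⟨R, hR⟩ := hρ_supp.isCompact.isBounded.subset_closedBall 0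
  refine ⟨eLpNorm ρ ∞ volume, max R 1, hρ_bdd.eLpNorm_ne_top, by positivity, ?_⟩
  rw [hμ, ← withDensity_const, ← withDensity_indicator measurableSet_Icc]
  refine withDensity_mono ?_
  filter_upwards [ae_le_eLpNormEssSup (f := ρ)] with t ht
  by_cases htρ : t ∈ tsupport ρ
  · have htR : t ∈ Set.Icc (-max R 1) (max R 1) := abs_le.1
      ((mem_closedBall_zero_iff.1 (hR htρ)).trans (le_max_left R 1))
    rw [Set.indicator_of_mem htR, eLpNorm_exponent_top]
    exact (Real.ofReal_le_enorm _).trans ht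
  · rw [image_eq_zero_of_notMem_tsupport htρ, ENNReal.ofReal_zero]
    exact zero_le

theorem ae_forall_abs_le {d : ℕ} {μ : Measure ℝ} [IsProbabilityMeasure μ] {K : ℝ≥0∞} {R : ℝ}
    (hμ : HasBoundedDensity μ K R) : ∀ᵐ ω ∂law d μ, ∀ k, |ω k| ≤ R := by
  have hIcc : ∀ᵐ t ∂μ, t ∈ Set.Icc (-R) R :=
    ae_mono hμ.le (Measure.ae_smul_measure (ae_restrict_mem measurableSet_Icc) K)
  exact ae_all_iff.2 fun k =>
    (measurePreserving_eval_infinitePi (fun _ : Lattice d => μ) k).quasiMeasurePreserving.ae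
      (hIcc.mono fun _ => abs_le.2)

theorem integrable_norm_rpow_and_integral_le {Ω E : Type*} [MeasurableSpace Ω]
    [NormedAddCommGroup E] {P : Measure Ω} {f : Ω → E} {p A : ℝ} (hf : AEStronglyMeasurable f P)
    (hp : 0 ≤ p) (hA : 0 ≤ A) (h : ∫⁻ ω, ‖f ω‖ₑ ^ p ∂P ≤ ENNReal.ofReal A) :
    Integrable (fun ω => ‖f ω‖ ^ p) P ∧ ∫ ω, ‖f ω‖ ^ p ∂P ≤ A := by
  have hmeas : AEStronglyMeasurable (fun ω => ‖f ω‖ ^ p) P :=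
    (hf.norm.aemeasurable.pow_const p).aestronglyMeasurable
  have hnonneg : ∀ᵐ ω ∂P, 0 ≤ ‖f ω‖ ^ p := .of_forall fun _ => by positivity
  simp only [← ofReal_norm, ENNReal.ofReal_rpow_of_nonneg (norm_nonneg _) hp] at h
  refine ⟨⟨hmeas, ?_⟩, ?_⟩
  · rw [hasFiniteIntegral_iff_ofReal hnonneg]
    exact h.trans_lt ENNReal.ofReal_lt_top
  · rw [integral_eq_lintegral_of_nonneg_ae hnonneg hmeas]
    exact ENNReal.toReal_le_of_le_ofReal hA h

end Expectation

namespace AlloyData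

section GreenFunction

variable {d : ℕ} {a : AlloyData d} {μ : Measure ℝ} [IsProbabilityMeasure μ] {K : ℝ≥0∞}
  {lam τ γ : ℝ} {z : ℂ} {Γ : Set (Lattice d)}

theorem truncPotential_eq_potential {ω : Lattice d → ℝ} (hω : ∀ k, |ω k| ≤ a.R) :
    a.truncPotential ω = potential a.u ω := by
  have hclamp : a.clamp ∘ ω = ω :=
    funext fun k => clamp_eq_self ((hω k).trans (by linarith [a.R_pos]))
  ext x
  rw [truncPotential, hclamp]

theorem green_eq_greenKernel_complexPotential (hlam : 0 ≤ lam) (hz : z.im < 0)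
    {ω : Lattice d → ℝ} (hω : ∀ k, |ω k| ≤ a.R) (x y : Γ) :
    green a.u lam ω Γ z x y = greenKernel (laplacian d) Γ (a.complexPotential lam z ω) x y := by
  have hw := isDissipative_complexPotential (a := a) hlam hz ω
  unfold complexPotential at hw ⊢
  rw [truncPotential_eq_potential hω] at hw ⊢
  exact green_eq_greenKernel
    (fun k => truncPotential_eq_potential hω ▸ a.abs_truncPotential_le ω k) hw hz.ne x y

theorem exists_norm_green_eq_norm_greenKernel (hlam : 0 ≤ lam) (hz : z.im ≠ 0) (x y : Γ) :
    ∃ (z' : ℂ) (x' y' : Γ), z'.im < 0 ∧ ‖(x' : Lattice d) - y'‖ = ‖(x : Lattice d) - y‖ ∧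
      ∀ ω : Lattice d → ℝ, (∀ k, |ω k| ≤ a.R) → ‖green a.u lam ω Γ z x y‖ =
        ‖greenKernel (laplacian d) Γ (a.complexPotential lam z' ω) x' y'‖ := by
  rcases hz.lt_or_gt with hneg | hpos
  · exact ⟨z, x, y, hneg, rfl, fun ω hω => by
      rw [green_eq_greenKernel_complexPotential hlam hneg hω]⟩
  · have hneg : (starRingEnd ℂ z).im < 0 := by simpa using hpos
    refine ⟨starRingEnd ℂ z, y, x, hneg, norm_sub_rev _ _, fun ω hω => ?_⟩
    rw [← green_eq_greenKernel_complexPotential hlam hneg hω]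
    exact norm_green_conj (fun k => truncPotential_eq_potential hω ▸ a.abs_truncPotential_le ω k)
      z x y

theorem exists_integral_norm_green_rpow_le (hμ : HasBoundedDensity μ K a.R) (hτ : 0 < τ)
    (hNτ : (a.N + 1) * τ < 1) (hγ : 0 ≤ γ) :
    ∃ lam₀ : ℝ, 0 < lam₀ ∧ ∀ lam : ℝ, lam₀ ≤ lam →
      ∀ (Γ : Set (Lattice d)) (z : ℂ), z.im ≠ 0 → ∀ x y : Γ,
        Integrable (fun ω => ‖green a.u lam ω Γ z x y‖ ^ τ) (law d μ) ∧
        ∫ ω, ‖green a.u lam ω Γ z x y‖ ^ τ ∂law d μ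
          ≤ Real.exp (γ * a.L) * Real.exp (-γ * ‖(x : Lattice d) - (y : Lattice d)‖) := by
  obtain ⟨lam₀, hlam₀, hdecay⟩ := exists_lintegral_greenKernel_le_exp hμ hτ hNτ hγ
  refine ⟨lam₀, hlam₀, fun lam hlam Γ z hz x y => ?_⟩
  have hlam_nonneg : 0 ≤ lam := hlam₀.le.trans hlam
  obtain ⟨z', x', y', hz', hxy, heq⟩ :=
    exists_norm_green_eq_norm_greenKernel (a := a) hlam_nonneg hz x y
  have hae : (fun ω => ‖green a.u lam ω Γ z x y‖ ^ τ) =ᵐ[law d μ] fun ω =>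
      ‖greenKernel (laplacian d) Γ (a.complexPotential lam z' ω) x' y'‖ ^ τ :=
    (ae_forall_abs_le hμ).mono fun ω hω => by simp only [heq ω hω]
  rw [integrable_congr hae, integral_congr_ae hae, ← hxy]
  exact integrable_norm_rpow_and_integral_le
    (a.continuous_greenKernel_complexPotential hlam_nonneg hz' Γ x' y').aestronglyMeasurable
    hτ.le (by positivity) (hdecay x' hlam hz' y'.2)

end GreenFunction

end AlloyData

end AlloyModel

end

theorem mainTheorem7_general (d : ℕ) (μ : Measure ℝ) [IsProbabilityMeasure μ] {K : ℝ≥0∞} {R : ℝ}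
    (hμ : AlloyModel.HasBoundedDensity μ K R)
    (u : AlloyModel.Lattice d → ℝ) (hu_zero : u 0 ≠ 0)
    (hu_fin : (Function.support u).Finite)
    (hu_pos : ∀ k ∈ AlloyModel.interiorBoundary (Function.support u), 0 < u k)
    {τ γ : ℝ} (hτ : 0 < τ) (hτ_lt : ((Function.support u).ncard + 1) * τ < 1) (hγ : 0 ≤ γ) :
    ∃ lam₀ A : ℝ, 0 < lam₀ ∧ 0 < A ∧ ∀ lam : ℝ, lam₀ ≤ lam →
      ∀ (Γ : Set (AlloyModel.Lattice d)) (z : ℂ), z.im ≠ 0 → ∀ x y : Γ,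
        Integrable (fun ω => ‖AlloyModel.green u lam ω Γ z x y‖ ^ τ) (AlloyModel.law d μ) ∧
        ∫ ω, ‖AlloyModel.green u lam ω Γ z x y‖ ^ τ ∂AlloyModel.law d μ
          ≤ A * Real.exp (-γ * ‖(x : AlloyModel.Lattice d) - (y : AlloyModel.Lattice d)‖) := by
  let a : AlloyModel.AlloyData d :=
    { u := u
      finite_support := hu_fin
      u_zero_ne_zero := hu_zero
      u_pos := fun k hk _ hj hj₀ =>
        hu_pos k (AlloyModel.mem_interiorBoundary_of_mem_neighbors hk hj fun h => h hj₀)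
      R := R
      R_pos := hμ.pos }
  have hN : (Function.support u).ncard = a.N := Set.ncard_eq_toFinset_card _ hu_fin
  rw [hN] at hτ_lt
  obtain ⟨lam₀, hlam₀, hbound⟩ := a.exists_integral_norm_green_rpow_le hμ hτ hτ_lt hγ
  exact ⟨lam₀, Real.exp (γ * a.L), hlam₀, Real.exp_pos _, hbound⟩

theorem mainTheorem7 (d : ℕ) (hd : 1 ≤ d)
    (μ : Measure ℝ) [IsProbabilityMeasure μ]
    (ρ : ℝ → ℝ) (hρ_nonneg : ∀ t, 0 ≤ ρ t) (hρ_bdd : MemLp ρ ∞ volume)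
    (hρ_supp : HasCompactSupport ρ)
    (hμ : μ = volume.withDensity (fun t => ENNReal.ofReal (ρ t)))
    (u : AlloyModel.Lattice d → ℝ) (hu_zero : u 0 ≠ 0)
    (hu_fin : (Function.support u).Finite)
    (hu_pos : ∀ k ∈ AlloyModel.interiorBoundary (Function.support u), 0 < u k)
    (s : ℝ) (hs_pos : 0 < s) (hs_lt : s < 1 / 3) :
    ∃ lam₀ : ℝ, 0 < lam₀ ∧ ∀ lam : ℝ, lam₀ ≤ lam →
      ∃ A γ : ℝ, 0 < A ∧ 0 < γ ∧
        ∀ (Γ : Set (AlloyModel.Lattice d)) (z : ℂ), z.im ≠ 0 → ∀ x y : Γ,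
          Integrable
            (fun ω => ‖AlloyModel.green u lam ω Γ z x y‖
              ^ (s / (2 * ((Function.support u).ncard : ℝ)))) (AlloyModel.law d μ) ∧
          ∫ ω, ‖AlloyModel.green u lam ω Γ z x y‖
              ^ (s / (2 * ((Function.support u).ncard : ℝ))) ∂(AlloyModel.law d μ)
            ≤ A * Real.exp (-γ * ‖(x : AlloyModel.Lattice d) - (y : AlloyModel.Lattice d)‖) := by
  obtain ⟨K, R, hKR⟩ := AlloyModel.exists_hasBoundedDensity hρ_bdd hρ_supp hμ
  have hN : (1 : ℝ) ≤ (Function.support u).ncard := by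
    exact_mod_cast (Set.ncard_pos hu_fin).2 ⟨0, hu_zero⟩
  have hτ_lt : ((Function.support u).ncard + 1) * (s / (2 * (Function.support u).ncard)) < 1 := by
    rw [mul_div_assoc', div_lt_one (by positivity)]
    nlinarith
  obtain ⟨lam₀, A, hlam₀, hA, hbound⟩ := mainTheorem7_general d μ hKR u hu_zero hu_fin hu_pos
    (by positivity) hτ_lt zero_le_one
  exact ⟨lam₀, hlam₀, fun lam hlam => ⟨A, 1, hA, one_pos, hbound lam hlam⟩⟩
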